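/- Let $d\ge 2$. Conventions. A space is $(d-1)$-connected if it is nonempty, path connected and its homotopy groups $\pi_1,\dots,\pi_{d-1}$ are trivial; a simplicial complex or simplicial set is $(d-1)$-connected if its geometric realization is. A simplicial set is $r$-reduced if it has exactly one $i$-simplex for each $i\le r$. The size of a finite simplicial complex is its number of simplices. The size of a finite simplicial set is the number of entries of its standard representation, that is, of the list of its nondegenerate simplices together with the tables of their faces, a face $s_{i_k}\cdots s_{i_1}y$ with $y$ nondegenerate being stored as $(i_1,\dots,i_k)$ and the name of $y$. For a finite simplicial complex, $C_n(X)$ is the group of integral simplicial (oriented) chains. For a simplicial set, $C_n(X)$ is the free abelian group on all $n$-simplices, with $\partial=\sum_i(-1)^i d_i$. $Z_d(X)=\ker\partial\subseteq C_d(X)$ and $H_d(X)$ is the homology. For a chain $z\in C_d(X)$ let $\|z\|_\infty$ be the largest absolute value of the coefficient in $z$ of a simplex (of a nondegenerate simplex, if $X$ is a simplicial set). 1. There are a sequence $\{X_k\}_{k\ge1}$ of finite $d$-dimensional $(d-1)$-connected simplicial complexes and constants $c\in\mathbb N$, $a>0$, $b>1$ such that for all $k\ge1$: $H_d(X_k)\cong\mathbb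 Z$, $k\le\mathrm{size}(X_k)\le ck$, and every cycle $z_k\in Z_d(X_k)$ whose class generates $H_d(X_k)$ satisfies $\|z_k\|_\infty=2^{k}$ and $\|z_k\|_\infty\ge a\,b^{\mathrm{size}(X_k)}$. 2. There are a sequence $\{X_k\}_{k\ge1}$ of finite $d$-dimensional $(d-1)$-connected $(d-2)$-reduced simplicial sets and constants $c\in\mathbb N$, $a>0$, $b>1$ such that for all $k\ge1$: $H_d(X_k)\cong\mathbb Z$, $k\le\mathrm{size}(X_k)\le ck$, and every cycle $z_k\in Z_d(X_k)$ whose class generates $H_d(X_k)$ satisfies $\|z_k\|_\infty=2^{k-1}$ and $\|z_k\|_\infty\ge a\,b^{\mathrm{size}(X_k)}$. -/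

import Mathlib

noncomputable section

namespace BigHomology

/-! ### Homology of a sequence of abelian groups with boundary maps -/

section Homology

variable (C : ℕ → Type) [∀ n, AddCommGroup (C n)] (bd : ∀ n, C (n + 1) →+ C n)

/-- The group `Z_n` of `n`-cycles (every `0`-chain is a cycle). -/
def cycles : ∀ n, AddSubgroup (C n)
  | 0 => ⊤
  | n + 1 => (bd n).ker

/-- The group `B_n` of `n`-boundaries, as a subgroup of `Z_n`. -/
def boundaries (n : ℕ) : AddSubgroup (cycles C bd n) :=
  (bd n).range.addSubgroupOf (cycles C bd n)

/-- The homology group `H_n = Z_n / B_n`. -/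
abbrev Homology (n : ℕ) : Type := cycles C bd n ⧸ boundaries C bd n

/-- The cycle `z` generates `H_n`, i.e. its class generates `H_n` as a group. -/
def Generates {n : ℕ} (z : cycles C bd n) : Prop :=
  AddSubgroup.zmultiples (z : Homology C bd n) = ⊤

end Homology

/-! ### Connectivity -/

/-- A space is `n`-connected if it is path connected (in particular nonempty) and its homotopy
groups in degrees `1, …, n` are trivial. -/
def IsNConnected (n : ℕ) (Y : Type) [TopologicalSpace Y] : Prop :=
  PathConnectedSpace Y ∧ ∀ i, 1 ≤ i → i ≤ n → ∀ y : Y, Subsingleton (HomotopyGroup.Pi i Y y)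

/-! ### Finite simplicial complexes -/

namespace Complex

variable {m : ℕ} (K : AbstractSimplicialComplex (Fin m))

/-- The `n`-simplices of `K`. -/
abbrev Simplex (n : ℕ) : Type := {s : Finset (Fin m) // s ∈ K.faces ∧ s.card = n + 1}

/-- The simplicial `n`-chains of `K`; each simplex is oriented by the order of its vertices. -/
abbrev Chain (n : ℕ) : Type := Simplex K n →₀ ℤ

/-- The `i`-th face of a simplex: its `i`-th smallest vertex is omitted. -/
def face {n : ℕ} (s : Simplex K (n + 1)) (i : Fin (n + 2)) : Simplex K n :=
  have hc : (s.1.erase (s.1.orderEmbOfFin s.2.2 i)).card = n + 1 := by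
    rw [Finset.card_erase_of_mem (s.1.orderEmbOfFin_mem s.2.2 i), s.2.2]; rfl
  ⟨s.1.erase (s.1.orderEmbOfFin s.2.2 i),
    (K.isRelLowerSet_faces s.2.1).2 (Finset.erase_subset _ _)
      (Finset.card_pos.1 (by rw [hc]; exact Nat.succ_pos n)), hc⟩

/-- The simplicial boundary operator. -/
def bd (n : ℕ) : Chain K (n + 1) →+ Chain K n :=
  Finsupp.liftAddHom fun s => (zmultiplesHom (Chain K n))
    (∑ i : Fin (n + 2), (-1 : ℤ) ^ (i : ℕ) • Finsupp.single (face K s i) (1 : ℤ))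

/-- The geometric realization of `K`, in barycentric coordinates. -/
def Realization : Type :=
  {x : Fin m → ℝ // x ∈ stdSimplex ℝ (Fin m) ∧ Finset.univ.filter (fun v => x v ≠ 0) ∈ K.faces}

instance : TopologicalSpace (Realization K) :=
  inferInstanceAs (TopologicalSpace
    {x : Fin m → ℝ // x ∈ stdSimplex ℝ (Fin m) ∧
      Finset.univ.filter (fun v => x v ≠ 0) ∈ K.faces})

/-- `K` has dimension exactly `d`. -/
def HasDim (d : ℕ) : Prop :=
  (∀ s ∈ K.faces, s.card ≤ d + 1) ∧ ∃ s ∈ K.faces, s.card = d + 1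

/-- The size of `K`: its number of simplices. -/
def size : ℕ := K.faces.ncard

/-- The largest absolute value of a coefficient of a chain. -/
def maxCoeff {n : ℕ} (z : Chain K n) : ℕ := z.support.sup fun s => (z s).natAbs

end Complex

/-! ### Finite simplicial sets -/

namespace SimpSet

variable (X : SSet.{0})

/-- The `n`-simplices of `X`. -/
abbrev Simplex (n : ℕ) : Type := X.obj (Opposite.op (SimplexCategory.mk n))

/-- The `n`-chains of `X`: the free abelian group on all `n`-simplices. -/
abbrev Chain (n : ℕ) : Type := Simplex X n →₀ ℤ

/-- The boundary operator, the alternating sum of the face operators. -/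
def bd (n : ℕ) : Chain X (n + 1) →+ Chain X n :=
  Finsupp.liftAddHom fun x => (zmultiplesHom (Chain X n))
    (∑ i : Fin (n + 2), (-1 : ℤ) ^ (i : ℕ) • Finsupp.single (X.δ i x) (1 : ℤ))

/-- `X` has dimension exactly `d`. -/
def HasDim (d : ℕ) : Prop := X.HasDimensionLE d ∧ (X.nonDegenerate d).Nonempty

/-- `X` has a single `i`-simplex for each `i ≤ r`. -/
def IsReduced (r : ℕ) : Prop := ∀ i ≤ r, ∃! _x : Simplex X i, True

/-- The number of entries needed to list a simplex `x` together with its faces. A face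
`s_{i_k} ⋯ s_{i_1} y` with `y` nondegenerate is stored as the sequence `(i_1, …, i_k)` and the
name of `y`; here `k` is the dimension of the face minus the dimension of `y`. -/
def recordSize : (n : ℕ) → Simplex X n → ℕ
  | 0, _ => 1
  | n + 1, x => 1 + ∑ i : Fin (n + 2), ((n - (SSet.S.mk (X.δ i x)).toN.dim) + 1)

/-- The size of (the standard representation of) a finite simplicial set: the number of entries
of the list of the nondegenerate simplices and of the tables of their faces. -/
def size : ℕ := ∑ᶠ s : X.N, recordSize X s.dim s.simplex

open Classical in
/-- The largest absolute value of the coefficient of a nondegenerate simplex in a chain. -/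
def maxCoeff {n : ℕ} (z : Chain X n) : ℕ :=
  (z.support.filter (fun x => x ∈ X.nonDegenerate n)).sup fun x => (z x).natAbs

end SimpSet

end BigHomology

end

/-! Both families are telescopes of doublings. A chain of about `k` pieces, each making one
`(d-1)`-cycle homologous to twice its neighbour, has size linear in `k`, while a `d`-cycle running
through all of them doubles its coefficients from piece to piece. The two ends are closed up so
that, apart from degenerate simplices, the `d`-cycles are the multiples of a single one, with
coefficient `1` at one end and a power of two at the other. There are no nondegenerate simplices of
dimension `d + 1`, so these coefficients cannot change inside a homology class.

For complexes with `d = 2` the piece is a six-vertex Möbius band, whose boundary circle winds twice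
around its core. A triangle fills the first core, the boundary of each band is the core of the next,
and a last triangle `S` fills the last boundary. Everything but `S` arises from a vertex by
elementary expansions (`Band.expands_tower`), so it is contractible and carries no top-dimensional
cycle; a cycle is therefore determined by its coefficient on `S` (`FilledModel.eq_smul`). Suspension
(`FilledModel.suspend`) raises the dimension, keeps the coefficients and multiplies the size by a
bounded factor.

For simplicial sets, `CellData.doubling` has one vertex, cells `a_j` of dimension `d - 1` with
trivial boundary, and cells `b_i` of dimension `d` with cellular boundary `2 a_{i-1} - a_i`. Since
chains include degenerate simplices, it must also be shown that these contribute nothing to `H_d`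
(`CellData.mem_range_bd`).

Connectivity is treated uniformly by `IsTopCell`: some `d`-cell has the property that the complement
of any ball inside it is null-homotopic in the space. A map from a cube of dimension below `d` can
be smoothed inside the cell, misses a point there, and can then be contracted
(`IsTopCell.isNConnected`). The property of the cell comes from the expansions for complexes
(`isTopCell_fillMap`) and from collapsing the other cells one after another for simplicial sets
(`CellData.exists_collapse_doubling`). -/

noncomputable section

namespace BigHomology

open scoped unitInterval Topology
open Set

/-! ### Free null-homotopies of loops -/

section Cube

variable {n : ℕ}

/-- The cube map scaling by `1 + t` about the centre, clamped to the cube. -/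
def cubeStretch (t : I) (x : Fin n → I) : Fin n → I := fun j =>
  projIcc (0 : ℝ) 1 zero_le_one ((1 + (t : ℝ)) * ((x j : ℝ) - 1 / 2) + 1 / 2)

/-- A continuous function on the cube that vanishes exactly on its boundary and is `1` on the
concentric cube of half the size. -/
def cubeDepth (x : Fin n → I) : I :=
  projIcc (0 : ℝ) 1 zero_le_one (∏ j, 4 * min (x j : ℝ) (1 - x j))

theorem continuous_cubeStretch :
    Continuous fun p : I × (Fin n → I) => cubeStretch p.1 p.2 := by
  unfold cubeStretch
  refine continuous_pi fun j => continuous_projIcc.comp ?_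
  fun_prop

theorem continuous_cubeDepth : Continuous (cubeDepth (n := n)) := by
  unfold cubeDepth
  refine continuous_projIcc.comp ?_
  fun_prop

theorem cubeStretch_zero (x : Fin n → I) : cubeStretch 0 x = x := by
  funext j
  simp only [cubeStretch, Icc.coe_zero, add_zero, one_mul, sub_add_cancel]
  exact projIcc_val _ _

theorem cubeStretch_mem_boundary (t : I) {x : Fin n → I} (hx : x ∈ Cube.boundary (Fin n)) :
    cubeStretch t x ∈ Cube.boundary (Fin n) := by
  obtain ⟨j, hj⟩ := hx
  have ht := t.2.1
  refine ⟨j, hj.imp (fun h => ?_) fun h => ?_⟩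
  · simp only [cubeStretch, h]
    exact projIcc_of_le_left (zero_le_one' ℝ) (by simp; linarith)
  · simp only [cubeStretch, h]
    exact projIcc_of_right_le (zero_le_one' ℝ) (by simp; linarith)

theorem cubeDepth_of_mem_boundary {x : Fin n → I} (hx : x ∈ Cube.boundary (Fin n)) :
    cubeDepth x = 0 := by
  obtain ⟨j, hj⟩ := hx
  have : ∏ j, 4 * min (x j : ℝ) (1 - x j) = 0 :=
    Finset.prod_eq_zero (Finset.mem_univ j) (by rcases hj with h | h <;> simp [h])
  simp only [cubeDepth, this]
  exact projIcc_of_le_left (zero_le_one' ℝ) le_rfl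

/-- If stretching by `2` leaves `x` off the boundary, every coordinate lies between `1/4` and `3/4`,
so every factor of the product defining `cubeDepth` is at least `1`. -/
theorem cubeStretch_one_mem_boundary {x : Fin n → I} (hx : cubeDepth x ≠ 1) :
    cubeStretch 1 x ∈ Cube.boundary (Fin n) := by
  by_contra hb
  refine hx (projIcc_of_right_le (zero_le_one' ℝ) ?_)
  refine Finset.prod_induction _ (fun r : ℝ => 1 ≤ r)
    (fun _ _ h h' => one_le_mul_of_one_le_of_one_le h h') le_rfl fun j _ => ?_
  have h0 : ¬ (cubeStretch 1 x j = 0) := fun h => hb ⟨j, Or.inl h⟩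
  have h1 : ¬ (cubeStretch 1 x j = 1) := fun h => hb ⟨j, Or.inr h⟩
  have h0' : ¬ ((1 + 1) * ((x j : ℝ) - 1 / 2) + 1 / 2 ≤ 0) := fun h =>
    h0 (projIcc_of_le_left _ (by simpa [cubeStretch] using h))
  have h1' : ¬ (1 ≤ (1 + 1) * ((x j : ℝ) - 1 / 2) + 1 / 2) := fun h =>
    h1 (projIcc_of_right_le _ (by simpa [cubeStretch] using h))
  have : 1 / 4 ≤ min (x j : ℝ) (1 - x j) := le_min (by linarith) (by linarith)
  linarith

/-- A generalized loop that is freely null-homotopic, through maps constant on the boundary of the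
cube, is null-homotopic relative to the boundary. -/
theorem genLoop_homotopic_const {X : Type*} [TopologicalSpace X] {y : X} (hn : 0 < n)
    (f : GenLoop (Fin n) X y) (F : C(I × (Fin n → I), X)) (h0 : ∀ x, F (0, x) = f x)
    (hb : ∀ t, ∀ x ∈ Cube.boundary (Fin n), F (t, x) = F (t, 0))
    (h1 : ∀ x, F (1, x) = F (1, 0)) : GenLoop.Homotopic f GenLoop.const := by
  have hz : (0 : Fin n → I) ∈ Cube.boundary (Fin n) := ⟨⟨0, hn⟩, Or.inl rfl⟩
  have hfy : ∀ x ∈ Cube.boundary (Fin n), f x = y := f.2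
  let g : C(Fin n → I, X) := ⟨fun x => F (cubeDepth x, 0), by
    have := continuous_cubeDepth (n := n); fun_prop⟩
  have hg : ∀ x ∈ Cube.boundary (Fin n), g x = y := fun x hx => by
    simp only [g, ContinuousMap.coe_mk, cubeDepth_of_mem_boundary hx, h0, hfy _ hz]
  let G : GenLoop (Fin n) X y := ⟨g, hg⟩
  -- Where the depth is `1` the homotopy runs to time `1`, at which `F` is constant; elsewhere the
  -- stretch reaches the boundary of the cube, on which `F` depends on time only. Either way the end
  -- is `g`.
  have e1 : GenLoop.Homotopic f G := by
    refine ⟨⟨⟨⟨fun p => F (min p.1 (cubeDepth p.2), cubeStretch p.1 p.2), ?_⟩, ?_, ?_⟩, ?_⟩⟩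
    · have := continuous_cubeDepth (n := n)
      have := continuous_cubeStretch (n := n)
      fun_prop
    · intro x
      simp [cubeStretch_zero, h0]
    · intro x
      have : min (1 : I) (cubeDepth x) = cubeDepth x := min_eq_right (cubeDepth x).2.2
      simp only [this]
      by_cases hx : cubeDepth x = 1
      · change _ = F _
        rw [hx, h1]
      · change _ = F _
        rw [hb _ _ (cubeStretch_one_mem_boundary hx)]
    · intro t x hx
      have h : min t (cubeDepth x) = 0 := by
        rw [cubeDepth_of_mem_boundary hx]; exact min_eq_right t.2.1
      change F (min t (cubeDepth x), cubeStretch t x) = f x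
      rw [h, h0, hfy _ (cubeStretch_mem_boundary t hx), hfy _ hx]
  -- `g` only retraces the track `F (·, 0)`, so scaling the depth down to `0` contracts it.
  have e2 : GenLoop.Homotopic G GenLoop.const := by
    refine ⟨⟨⟨⟨fun p => F (σ p.1 * cubeDepth p.2, 0), ?_⟩, ?_, ?_⟩, ?_⟩⟩
    · have := continuous_cubeDepth (n := n)
      fun_prop
    · intro x
      change F (σ 0 * cubeDepth x, 0) = F _
      simp
    · intro x
      change F (σ 1 * cubeDepth x, 0) = y
      simp [h0, hfy _ hz]
    · intro t x hx
      change F (σ t * cubeDepth x, 0) = g x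
      rw [hg x hx, cubeDepth_of_mem_boundary hx]
      simp [h0, hfy _ hz]
  exact e1.trans e2

end Cube

/-! ### Spaces with a top cell -/

section TopCell

variable {d : ℕ} {X : Type} [TopologicalSpace X]

/-- The characteristic map `Ψ` of a top-dimensional cell of `X`: maps which are constant on the
boundary of the simplex extend to `X` by a constant, and the complement of any ball in the
interior of the cell is null-homotopic in `X`. -/
structure IsTopCell (Ψ : C(stdSimplex ℝ (Fin (d + 1)), X)) : Prop where
  extend : ∀ (Z : Type) [TopologicalSpace Z] (g : C(stdSimplex ℝ (Fin (d + 1)), Z)) (z : Z),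
    (∀ b, (∃ i, b i = 0) → g b = z) →
      ∃ G : C(X, Z), (∀ b, G (Ψ b) = g b) ∧ ∀ x, (∀ b, (∀ i, b i ≠ 0) → Ψ b ≠ x) → G x = z
  null : ∀ p : stdSimplex ℝ (Fin (d + 1)), (∀ i, 0 < p i) → ∀ ε > 0,
    (⟨Subtype.val, continuous_subtype_val⟩ :
      C({x : X // ∀ b, dist b p < ε → Ψ b ≠ x}, X)).Nullhomotopic

/-- Affine coordinates on the simplex, centred at the point with coordinates `a`. -/
def simplexCoord (a : ℝ) (b : stdSimplex ℝ (Fin (d + 1))) : Fin d → ℝ := fun i => b i.succ - a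

theorem continuous_simplexCoord (a : ℝ) : Continuous (simplexCoord (d := d) a) := by
  unfold simplexCoord
  refine continuous_pi fun i => ?_
  exact ((continuous_apply i.succ).comp continuous_subtype_val).sub continuous_const

/-- The points of the simplex with prescribed affine coordinates, clamped to `[-R, R]`. -/
def simplexOfCoord {a R : ℝ} (hR : 0 < R) (ha : 2 * R ≤ a) (hd : d * (a + 2 * R) ≤ 1) :
    C(Fin d → ℝ, stdSimplex ℝ (Fin (d + 1))) where
  toFun v := ⟨Fin.cons (1 - ∑ i, (a + max (-R) (min R (v i)))) fun i =>
      a + max (-R) (min R (v i)), by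
    have h1 : ∀ i, a + max (-R) (min R (v i)) ≤ a + 2 * R := fun i => by
      have : max (-R) (min R (v i)) ≤ R := max_le (by linarith) (min_le_left _ _)
      linarith
    have h2 : ∑ i, (a + max (-R) (min R (v i))) ≤ 1 := by
      refine (Finset.sum_le_sum fun i _ => h1 i).trans ?_
      simpa [mul_add] using hd
    refine ⟨fun i => ?_, by simp [Fin.sum_univ_succ]⟩
    refine Fin.cases ?_ (fun i => ?_) i
    · simpa using h2
    · have : -R ≤ max (-R) (min R (v i)) := le_max_left _ _
      simp only [Fin.cons_succ]
      linarith⟩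
  continuous_toFun := by
    refine Continuous.subtype_mk (continuous_pi fun i => ?_) _
    refine Fin.cases ?_ (fun i => ?_) i
    · simp only [Fin.cons_zero]
      fun_prop
    · simp only [Fin.cons_succ]
      fun_prop

theorem simplexCoord_simplexOfCoord {a R : ℝ} (hR : 0 < R) (ha : 2 * R ≤ a)
    (hd : d * (a + 2 * R) ≤ 1) {v : Fin d → ℝ} (hv : ‖v‖ ≤ R) :
    simplexCoord a (simplexOfCoord hR ha hd v) = v := by
  funext i
  have h := abs_le.1 ((norm_le_pi_norm v i).trans hv)
  change a + max (-R) (min R (v i)) - a = v i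
  rw [min_eq_right h.2, max_eq_right h.1]
  ring

theorem simplexCoord_injective (a : ℝ) : Function.Injective (simplexCoord (d := d) a) := by
  intro b b' h
  have h' : ∀ i : Fin d, b i.succ = b' i.succ := fun i => by
    have := congrFun h i
    simpa [simplexCoord] using this
  have s := b.2.2
  have s' := b'.2.2
  rw [Fin.sum_univ_succ] at s s'
  have e : ∑ i : Fin d, b.1 i.succ = ∑ i : Fin d, b'.1 i.succ :=
    Finset.sum_congr rfl fun i _ => h' i
  refine Subtype.ext (funext fun i => ?_)
  refine Fin.cases ?_ (fun i => ?_) i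
  · linarith
  · exact h' i

theorem simplexOfCoord_simplexCoord {a R : ℝ} (hR : 0 < R) (ha : 2 * R ≤ a)
    (hd : d * (a + 2 * R) ≤ 1) {b : stdSimplex ℝ (Fin (d + 1))} (hb : ‖simplexCoord a b‖ ≤ R) :
    simplexOfCoord hR ha hd (simplexCoord a b) = b :=
  simplexCoord_injective a (simplexCoord_simplexOfCoord hR ha hd hb)

theorem norm_simplexCoord_sub_lt {a ε : ℝ} {b b' : stdSimplex ℝ (Fin (d + 1))}
    (h : dist b b' < ε) : ‖simplexCoord a b - simplexCoord a b'‖ < ε := by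
  refine (pi_norm_lt_iff (dist_nonneg.trans_lt h)).2 fun i => ?_
  have := (dist_le_pi_dist b.1 b'.1 i.succ).trans_lt h
  rw [Real.dist_eq] at this
  change |b.1 i.succ - a - (b'.1 i.succ - a)| < ε
  rwa [sub_sub_sub_cancel_right]

/-- If a coordinate with positive index vanishes, its centred value is `-a`. If the `0`-th one
vanishes, the others sum to `1`, so they cannot all be below `a + 2 * R`. This places the ball of
radius `2 * R` in the interior. -/
theorem norm_simplexCoord_of_eq_zero {a R : ℝ} (ha : 2 * R ≤ a)
    (hd : d * (a + 2 * R) ≤ 1) {b : stdSimplex ℝ (Fin (d + 1))} (hb : ∃ i, b i = 0) :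
    2 * R ≤ ‖simplexCoord a b‖ := by
  obtain ⟨i, hi⟩ := hb
  revert hi
  refine Fin.cases (fun hi => ?_) (fun i hi => ?_) i
  · by_contra! h
    have s := b.2.2
    rw [Fin.sum_univ_succ] at s
    have hi' : b.1 0 = 0 := hi
    have hne : (Finset.univ : Finset (Fin d)).Nonempty := by
      by_contra hne
      rw [Finset.not_nonempty_iff_eq_empty] at hne
      rw [hne, hi'] at s
      simp at s
    have : ∑ i : Fin d, b.1 i.succ < ∑ i : Fin d, (a + 2 * R) := by
      refine Finset.sum_lt_sum_of_nonempty hne fun i _ => ?_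
      have := (abs_lt.1 ((norm_le_pi_norm _ i).trans_lt h)).2
      change b.1 i.succ - a < 2 * R at this
      linarith
    simp at this
    linarith
  · refine le_trans ?_ (norm_le_pi_norm _ i)
    simp only [simplexCoord, hi, Real.norm_eq_abs, zero_sub, abs_neg]
    exact ha.trans (le_abs_self a)

/-- Two functions recording, on `X`, the distance from the centre of a ball in the interior of the
top cell, and the position in this ball. -/
theorem IsTopCell.exists_chart {Ψ : C(stdSimplex ℝ (Fin (d + 1)), X)} (h : IsTopCell Ψ)
    {a R : ℝ} (hR : 0 < R) (ha : 2 * R ≤ a) (hd : d * (a + 2 * R) ≤ 1) :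
    ∃ (s : C(X, ℝ)) (w : C(X, Fin d → ℝ)),
      (∀ b, ‖simplexCoord a b‖ ≤ R →
        s (Ψ b) = ‖simplexCoord a b‖ / R ∧ w (Ψ b) = simplexCoord a b) ∧
      (∀ b, R ≤ ‖simplexCoord a b‖ → s (Ψ b) = 1) ∧
      ∀ x, s x < 1 → ∃ b, Ψ b = x ∧ ‖simplexCoord a b‖ < R := by
  have hc := continuous_simplexCoord (d := d) a
  -- The components are the radius capped at `1` and the position damped to `0` between the radii
  -- `R` and `2 * R`. The boundary has radius at least `2 * R`, so the pair is `(1, 0)` there and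
  -- extends by this constant.
  obtain ⟨G, hG, hG'⟩ := h.extend (ℝ × (Fin d → ℝ))
    ⟨fun b => (min 1 (‖simplexCoord a b‖ / R),
      (max 0 (min 1 (2 - ‖simplexCoord a b‖ / R))) • simplexCoord a b), by fun_prop⟩ (1, 0) (by
      intro b hb
      have h2 : 2 ≤ ‖simplexCoord a b‖ / R :=
        (le_div_iff₀ hR).2 (norm_simplexCoord_of_eq_zero ha hd hb)
      simp only [ContinuousMap.coe_mk, Prod.mk.injEq]
      refine ⟨min_eq_left (by linarith), ?_⟩
      rw [max_eq_left, zero_smul]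
      exact (min_le_right _ _).trans (by linarith))
  refine ⟨⟨fun x => (G x).1, by fun_prop⟩, ⟨fun x => (G x).2, by fun_prop⟩, fun b hb => ?_,
    fun b hb => ?_, fun x hx => ?_⟩
  · have h1 : ‖simplexCoord a b‖ / R ≤ 1 := (div_le_one hR).2 hb
    simp only [ContinuousMap.coe_mk, hG]
    refine ⟨min_eq_right h1, ?_⟩
    rw [min_eq_left (by linarith), max_eq_right zero_le_one, one_smul]
  · simp only [ContinuousMap.coe_mk, hG]
    exact min_eq_left ((one_le_div hR).2 hb)
  · simp only [ContinuousMap.coe_mk] at hx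
    by_cases hb : ∃ b, (∀ i, b i ≠ 0) ∧ Ψ b = x
    · obtain ⟨b, -, rfl⟩ := hb
      refine ⟨b, rfl, ?_⟩
      rw [hG] at hx
      simpa [div_lt_one hR] using hx
    · push Not at hb
      rw [hG' x hb] at hx
      exact absurd hx (lt_irrefl _)

/-- Every point of `X` avoids a ball in the interior of the top cell. -/
theorem IsTopCell.exists_ball_avoiding {Ψ : C(stdSimplex ℝ (Fin (d + 1)), X)} (h : IsTopCell Ψ)
    (hd : 0 < d) (y : X) : ∃ a R : ℝ, 0 < R ∧ 2 * R ≤ a ∧ d * (a + 2 * R) ≤ 1 ∧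
      ∀ b, ‖simplexCoord a b‖ < R → Ψ b ≠ y := by
  have hd' : (0 : ℝ) < d := by exact_mod_cast hd
  -- The factor `16` leaves room for two disjoint balls of radius `r`, centred at the points with
  -- affine coordinates `4 * r` and `8 * r`.
  set r : ℝ := 1 / (16 * d) with hr
  have hr0 : 0 < r := by positivity
  have hdr : d * r = 1 / 16 := by rw [hr]; field_simp
  have e1 : (d : ℝ) * (4 * r + 2 * r) ≤ 1 := by linarith
  have e2 : (d : ℝ) * (8 * r + 2 * r) ≤ 1 := by linarith
  by_cases h1 : ∀ b, ‖simplexCoord (4 * r) b‖ < r → Ψ b ≠ y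
  · exact ⟨4 * r, r, hr0, by linarith, e1, h1⟩
  refine ⟨8 * r, r, hr0, by linarith, e2, fun b' hb' hy' => ?_⟩
  push Not at h1
  obtain ⟨b, hb, hy⟩ := h1
  -- The images of the two balls are separated by `s`: it is below `1` on the first and equal to `1`
  -- on the second.
  obtain ⟨s, w, hs, hs', -⟩ := h.exists_chart hr0 (by linarith : 2 * r ≤ 4 * r) e1
  have k1 := (hs b hb.le).1
  have k2 : s (Ψ b') = 1 := by
    refine hs' b' (le_trans ?_ (norm_le_pi_norm _ ⟨0, hd⟩))
    have := (abs_lt.1 ((norm_le_pi_norm _ ⟨0, hd⟩).trans_lt hb')).1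
    simp only [simplexCoord] at this ⊢
    rw [Real.norm_eq_abs]
    exact le_trans (by linarith) (le_abs_self _)
  rw [hy, ← hy', k2, eq_div_iff hr0.ne'] at k1
  linarith

/-- Smooth approximation: a map from a cube of dimension less than `d` can be moved off a ball in
the interior of the top cell, without changing it outside a given larger ball. -/
theorem IsTopCell.exists_homotopy_avoiding {Ψ : C(stdSimplex ℝ (Fin (d + 1)), X)}
    (h : IsTopCell Ψ) {n : ℕ} (hn : n < d) {a R : ℝ} (hR : 0 < R) (ha : 2 * R ≤ a)
    (hd : d * (a + 2 * R) ≤ 1) (f : C(Fin n → I, X)) :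
    ∃ F : C(I × (Fin n → I), X), (∀ x, F (0, x) = f x) ∧
      (∀ t x, (∀ b, ‖simplexCoord a b‖ < R → Ψ b ≠ f x) → F (t, x) = f x) ∧
      ∃ p : stdSimplex ℝ (Fin (d + 1)), (∀ i, 0 < p i) ∧ ∃ ε > 0,
        ∀ x b, dist b p < ε → Ψ b ≠ F (1, x) := by
  obtain ⟨s, w, hsw, hs1, hs⟩ := h.exists_chart hR ha hd
  have hw : ∀ x, s x < 1 → ‖w x‖ = s x * R ∧ Ψ (simplexOfCoord hR ha hd (w x)) = x := by
    intro x hx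
    obtain ⟨b, rfl, hb⟩ := hs x hx
    obtain ⟨e1, e2⟩ := hsw b hb.le
    rw [e1, e2, simplexOfCoord_simplexCoord hR ha hd hb.le, div_mul_cancel₀ _ hR.ne']
    exact ⟨rfl, rfl⟩
  -- Clamping extends `w ∘ f` to all of `ℝⁿ`, where it has a `C¹` approximation `q`. As `n < d`, the
  -- range of `q` has dense complement, which yields a missed point `v` near the centre.
  obtain ⟨q, hq, hqw, -⟩ := Continuous.exists_contDiff_approx (E := Fin n → ℝ) 1
    (f := fun u => w (f fun j => projIcc (0 : ℝ) 1 zero_le_one (u j)))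
    (ε := fun _ => R / 8) (by
      have : Continuous (projIcc (0 : ℝ) 1 zero_le_one) := continuous_projIcc
      fun_prop) continuous_const (fun _ => by positivity)
  obtain ⟨v, hv, hvq⟩ := (hq.dense_compl_range_of_finrank_lt_finrank
    (by simpa using hn)).exists_dist_lt 0 (by positivity : 0 < R / 8)
  have hvq' : ‖v‖ < R / 8 := by simpa [dist_comm] using hvq
  let q' : C(Fin n → I, Fin d → ℝ) := ⟨fun x => q fun j => (x j : ℝ), by
    have := hq.continuous; fun_prop⟩
  have hq' : ∀ x, ‖q' x - w (f x)‖ < R / 8 := fun x => by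
    have := hqw fun j => (x j : ℝ)
    simpa [dist_eq_norm, q'] using this
  obtain ⟨ε, hε, hεq⟩ : ∃ ε > 0, ∀ x, ε ≤ ‖q' x - v‖ := by
    obtain ⟨x₀, -, hx₀⟩ := isCompact_univ.exists_isMinOn (univ_nonempty (α := Fin n → I))
      (f := fun x => ‖q' x - v‖) (by fun_prop)
    refine ⟨‖q' x₀ - v‖, ?_, fun x => hx₀ (mem_univ x)⟩
    rw [gt_iff_lt, norm_pos_iff, sub_ne_zero]
    exact fun e => hv ⟨_, e⟩
  -- The cutoff is `1` up to relative radius `1/2` and `0` from `3/4` on. The deformation onto `q'`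
  -- is thus complete in the inner half of the ball and stationary before the case distinction at
  -- `7/8` in `F`.
  let lam : ℝ → ℝ := fun r => max 0 (min 1 (3 - 4 * r))
  have hlam : Continuous lam := by fun_prop
  have hlam0 : ∀ r, 0 ≤ lam r := fun r => le_max_left _ _
  have hlam1 : ∀ r, lam r ≤ 1 := fun r => max_le zero_le_one (min_le_left _ _)
  let F : I × (Fin n → I) → X := fun z => if s (f z.2) ≤ 7 / 8 then
    Ψ (simplexOfCoord hR ha hd
      (w (f z.2) + ((z.1 : ℝ) * lam (s (f z.2))) • (q' z.2 - w (f z.2)))) else f z.2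
  have hF : Continuous F := by
    refine Continuous.if_le (by fun_prop) (by fun_prop) (by fun_prop) continuous_const ?_
    intro z hz
    have : lam (s (f z.2)) = 0 := by
      simp only [lam, hz]
      norm_num
    rw [this, mul_zero, zero_smul, add_zero, (hw _ (by rw [hz]; norm_num)).2]
  refine ⟨⟨F, hF⟩, fun x => ?_, fun t x hx => ?_, simplexOfCoord hR ha hd v, ?_, min ε (R / 8),
    by positivity, ?_⟩
  · simp only [F, ContinuousMap.coe_mk]
    split_ifs with hx
    · simp [(hw _ (by linarith : s (f x) < 1)).2]
    · rfl
  · have : ¬ s (f x) ≤ 7 / 8 := fun hle => by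
      obtain ⟨b, hb, hb'⟩ := hs (f x) (by linarith)
      exact hx b hb' hb
    simp [F, this]
  · have hp : simplexCoord a (simplexOfCoord hR ha hd v) = v :=
      simplexCoord_simplexOfCoord hR ha hd (by linarith)
    intro i
    refine lt_of_le_of_ne ((simplexOfCoord hR ha hd v).2.1 i) fun hi => ?_
    have := norm_simplexCoord_of_eq_zero ha hd ⟨i, hi.symm⟩
    rw [hp] at this
    linarith
  · intro x b hb hbx
    have hbv : ‖simplexCoord a b - v‖ < min ε (R / 8) := by
      rw [← simplexCoord_simplexOfCoord hR ha hd (by linarith : ‖v‖ ≤ R)]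
      exact norm_simplexCoord_sub_lt hb
    have hbε := hbv.trans_le (min_le_left _ _)
    have hbR := hbv.trans_le (min_le_right _ _)
    have hb4 : ‖simplexCoord a b‖ < R / 4 := by
      have := norm_le_norm_add_norm_sub' (simplexCoord a b) v
      linarith
    obtain ⟨e1, e2⟩ := hsw b (by linarith)
    simp only [ContinuousMap.coe_mk, F] at hbx
    split_ifs at hbx with hx
    · obtain ⟨k1, k2⟩ := hw (f x) (by linarith)
      set u := w (f x) + (((1 : I) : ℝ) * lam (s (f x))) • (q' x - w (f x)) with hu
      have hl : ‖(((1 : I) : ℝ) * lam (s (f x))) • (q' x - w (f x))‖ ≤ R / 8 := by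
        rw [norm_smul, Icc.coe_one, one_mul, Real.norm_of_nonneg (hlam0 _)]
        calc _ ≤ 1 * ‖q' x - w (f x)‖ := by gcongr; exact hlam1 _
          _ ≤ R / 8 := by rw [one_mul]; exact (hq' x).le
      have hsR : s (f x) * R ≤ 7 / 8 * R := by gcongr
      have huR : ‖u‖ ≤ R := (norm_add_le _ _).trans (by linarith)
      have hcu : simplexCoord a (simplexOfCoord hR ha hd u) = u :=
        simplexCoord_simplexOfCoord hR ha hd huR
      have e3 := (hsw (simplexOfCoord hR ha hd u) (by rwa [hcu])).2
      rw [← hbx, e2, hcu] at e3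
      -- The endpoint has norm below `R / 4` and the deformation moves by at most `R / 8`, so the
      -- starting point lies in the inner half. There the endpoint is `q' x`, which keeps distance
      -- `ε` from `v`.
      have hw4 : ‖w (f x)‖ < R / 2 := by
        have : ‖w (f x)‖ ≤ ‖u‖ + ‖(((1 : I) : ℝ) * lam (s (f x))) • (q' x - w (f x))‖ := by
          have : w (f x) = u - (((1 : I) : ℝ) * lam (s (f x))) • (q' x - w (f x)) := by
            rw [hu]; abel
          calc _ = ‖u - (((1 : I) : ℝ) * lam (s (f x))) • (q' x - w (f x))‖ := by rw [← this]
            _ ≤ _ := norm_sub_le _ _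
        rw [← e3] at this
        linarith
      have hs2 : s (f x) < 1 / 2 := by
        by_contra! hge
        have : 1 / 2 * R ≤ s (f x) * R := by gcongr
        linarith
      have hl1 : lam (s (f x)) = 1 := by
        simp only [lam]
        rw [min_eq_left (by linarith), max_eq_right zero_le_one]
      have huq : u = q' x := by
        rw [hu, hl1, Icc.coe_one, mul_one, one_smul, add_sub_cancel]
      rw [e3, huq] at hbε
      exact absurd (hεq x) (not_le.2 hbε)
    · rw [← hbx, e1] at hx
      rw [div_le_iff₀ hR] at hx
      linarith

/-- A space with a top cell of dimension `d` is `(d - 1)`-connected. -/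
theorem IsTopCell.isNConnected {Ψ : C(stdSimplex ℝ (Fin (d + 1)), X)} (h : IsTopCell Ψ)
    (hd : 0 < d) : IsNConnected (d - 1) X := by
  refine ⟨?_, fun n hn hnd y => ?_⟩
  · let v : stdSimplex ℝ (Fin (d + 1)) := stdSimplex.vertex 0
    have hv : ∃ i, v i = 0 := ⟨Fin.last d, by
      have : Fin.last d ≠ 0 := by rw [Ne, Fin.last_eq_zero_iff]; omega
      simp [v, this]⟩
    -- Both `Ψ v` and `y` avoid a suitable ball; the null-homotopy of the complement of a ball
    -- traces a path from each of them to the same point `q`.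
    have key : ∀ y, Joined (Ψ v) y := by
      intro y
      obtain ⟨a, R, hR, ha, hda, hy⟩ := h.exists_ball_avoiding hd y
      have hv' : ∀ b, ‖simplexCoord a b‖ < R → Ψ b ≠ Ψ v := by
        obtain ⟨s, w, hs, hs', -⟩ := h.exists_chart hR ha hda
        intro b hb e
        have e1 := (hs b hb.le).1
        rw [e, hs' v (by linarith [norm_simplexCoord_of_eq_zero ha hda hv]),
          eq_div_iff hR.ne'] at e1
        linarith
      have h0 : simplexCoord a (simplexOfCoord hR ha hda 0) = 0 :=
        simplexCoord_simplexOfCoord hR ha hda (by simpa using hR.le)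
      obtain ⟨q, ⟨H⟩⟩ := h.null (simplexOfCoord hR ha hda 0) (fun i => by
        refine lt_of_le_of_ne ((simplexOfCoord hR ha hda 0).2.1 i) fun hi => ?_
        have := norm_simplexCoord_of_eq_zero ha hda ⟨i, hi.symm⟩
        rw [h0, norm_zero] at this
        linarith) R hR
      have hmem : ∀ z, (∀ b, ‖simplexCoord a b‖ < R → Ψ b ≠ z) →
          ∀ b, dist b (simplexOfCoord hR ha hda 0) < R → Ψ b ≠ z := by
        intro z hz b hb
        refine hz b ?_
        rw [← sub_zero (simplexCoord a b), ← h0]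
        exact norm_simplexCoord_sub_lt hb
      have j : ∀ z, (∀ b, ‖simplexCoord a b‖ < R → Ψ b ≠ z) → Joined z q := fun z hz =>
        ⟨H.evalAt ⟨z, hmem z hz⟩⟩
      exact (j _ hv').trans (j _ hy).symm
    exact ⟨⟨Ψ v⟩, fun x y => (key x).symm.trans (key y)⟩
  · suffices H : ∀ f : GenLoop (Fin n) X y, GenLoop.Homotopic f GenLoop.const by
      constructor
      intro f g
      induction f using Quotient.inductionOn
      induction g using Quotient.inductionOn
      exact Quotient.sound ((H _).trans (H _).symm)
    intro f
    obtain ⟨a, R, hR, ha, hda, hy⟩ := h.exists_ball_avoiding hd y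
    obtain ⟨F, hF0, hFy, p, hp, ε, hε, hF1⟩ :=
      h.exists_homotopy_avoiding (by omega : n < d) hR ha hda f.1
    have hfy : ∀ x ∈ Cube.boundary (Fin n), f.1 x = y := f.2
    have hFb : ∀ t, ∀ x ∈ Cube.boundary (Fin n), F (t, x) = y := fun t x hx => by
      rw [hFy t x (by rw [hfy x hx]; exact hy), hfy x hx]
    let g : GenLoop (Fin n) X y := ⟨⟨fun x => F (1, x), by fun_prop⟩, fun x hx => hFb 1 x hx⟩
    have e1 : GenLoop.Homotopic f g :=
      ⟨⟨⟨F, hF0, fun x => rfl⟩, fun t x hx => (hFb t x hx).trans (hfy x hx).symm⟩⟩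
    refine e1.trans ?_
    -- `H` is only a free null-homotopy, but at each time it is a function of the point of `X`. It
    -- is therefore constant on the boundary of the cube, as `genLoop_homotopic_const` requires.
    obtain ⟨q, ⟨H⟩⟩ := h.null p hp ε hε
    let k : C(Fin n → I, {x : X // ∀ b, dist b p < ε → Ψ b ≠ x}) :=
      ⟨fun x => ⟨F (1, x), hF1 x⟩, by fun_prop⟩
    refine genLoop_homotopic_const (by omega) g ⟨fun z => H (z.1, k z.2), by fun_prop⟩
      (fun x => ?_) (fun t x hx => ?_) fun x => ?_
    · simp only [k, g, ContinuousMap.coe_mk, ContinuousMap.Homotopy.apply_zero]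
      rfl
    · have h0 : (0 : Fin n → I) ∈ Cube.boundary (Fin n) := ⟨⟨0, by omega⟩, Or.inl rfl⟩
      have : k x = k 0 := Subtype.ext ((hFb 1 x hx).trans (hFb 1 0 h0).symm)
      simp [this]
    · simp

end TopCell

end BigHomology

end

set_option linter.unusedSectionVars false
noncomputable section

namespace BigHomology

open scoped unitInterval Topology
open Set

/-! ### Elementary expansions -/

/-- The families of finite sets obtained from a vertex by elementary expansions: one adds a simplex
`insert v τ` together with its free face `τ`. -/
inductive Expands {V : Type} [DecidableEq V] : Set (Finset V) → Prop
  | vertex (v : V) : Expands {{v}}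
  | step {F : Set (Finset V)} {τ : Finset V} {v : V} : Expands F → τ.Nonempty → v ∉ τ →
      (∀ s ∈ F, ¬ τ ⊆ s) → (∀ s ⊂ insert v τ, s.Nonempty → s ≠ τ → s ∈ F) →
      Expands (insert τ (insert (insert v τ) F))

section Geom

variable {V : Type} [Fintype V] [DecidableEq V]

/-- The geometric realization of a family of finite sets, in barycentric coordinates. -/
abbrev Geom (F : Set (Finset V)) : Type :=
  {x : V → ℝ // x ∈ stdSimplex ℝ V ∧ Finset.univ.filter (fun v => x v ≠ 0) ∈ F}

theorem mem_expansion {F : Set (Finset V)} {τ : Finset V} {v : V}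
    (h : ∀ s ⊂ insert v τ, s.Nonempty → s ≠ τ → s ∈ F) {s : Finset V} (hs : s.Nonempty)
    (hsub : s ⊆ insert v τ) : s ∈ insert τ (insert (insert v τ) F) := by
  by_cases h1 : s = τ
  · exact Or.inl h1
  by_cases h2 : s = insert v τ
  · exact Or.inr (Or.inl h2)
  · exact Or.inr (Or.inr (h s (Finset.ssubset_iff_subset_ne.2 ⟨hsub, h2⟩) hs h1))

theorem support_nonempty {x : V → ℝ} (hx : x ∈ stdSimplex ℝ V) :
    (Finset.univ.filter fun v => x v ≠ 0).Nonempty := by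
  by_contra h
  rw [Finset.not_nonempty_iff_eq_empty, Finset.filter_eq_empty_iff] at h
  have := hx.2
  rw [Finset.sum_eq_zero fun v _ => not_not.1 (h (Finset.mem_univ v))] at this
  exact zero_ne_one this

/-- The flow pushing a simplex `insert v τ` from its face `τ` towards the opposite faces. -/
def hornPush (τ : Finset V) (hτ : τ.Nonempty) (v : V) (t : ℝ) (x : V → ℝ) : V → ℝ := fun u =>
  x u + t * τ.inf' hτ x * ((if u = v then (τ.card : ℝ) else 0) - if u ∈ τ then 1 else 0)

theorem continuous_hornPush (τ : Finset V) (hτ : τ.Nonempty) (v : V) :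
    Continuous fun p : ℝ × (V → ℝ) => hornPush τ hτ v p.1 p.2 := by
  have : Continuous fun x : V → ℝ => τ.inf' hτ x := by
    have := Continuous.finset_inf'_apply hτ (f := fun u (x : V → ℝ) => x u)
      fun u _ => continuous_apply u
    exact this
  unfold hornPush
  refine continuous_pi fun u => ?_
  fun_prop

theorem hornPush_zero (τ : Finset V) (hτ : τ.Nonempty) (v : V) (x : V → ℝ) :
    hornPush τ hτ v 0 x = x := by
  funext u
  simp [hornPush]

/-- Such points are fixed. This covers all points of a complex none of whose simplices contains `τ`.
-/
theorem hornPush_of_inf_eq_zero {τ : Finset V} {hτ : τ.Nonempty} {v : V} (t : ℝ) {x : V → ℝ}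
    (hx : τ.inf' hτ x = 0) : hornPush τ hτ v t x = x := by
  funext u
  simp [hornPush, hx]

theorem inf_nonneg {τ : Finset V} (hτ : τ.Nonempty) {x : V → ℝ} (hx : x ∈ stdSimplex ℝ V) :
    0 ≤ τ.inf' hτ x := (Finset.le_inf'_iff hτ x).2 fun u _ => hx.1 u

/-- Each vertex of `τ` loses at most the smallest coordinate on `τ`, and the total loss is credited
to `v`. -/
theorem hornPush_mem_stdSimplex {τ : Finset V} (hτ : τ.Nonempty) {v : V} (hv : v ∉ τ) {t : ℝ}
    (h0 : 0 ≤ t) (h1 : t ≤ 1) {x : V → ℝ} (hx : x ∈ stdSimplex ℝ V) :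
    hornPush τ hτ v t x ∈ stdSimplex ℝ V := by
  have hm := inf_nonneg hτ hx
  constructor
  · intro u
    have := hx.1 u
    simp only [hornPush]
    by_cases hu : u ∈ τ
    · have huv : u ≠ v := fun e => hv (e ▸ hu)
      have hle : τ.inf' hτ x ≤ x u := Finset.inf'_le x hu
      simp only [huv, hu, if_true, if_false]
      nlinarith
    · simp only [hu, if_false, sub_zero]
      split_ifs <;> positivity
  · simp only [hornPush, Finset.sum_add_distrib, ← Finset.mul_sum, Finset.sum_sub_distrib, hx.2]
    simp

theorem hornPush_support {τ : Finset V} (hτ : τ.Nonempty) {v : V} (t : ℝ)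
    {x : V → ℝ} {u : V} (hu : u ∉ insert v τ) : hornPush τ hτ v t x u = x u := by
  rw [Finset.mem_insert, not_or] at hu
  simp [hornPush, hu.1, hu.2]

/-- After the full push some coordinate in `τ` vanishes. -/
theorem exists_hornPush_one_eq_zero {τ : Finset V} (hτ : τ.Nonempty) {v : V} (hv : v ∉ τ)
    (x : V → ℝ) : ∃ u ∈ τ, hornPush τ hτ v 1 x u = 0 := by
  obtain ⟨u, hu, h⟩ := τ.exists_mem_eq_inf' hτ x
  refine ⟨u, hu, ?_⟩
  have huv : u ≠ v := fun e => hv (e ▸ hu)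
  simp [hornPush, huv, hu, h]

theorem subset_support_of_inf_ne_zero {τ : Finset V} (hτ : τ.Nonempty) {x : V → ℝ}
    (hx : x ∈ stdSimplex ℝ V) (h : τ.inf' hτ x ≠ 0) :
    τ ⊆ Finset.univ.filter fun v => x v ≠ 0 := by
  intro u hu
  have h0 := lt_of_le_of_ne (inf_nonneg hτ hx) h.symm
  simpa using (h0.trans_le (Finset.inf'_le x hu)).ne'

/-- The realization of a family built by elementary expansions is contractible. -/
theorem Expands.contractibleSpace {F : Set (Finset V)} (hF : Expands F) :
    ContractibleSpace (Geom F) := by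
  induction hF with
  | vertex v =>
    have hu : Unique (Geom ({{v}} : Set (Finset V))) := by
      have key : ∀ x : Geom ({{v}} : Set (Finset V)), x.1 = Pi.single v 1 := by
        intro x
        have hs : Finset.univ.filter (fun u => x.1 u ≠ 0) = {v} := x.2.2
        have h0 : ∀ u, u ≠ v → x.1 u = 0 := by
          intro u hu
          by_contra h
          have : u ∈ Finset.univ.filter (fun u => x.1 u ≠ 0) := by simpa using h
          rw [hs, Finset.mem_singleton] at this
          exact hu this
        have h1 := x.2.1.2
        rw [Finset.sum_eq_single v (fun u _ hu => h0 u hu) (by simp)] at h1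
        funext u
        by_cases hu : u = v
        · rw [hu, h1, Pi.single_eq_same]
        · rw [h0 u hu, Pi.single_eq_of_ne hu]
      refine ⟨⟨⟨Pi.single v 1, single_mem_stdSimplex ℝ v, ?_⟩⟩, fun x => Subtype.ext (key x)⟩
      have : Finset.univ.filter (fun u => (Pi.single v 1 : V → ℝ) u ≠ 0) = {v} := by
        ext u
        by_cases hu : u = v
        · simp [hu]
        · simp [hu]
      exact this
    infer_instance
  | @step F τ v hF hτ hv hfree hfaces ih =>
    have hmono : ∀ s ∈ F, s ∈ insert τ (insert (insert v τ) F) := fun s hs =>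
      Or.inr (Or.inr hs)
    have hsup : ∀ x : Geom (insert τ (insert (insert v τ) F)), ∀ t : ℝ, 0 ≤ t → t ≤ 1 →
        hornPush τ hτ v t x.1 ≠ x.1 →
        Finset.univ.filter (fun u => hornPush τ hτ v t x.1 u ≠ 0) ⊆ insert v τ := by
      intro x t h0 h1 hne
      have hm : τ.inf' hτ x.1 ≠ 0 := fun e => hne (hornPush_of_inf_eq_zero t e)
      have hsub := subset_support_of_inf_ne_zero hτ x.2.1 hm
      have hx : Finset.univ.filter (fun u => x.1 u ≠ 0) ⊆ insert v τ := by
        rcases x.2.2 with h | h | h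
        · rw [h]; exact Finset.subset_insert _ _
        · rw [h]
        · exact absurd hsub (hfree _ h)
      intro u hu
      by_contra hu'
      rw [Finset.mem_filter, hornPush_support hτ t hu'] at hu
      exact hu' (hx (by simpa using hu.2))
    have hmem : ∀ x : Geom (insert τ (insert (insert v τ) F)), ∀ t : ℝ, 0 ≤ t → t ≤ 1 →
        Finset.univ.filter (fun u => hornPush τ hτ v t x.1 u ≠ 0) ∈
          insert τ (insert (insert v τ) F) := by
      intro x t h0 h1
      by_cases hne : hornPush τ hτ v t x.1 = x.1
      · rw [hne]; exact x.2.2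
      · exact mem_expansion hfaces
          (support_nonempty (hornPush_mem_stdSimplex hτ hv h0 h1 x.2.1)) (hsup x t h0 h1 hne)
    -- The fully pushed point has a zero coordinate in `τ`, so its support is neither of the two
    -- added simplices.
    have hmem1 : ∀ x : Geom (insert τ (insert (insert v τ) F)),
        Finset.univ.filter (fun u => hornPush τ hτ v 1 x.1 u ≠ 0) ∈ F := by
      intro x
      obtain ⟨u, hu, hu0⟩ := exists_hornPush_one_eq_zero hτ hv x.1
      have hnot : ¬ τ ⊆ Finset.univ.filter (fun u => hornPush τ hτ v 1 x.1 u ≠ 0) := fun h => by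
        have := h hu
        simp [hu0] at this
      rcases hmem x 1 zero_le_one le_rfl with h | h | h
      · exact absurd h.symm.subset hnot
      · exact absurd ((Finset.subset_insert _ _).trans h.symm.subset) hnot
      · exact h
    let i : C(Geom F, Geom (insert τ (insert (insert v τ) F))) :=
      ⟨fun x => ⟨x.1, x.2.1, hmono _ x.2.2⟩, by fun_prop⟩
    have hc := continuous_hornPush τ hτ v
    let r : C(Geom (insert τ (insert (insert v τ) F)), Geom F) :=
      ⟨fun x => ⟨hornPush τ hτ v 1 x.1,
        hornPush_mem_stdSimplex hτ hv zero_le_one le_rfl x.2.1, hmem1 x⟩, by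
        refine Continuous.subtype_mk ?_ _
        exact hc.comp (continuous_const.prodMk continuous_subtype_val)⟩
    have e1 : r.comp i = ContinuousMap.id _ := by
      ext x : 1
      refine Subtype.ext (hornPush_of_inf_eq_zero 1 ?_)
      by_contra hm
      exact hfree _ x.2.2 (subset_support_of_inf_ne_zero hτ x.2.1 hm)
    have e2 : (ContinuousMap.id _).Homotopic (i.comp r) := by
      refine ⟨⟨⟨fun p => ⟨hornPush τ hτ v p.1 p.2.1,
        hornPush_mem_stdSimplex hτ hv p.1.2.1 p.1.2.2 p.2.2.1, hmem p.2 _ p.1.2.1 p.1.2.2⟩,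
        ?_⟩, fun x => ?_, fun x => ?_⟩⟩
      · refine Continuous.subtype_mk ?_ _
        exact hc.comp ((continuous_subtype_val.comp continuous_fst).prodMk
          (continuous_subtype_val.comp continuous_snd))
      · exact Subtype.ext (hornPush_zero _ _ _ _)
      · rfl
    let e : ContinuousMap.HomotopyEquiv (Geom (insert τ (insert (insert v τ) F))) (Geom F) :=
      ⟨r, i, e2.symm, by rw [e1]⟩
    exact e.contractibleSpace

/-! ### Pushing away from an interior point -/

/-- The weight of `P` in the largest multiple of `P` that is at most `x` on `S`. -/
def radialWeight (S : Finset V) (hS : S.Nonempty) (P x : V → ℝ) : ℝ := S.inf' hS fun u => x u / P u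

/-- The point from which `x` is obtained by mixing with `P` in proportion `c`. -/
def radialPush (P : V → ℝ) (c : ℝ) (x : V → ℝ) : V → ℝ := fun u => (1 - c)⁻¹ * (x u - c * P u)

theorem continuous_radialWeight (S : Finset V) (hS : S.Nonempty) (P : V → ℝ) :
    Continuous (radialWeight S hS P) := by
  have := Continuous.finset_inf'_apply hS (f := fun u (x : V → ℝ) => x u / P u)
    fun u _ => (continuous_apply u).div_const _
  exact this

theorem radialPush_zero (P x : V → ℝ) : radialPush P 0 x = x := by
  funext u
  simp [radialPush]

section Radial

variable {S : Finset V} {hS : S.Nonempty} {P : V → ℝ} (hP : ∀ u ∈ S, 0 < P u)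
  (hP0 : ∀ u ∉ S, P u = 0) (hPs : P ∈ stdSimplex ℝ V)

include hP in
theorem radialWeight_nonneg {x : V → ℝ} (hx : x ∈ stdSimplex ℝ V) : 0 ≤ radialWeight S hS P x :=
  (Finset.le_inf'_iff hS _).2 fun u hu => div_nonneg (hx.1 u) (hP u hu).le

include hP in
theorem radialWeight_mul_le {x : V → ℝ} {u : V} (hu : u ∈ S) :
    radialWeight S hS P x * P u ≤ x u :=
  (le_div_iff₀ (hP u hu)).1 (Finset.inf'_le _ hu)

include hP hP0 hPs in
-- A weight of at least `1` makes `x` dominate `P` in every coordinate; both have total mass `1`, so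
-- they would agree.
theorem radialWeight_lt_one {x : V → ℝ} (hx : x ∈ stdSimplex ℝ V) (hne : x ≠ P) :
    radialWeight S hS P x < 1 := by
  by_contra! h
  have hle : ∀ u, 0 ≤ x u - P u := by
    intro u
    by_cases hu : u ∈ S
    · have h1 := radialWeight_mul_le (hS := hS) hP (x := x) hu
      have h2 := hP u hu
      nlinarith
    · rw [hP0 u hu, sub_zero]
      exact hx.1 u
  have hs : ∑ u, (x u - P u) = 0 := by rw [Finset.sum_sub_distrib, hx.2, hPs.2, sub_self]
  refine hne (funext fun u => sub_eq_zero.1 ?_)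
  exact (Finset.sum_eq_zero_iff_of_nonneg fun u _ => hle u).1 hs u (Finset.mem_univ u)

include hP hP0 hPs in
theorem radialPush_mem_stdSimplex {x : V → ℝ} (hx : x ∈ stdSimplex ℝ V) {c : ℝ}
    (hc : c ≤ radialWeight S hS P x) (hc1 : c < 1) : radialPush P c x ∈ stdSimplex ℝ V := by
  have h1 : 0 < 1 - c := sub_pos.2 hc1
  refine ⟨fun u => mul_nonneg (inv_nonneg.2 h1.le) ?_, ?_⟩
  · by_cases hu : u ∈ S
    · have h1 := radialWeight_mul_le (hS := hS) hP (x := x) hu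
      have h2 := hP u hu
      nlinarith
    · rw [hP0 u hu, mul_zero, sub_zero]
      exact hx.1 u
  · simp only [radialPush]
    rw [← Finset.mul_sum, Finset.sum_sub_distrib, ← Finset.mul_sum, hx.2, hPs.2, mul_one,
      inv_mul_cancel₀ h1.ne']

include hP in
theorem exists_radialPush_eq_zero (x : V → ℝ) :
    ∃ u ∈ S, radialPush P (radialWeight S hS P x) x u = 0 := by
  obtain ⟨u, hu, h⟩ := S.exists_mem_eq_inf' hS fun u => x u / P u
  refine ⟨u, hu, ?_⟩
  rw [radialPush, radialWeight, h, div_mul_cancel₀ _ (hP u hu).ne', sub_self, mul_zero]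

end Radial

/-! ### The top cell of a complex obtained by filling a sphere in a contractible complex -/

section Fill

variable {d : ℕ} {S : Finset V} (hS : S.card = d + 1)

/-- The characteristic map of the simplex `S`, as a map to functions on the vertices. -/
def fillFun (b : Fin (d + 1) → ℝ) : V → ℝ := fun u =>
  if h : u ∈ S then b ((S.equivFinOfCardEq hS) ⟨u, h⟩) else 0

theorem fillFun_mem (b : Fin (d + 1) → ℝ) (i : Fin (d + 1)) :
    fillFun hS b ((S.equivFinOfCardEq hS).symm i) = b i := by
  simp [fillFun]

theorem sum_eq_sum_fin {x : V → ℝ} (hx : ∀ u ∉ S, x u = 0) :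
    ∑ i, x ((S.equivFinOfCardEq hS).symm i) = ∑ u, x u := by
  rw [Equiv.sum_comp (S.equivFinOfCardEq hS).symm (fun u : S => x u), Finset.sum_coe_sort]
  exact Finset.sum_subset (Finset.subset_univ _) fun u _ hu => hx u hu

theorem fillFun_mem_stdSimplex (b : stdSimplex ℝ (Fin (d + 1))) :
    fillFun hS b.1 ∈ stdSimplex ℝ V := by
  constructor
  · intro u
    simp only [fillFun]
    split_ifs
    · exact b.2.1 _
    · exact le_rfl
  · rw [← sum_eq_sum_fin hS (x := fillFun hS b.1) fun u hu => dif_neg hu]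
    simp only [fillFun_mem]
    exact b.2.2

theorem continuous_fillFun : Continuous (fillFun (V := V) hS) := by
  unfold fillFun
  refine continuous_pi fun u => ?_
  split_ifs <;> fun_prop

variable {Y : Set (Finset V)} (hfree : ∀ s ∈ Y, ¬ S ⊆ s)
  (hfaces : ∀ s ⊂ S, s.Nonempty → s ∈ Y)

include hfaces in
theorem mem_insert_of_subset {s : Finset V} (hs : s.Nonempty) (h : s ⊆ S) : s ∈ insert S Y := by
  by_cases e : s = S
  · exact Or.inl e
  · exact Or.inr (hfaces s (Finset.ssubset_iff_subset_ne.2 ⟨h, e⟩) hs)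

/-- The characteristic map of the simplex `S`. -/
def fillMap : C(stdSimplex ℝ (Fin (d + 1)), Geom (insert S Y)) where
  toFun b := ⟨fillFun hS b.1, fillFun_mem_stdSimplex hS b,
    mem_insert_of_subset hfaces (support_nonempty (fillFun_mem_stdSimplex hS b)) (by
      intro u hu
      by_contra h
      simp [fillFun, h] at hu)⟩
  continuous_toFun := Continuous.subtype_mk
    ((continuous_fillFun hS).comp continuous_subtype_val) _

include hS hfree hfaces in
theorem isTopCell_fillMap (hY : Expands Y) : IsTopCell (fillMap hS hfaces) := by
  have hSn : S.Nonempty := Finset.card_pos.1 (by omega)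
  constructor
  · intro Z _ g z hg
    -- `A` is the closed simplex `S` and `B` contains the rest together with the boundary of `S`.
    -- They form a closed cover, because the only simplex containing `S` is `S` itself.
    let A : Set (Geom (insert S Y)) := {x | ∀ u ∉ S, x.1 u = 0}
    let B : Set (Geom (insert S Y)) := {x | S.inf' hSn x.1 = 0}
    let r : C(A, stdSimplex ℝ (Fin (d + 1))) :=
      ⟨fun x => ⟨fun i => x.1.1 ((S.equivFinOfCardEq hS).symm i), fun i => x.1.2.1.1 _,
        (sum_eq_sum_fin hS x.2).trans x.1.2.1.2⟩, by
        refine Continuous.subtype_mk (continuous_pi fun i => ?_) _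
        exact (continuous_apply _).comp (continuous_subtype_val.comp continuous_subtype_val)⟩
    have hr : ∀ x : A, fillMap hS hfaces (r x) = x.1 := by
      intro x
      refine Subtype.ext (funext fun u => ?_)
      change fillFun hS (r x).1 u = x.1.1 u
      by_cases hu : u ∈ S
      · simp [fillFun, hu, r]
      · rw [fillFun, dif_neg hu, x.2 u hu]
    classical
    let G : Geom (insert S Y) → Z := fun x => if h : x ∈ A then g (r ⟨x, h⟩) else z
    have hGB : ∀ x ∈ B, G x = z := by
      intro x hx
      simp only [G]
      split_ifs with h
      · refine hg _ ?_
        obtain ⟨u, hu, e⟩ := S.exists_mem_eq_inf' hSn x.1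
        refine ⟨S.equivFinOfCardEq hS ⟨u, hu⟩, ?_⟩
        change x.1 ((S.equivFinOfCardEq hS).symm (S.equivFinOfCardEq hS ⟨u, hu⟩)) = 0
        rw [Equiv.symm_apply_apply, ← e]
        exact hx
      · rfl
    have hA : IsClosed A := by
      have : A = ⋂ u ∈ (Sᶜ : Set V), {x | x.1 u = 0} := by ext; simp [A]
      rw [this]
      refine isClosed_biInter fun u _ => isClosed_eq ?_ continuous_const
      exact (continuous_apply u).comp continuous_subtype_val
    have hB : IsClosed B := by
      refine isClosed_eq ?_ continuous_const
      have := Continuous.finset_inf'_apply hSn (f := fun u (x : V → ℝ) => x u)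
        fun u _ => continuous_apply u
      exact (show Continuous fun x : V → ℝ => S.inf' hSn x from this).comp
        continuous_subtype_val
    have hAB : A ∪ B = univ := by
      refine eq_univ_of_forall fun x => ?_
      by_cases hx : S.inf' hSn x.1 = 0
      · exact Or.inr hx
      · have hs := subset_support_of_inf_ne_zero hSn x.2.1 hx
        refine Or.inl fun u hu => ?_
        rcases x.2.2 with h | h
        · by_contra hu'
          have : u ∈ Finset.univ.filter fun v => x.1 v ≠ 0 := by simpa using hu'
          rw [h] at this
          exact hu this
        · exact absurd hs (hfree _ h)
    have hG : Continuous G := by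
      rw [← continuousOn_univ, ← hAB]
      refine ContinuousOn.union_of_isClosed ?_ ?_ hA hB
      · rw [continuousOn_iff_continuous_domRestrict]
        have : A.domRestrict G = fun x => g (r x) := by
          funext x
          simp only [Set.domRestrict_apply, G, dif_pos x.2]
        rw [this]
        fun_prop
      · exact continuousOn_const.congr hGB
    refine ⟨⟨G, hG⟩, fun b => ?_, fun x hx => ?_⟩
    · have hb : fillMap hS hfaces b ∈ A := fun u hu => dif_neg hu
      have e : r ⟨fillMap hS hfaces b, hb⟩ = b :=
        Subtype.ext (funext fun i => fillFun_mem hS b.1 i)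
      simp only [ContinuousMap.coe_mk, G, dif_pos hb, e]
    · simp only [ContinuousMap.coe_mk, G]
      split_ifs with h
      · refine hg _ ?_
        by_contra! hne
        exact hx _ hne (hr ⟨x, h⟩)
      · rfl
  · intro p hp ε hε
    set P : V → ℝ := fillFun hS p.1 with hPdef
    have hP : ∀ u ∈ S, 0 < P u := fun u hu => by
      simp only [hPdef, fillFun, dif_pos hu]
      exact hp _
    have hP0 : ∀ u ∉ S, P u = 0 := fun u hu => dif_neg hu
    have hPs : P ∈ stdSimplex ℝ V := fillFun_mem_stdSimplex hS p
    let A := {x : Geom (insert S Y) // ∀ b, dist b p < ε → fillMap hS hfaces b ≠ x}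
    -- Off the ball around `p` the weight is below `1`, so pushing away from `P` by the amount `μ`
    -- is defined. At its end a coordinate in `S` vanishes, and the point has reached the
    -- contractible space `Geom Y`.
    let μ : A → ℝ := fun x => radialWeight S hSn P x.1.1
    have hμ : Continuous μ := (continuous_radialWeight S hSn P).comp
      (continuous_subtype_val.comp continuous_subtype_val)
    have hμ0 : ∀ x, 0 ≤ μ x := fun x => radialWeight_nonneg hP x.1.2.1
    have hμ1 : ∀ x, μ x < 1 := fun x => radialWeight_lt_one hP hP0 hPs x.1.2.1 fun e =>
      x.2 p (by simpa using hε) (Subtype.ext e.symm)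
    have htμ : ∀ (t : I) (x : A), (t : ℝ) * μ x ≤ μ x := fun t x =>
      mul_le_of_le_one_left (hμ0 x) t.2.2
    have hsimp : ∀ (t : I) (x : A), radialPush P (t * μ x) x.1.1 ∈ stdSimplex ℝ V := fun t x =>
      radialPush_mem_stdSimplex hP hP0 hPs x.1.2.1 (htμ t x) ((htμ t x).trans_lt (hμ1 x))
    have hmem : ∀ (t : I) (x : A),
        Finset.univ.filter (fun u => radialPush P (t * μ x) x.1.1 u ≠ 0) ∈ insert S Y := by
      intro t x
      by_cases h0 : μ x = 0
      · rw [h0, mul_zero, radialPush_zero]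
        exact x.1.2.2
      have hs : S ⊆ Finset.univ.filter fun v => x.1.1 v ≠ 0 := by
        intro u hu
        have h1 := radialWeight_mul_le (hS := hSn) hP (x := x.1.1) hu
        have h2 := mul_pos (lt_of_le_of_ne (hμ0 x) (Ne.symm h0)) (hP u hu)
        simpa using (h2.trans_le h1).ne'
      have hs' : (Finset.univ.filter fun v => x.1.1 v ≠ 0) = S := by
        rcases x.1.2.2 with h | h
        · exact h
        · exact absurd hs (hfree _ h)
      refine mem_insert_of_subset hfaces (support_nonempty (hsimp t x)) fun u hu => ?_
      by_contra hu'
      have hx0 : x.1.1 u = 0 := by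
        by_contra hx
        rw [← hs'] at hu'
        simp [hx] at hu'
      simp [radialPush, hx0, hP0 u hu'] at hu
    have hmem1 : ∀ x : A,
        Finset.univ.filter (fun u => radialPush P ((1 : I) * μ x) x.1.1 u ≠ 0) ∈ Y := by
      intro x
      rcases hmem 1 x with h | h
      · obtain ⟨u, hu, hu0⟩ := exists_radialPush_eq_zero (hS := hSn) hP x.1.1
        rw [← h] at hu
        simp only [Icc.coe_one, one_mul, Finset.mem_filter] at hu
        exact absurd hu0 hu.2
      · exact h
    have hcont : Continuous fun q : I × A => radialPush P (q.1 * μ q.2) q.2.1.1 := by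
      unfold radialPush
      refine continuous_pi fun u => ?_
      have h1 : Continuous fun q : I × A => (1 - (q.1 : ℝ) * μ q.2)⁻¹ := by
        refine Continuous.inv₀ (by
          exact continuous_const.sub ((continuous_subtype_val.comp continuous_fst).mul
            (hμ.comp continuous_snd))) fun q => ?_
        have := (htμ q.1 q.2).trans_lt (hμ1 q.2)
        linarith
      have h2 : Continuous fun x : A => x.1.1 u :=
        ((continuous_apply u).comp continuous_subtype_val).comp
          (continuous_subtype_val (p := fun x : Geom (insert S Y) =>
            ∀ b, dist b p < ε → fillMap hS hfaces b ≠ x))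
      have h3 : Continuous fun q : I × A => q.2.1.1 u := h2.comp continuous_snd
      exact h1.mul (h3.sub (((continuous_subtype_val.comp continuous_fst).mul
        (hμ.comp continuous_snd)).mul continuous_const))
    let i : C(Geom Y, Geom (insert S Y)) := ⟨fun x => ⟨x.1, x.2.1, Or.inr x.2.2⟩, by fun_prop⟩
    let ρ : C(A, Geom Y) := ⟨fun x => ⟨_, hsimp 1 x, hmem1 x⟩, by
      refine Continuous.subtype_mk ?_ _
      exact hcont.comp (continuous_const.prodMk continuous_id)⟩
    have e : (⟨Subtype.val, continuous_subtype_val⟩ : C(A, Geom (insert S Y))).Homotopic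
        (i.comp ρ) := by
      refine ⟨⟨⟨fun q => ⟨_, hsimp q.1 q.2, hmem q.1 q.2⟩, ?_⟩, fun x => ?_, fun x => ?_⟩⟩
      · exact Continuous.subtype_mk hcont _
      · refine Subtype.ext ?_
        change radialPush P ((0 : I) * μ x) x.1.1 = x.1.1
        rw [Icc.coe_zero, zero_mul, radialPush_zero]
      · rfl
    have := hY.contractibleSpace
    obtain ⟨y, hy⟩ := ((id_nullhomotopic (Geom Y)).comp_left ρ).comp_right i
    exact ⟨y, e.trans hy⟩

end Fill

end Geom

end BigHomology

end

/-! ### Cones and elementary expansions. -/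

noncomputable section

namespace BigHomology

section Cones

variable {V : Type} [DecidableEq V]

theorem Expands.nonempty_of_mem {F : Set (Finset V)} (hF : Expands F) :
    ∀ s ∈ F, s.Nonempty := by
  induction hF with
  | vertex v => rintro s rfl; exact Finset.singleton_nonempty v
  | step hF hτ hv hfree hfaces ih =>
    rintro s (rfl | rfl | h)
    · exact hτ
    · exact Finset.insert_nonempty _ _
    · exact ih s h

theorem Expands.mem_of_subset {F : Set (Finset V)} (hF : Expands F) :
    ∀ s ∈ F, ∀ t ⊆ s, t.Nonempty → t ∈ F := by
  induction hF with
  | vertex v =>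
    rintro s rfl t hts ht
    exact (Finset.subset_singleton_iff.1 hts).resolve_left ht.ne_empty
  | @step F τ v hF hτ hv hfree hfaces ih =>
    intro s hs t hts ht
    by_cases h1 : t = τ
    · exact Or.inl h1
    by_cases h2 : t = insert v τ
    · exact Or.inr (Or.inl h2)
    have key : t ⊆ insert v τ → t ∈ F := fun h =>
      hfaces t (Finset.ssubset_iff_subset_ne.2 ⟨h, h2⟩) ht h1
    rcases hs with rfl | rfl | hs
    · exact Or.inr (Or.inr (key (hts.trans (Finset.subset_insert _ _))))
    · exact Or.inr (Or.inr (key hts))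
    · exact Or.inr (Or.inr (ih s hs t hts ht))

theorem Expands.finite {F : Set (Finset V)} (hF : Expands F) : F.Finite := by
  induction hF with
  | vertex v => exact Set.finite_singleton _
  | step _ _ _ _ _ ih => exact (ih.insert _).insert _

/-- The cone on a finite complex can be built by elementary expansions. -/
theorem expands_cone (a : V) (n : ℕ) : ∀ X : Finset (Finset V), X.card = n →
    (∀ s ∈ X, s.Nonempty) → (∀ s ∈ X, ∀ t ⊆ s, t.Nonempty → t ∈ X) → (∀ s ∈ X, a ∉ s) →
      Expands ({t | t = {a} ∨ t ∈ X ∨ ∃ s ∈ X, t = insert a s}) := by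
  induction n with
  | zero =>
    intro X hX _ _ _
    rw [Finset.card_eq_zero] at hX
    subst hX
    have : {t : Finset V | t = {a} ∨ t ∈ (∅ : Finset (Finset V)) ∨
        ∃ s ∈ (∅ : Finset (Finset V)), t = insert a s} = {{a}} := by
      ext t; simp
    rw [this]
    exact Expands.vertex a
  | succ n ih =>
    intro X hX hne hlow ha
    -- A simplex `τ` of maximal cardinality can be removed from `X` leaving a complex, and its cone
    -- is restored by one expansion with free face `τ`.
    obtain ⟨τ, hτ, hmax⟩ := X.exists_max_image Finset.card (Finset.card_pos.1 (by omega))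
    have hnot : ∀ s ∈ X.erase τ, ¬ τ ⊆ s := fun s hs h =>
      Finset.ne_of_mem_erase hs
        (Finset.eq_of_subset_of_card_le h (hmax s (Finset.mem_of_mem_erase hs))).symm
    have hE := ih (X.erase τ) (by rw [Finset.card_erase_of_mem hτ, hX]; rfl)
      (fun s hs => hne s (Finset.mem_of_mem_erase hs))
      (fun s hs t hts ht => Finset.mem_erase.2 ⟨fun e => hnot s hs (e ▸ hts),
        hlow s (Finset.mem_of_mem_erase hs) t hts ht⟩)
      (fun s hs => ha s (Finset.mem_of_mem_erase hs))
    have hface : ∀ t ⊆ τ, t.Nonempty → t ≠ τ → t ∈ X.erase τ := fun t h1 h2 h3 =>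
      Finset.mem_erase.2 ⟨h3, hlow τ hτ t h1 h2⟩
    have := hE.step (τ := τ) (v := a) (hne τ hτ) (ha τ hτ) ?_ ?_
    · convert this using 1
      ext t
      simp only [Set.mem_ofPred_eq, Set.mem_insert_iff, Finset.mem_erase]
      constructor
      · rintro (h | h | ⟨s, hs, rfl⟩)
        · exact Or.inr (Or.inr (Or.inl h))
        · by_cases e : t = τ
          · exact Or.inl e
          · exact Or.inr (Or.inr (Or.inr (Or.inl ⟨e, h⟩)))
        · by_cases e : s = τ
          · exact Or.inr (Or.inl (by rw [e]))
          · exact Or.inr (Or.inr (Or.inr (Or.inr ⟨s, ⟨e, hs⟩, rfl⟩)))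
      · rintro (rfl | rfl | h | h | ⟨s, hs, rfl⟩)
        · exact Or.inr (Or.inl hτ)
        · exact Or.inr (Or.inr ⟨τ, hτ, rfl⟩)
        · exact Or.inl h
        · exact Or.inr (Or.inl h.2)
        · exact Or.inr (Or.inr ⟨s, hs.2, rfl⟩)
    · rintro t (rfl | h | ⟨s, hs, rfl⟩) hsub
      · obtain ⟨u, hu⟩ := hne τ hτ
        exact ha τ hτ (Finset.mem_singleton.1 (hsub hu) ▸ hu)
      · exact hnot t h hsub
      · refine hnot s hs fun u hu => (Finset.mem_insert.1 (hsub hu)).resolve_left ?_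
        rintro rfl
        exact ha τ hτ hu
    · intro t ht htne hne'
      by_cases h : a ∈ t
      · have ht' : insert a (t.erase a) = t := Finset.insert_erase h
        have hsub : t.erase a ⊆ τ := fun u hu =>
          (Finset.mem_insert.1 (ht.1 (Finset.mem_of_mem_erase hu))).resolve_left
            (Finset.ne_of_mem_erase hu)
        rcases Finset.eq_empty_or_nonempty (t.erase a) with he | he
        · left
          rw [← ht', he]; rfl
        · refine Or.inr (Or.inr ⟨t.erase a, hface _ hsub he fun e => ?_, ht'.symm⟩)
          rw [e] at ht'
          exact ht.ne ht'.symm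
      · refine Or.inr (Or.inl (hface t (fun u hu => ?_) htne hne'))
        refine (Finset.mem_insert.1 (ht.1 hu)).resolve_left ?_
        rintro rfl
        exact h hu

/-- A cone on a complex `Y` built by elementary expansions can be attached by elementary expansions
to any complex containing `Y`. -/
theorem Expands.union_cone {Y : Set (Finset V)} (hY : Expands Y) {G : Set (Finset V)} {a : V}
    (hG : Expands G) (hYG : Y ⊆ G) (ha : ∀ s ∈ G, a ∉ s) :
    Expands {t | t ∈ G ∨ t = {a} ∨ ∃ s ∈ Y, t = insert a s} := by
  induction hY with
  | vertex v =>
    have hvG : {v} ∈ G := hYG rfl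
    have hva : v ≠ a := fun e => ha _ hvG (by simp [e])
    -- The cone on the vertex `v` is an edge, attached with its new endpoint `a` as free face.
    have := hG.step (τ := {a}) (v := v) (Finset.singleton_nonempty a) (by simpa using hva)
      (fun s hs h => ha s hs (Finset.singleton_subset_iff.1 h)) ?_
    · convert this using 1
      ext t
      simp only [Set.mem_ofPred_eq, Set.mem_insert_iff, Set.mem_singleton_iff, exists_eq_left,
        Finset.pair_comm a v]
      tauto
    · intro t ht htne hne
      have : t = {v} := by
        have hat : a ∉ t := by
          intro hat
          by_cases hvt : v ∈ t
          · refine ht.2 fun u hu => ?_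
            rcases Finset.mem_insert.1 hu with rfl | hu
            · exact hvt
            · rwa [Finset.mem_singleton.1 hu]
          · refine hne (Finset.Subset.antisymm (fun u hu => ?_) (by simpa using hat))
            rcases Finset.mem_insert.1 (ht.1 hu) with rfl | hu
            · exact absurd hu hvt
            · exact hu
        have hsub : t ⊆ {v} := fun u hu => by
          rcases Finset.mem_insert.1 (ht.1 hu) with rfl | h
          · simp
          · rw [Finset.mem_singleton.1 h] at hu
            exact absurd hu hat
        exact (Finset.subset_singleton_iff.1 hsub).resolve_left htne.ne_empty
      rw [this]
      exact hvG
  | @step Y τ v hY hτ hv hfree hfaces ih =>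
    have hY' : Expands (insert τ (insert (insert v τ) Y)) := hY.step hτ hv hfree hfaces
    have hE := ih fun s hs => hYG (Or.inr (Or.inr hs))
    have hτG : τ ∈ G := hYG (Or.inl rfl)
    have hvτG : insert v τ ∈ G := hYG (Or.inr (Or.inl rfl))
    have haτ : a ∉ τ := ha _ hτG
    have havτ : a ∉ insert v τ := ha _ hvτG
    have hva : v ≠ a := fun e => havτ (by simp [e])
    -- The expansion of `Y` along `τ` is mirrored by one along the cone on `τ`. Faces without the
    -- apex already lie in `G`.
    have := hE.step (τ := insert a τ) (v := v) (Finset.insert_nonempty _ _) (by simp [hva, hv])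
      ?_ ?_
    · convert this using 1
      ext t
      simp only [Set.mem_ofPred_eq, Set.mem_insert_iff, Finset.insert_comm v a]
      constructor
      · rintro (h | h | ⟨s, rfl | rfl | hs, rfl⟩) <;> tauto
      · rintro (h | h | h | h | ⟨s, hs, rfl⟩) <;> [right; right; left; right; right]
        · exact Or.inr ⟨_, Or.inl rfl, h⟩
        · exact Or.inr ⟨_, Or.inr (Or.inl rfl), h⟩
        · exact h
        · exact Or.inl h
        · exact Or.inr ⟨s, Or.inr (Or.inr hs), rfl⟩
    · rintro t (h | rfl | ⟨s, hs, rfl⟩) hsub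
      · exact ha t h (hsub (Finset.mem_insert_self _ _))
      · obtain ⟨u, hu⟩ := hτ
        have := Finset.mem_singleton.1 (hsub (Finset.mem_insert_of_mem hu))
        exact haτ (this ▸ hu)
      · refine hfree s hs fun u hu => ?_
        refine (Finset.mem_insert.1 (hsub (Finset.mem_insert_of_mem hu))).resolve_left ?_
        rintro rfl
        exact haτ hu
    · intro t ht htne hne
      by_cases h : a ∈ t
      · have ht' : insert a (t.erase a) = t := Finset.insert_erase h
        have hsub : t.erase a ⊆ insert v τ := fun u hu => by
          have h1 := ht.1 (Finset.mem_of_mem_erase hu)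
          have h2 := Finset.ne_of_mem_erase hu
          simp only [Finset.mem_insert] at h1 ⊢
          tauto
        rcases Finset.eq_empty_or_nonempty (t.erase a) with he | he
        · refine Or.inr (Or.inl ?_)
          rw [← ht', he]; rfl
        · refine Or.inr (Or.inr ⟨t.erase a, hfaces _ (Finset.ssubset_iff_subset_ne.2
            ⟨hsub, fun e => ?_⟩) he fun e => ?_, ht'.symm⟩)
          · rw [e, Finset.insert_comm] at ht'
            exact ht.ne ht'.symm
          · rw [e] at ht'
            exact hne ht'.symm
      · refine Or.inl (hG.mem_of_subset _ hvτG t (fun u hu => ?_) htne)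
        have h1 := ht.1 hu
        have h2 : u ≠ a := fun e => h (e ▸ hu)
        simp only [Finset.mem_insert] at h1 ⊢
        tauto

end Cones

end BigHomology

end

noncomputable section

namespace BigHomology

/-! ### Ordered simplicial chains on the vertex set `ℕ` -/

section Chains

/-- The simplicial boundary of formal combinations of finite sets of natural numbers. -/
def chainBd : (Finset ℕ →₀ ℤ) →+ (Finset ℕ →₀ ℤ) :=
  Finsupp.liftAddHom fun s => zmultiplesHom (Finset ℕ →₀ ℤ)
    (∑ v ∈ s, (-1 : ℤ) ^ (s.filter (· < v)).card • Finsupp.single (s.erase v) (1 : ℤ))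

theorem chainBd_single (s : Finset ℕ) : chainBd (Finsupp.single s 1) =
    ∑ v ∈ s, (-1 : ℤ) ^ (s.filter (· < v)).card • Finsupp.single (s.erase v) (1 : ℤ) := by
  simp [chainBd]

theorem addMonoidHom_eq_sum {α M : Type*} [AddCommGroup M] (f : (α →₀ ℤ) →+ M) (z : α →₀ ℤ) :
    f z = ∑ s ∈ z.support, z s • f (Finsupp.single s 1) := by
  conv_lhs => rw [← Finsupp.sum_single z]
  rw [Finsupp.sum, map_sum]
  refine Finset.sum_congr rfl fun s _ => ?_
  rw [← map_zsmul, Finsupp.smul_single, smul_eq_mul, mul_one]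

theorem chainBd_single_apply_of_not_subset {s τ : Finset ℕ} (h : ¬ τ ⊆ s) :
    chainBd (Finsupp.single s 1) τ = 0 := by
  rw [chainBd_single, Finsupp.finsetSum_apply]
  refine Finset.sum_eq_zero fun v _ => ?_
  have : s.erase v ≠ τ := fun e => h (e ▸ Finset.erase_subset _ _)
  simp [this]

theorem chainBd_single_insert_apply {τ : Finset ℕ} {v : ℕ} (hv : v ∉ τ) :
    chainBd (Finsupp.single (insert v τ) 1) τ =
      (-1 : ℤ) ^ ((insert v τ).filter (· < v)).card := by
  rw [chainBd_single, Finsupp.finsetSum_apply,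
    Finset.sum_eq_single_of_mem v (Finset.mem_insert_self _ _)]
  · simp [Finset.erase_insert hv]
  · intro u hu huv
    have : (insert v τ).erase u ≠ τ := fun e => hv (by
      rw [← e]; exact Finset.mem_erase.2 ⟨huv.symm, Finset.mem_insert_self _ _⟩)
    simp [this]

/-- A complex built by elementary expansions carries no top-dimensional cycles. -/
theorem Expands.eq_zero_of_chainBd_eq_zero {F : Set (Finset ℕ)} (hF : Expands F) {d : ℕ}
    (hd : 1 ≤ d) (hdim : ∀ s ∈ F, s.card ≤ d + 1) {z : Finset ℕ →₀ ℤ}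
    (hz : ∀ s, z s ≠ 0 → s ∈ F ∧ s.card = d + 1) (hb : chainBd z = 0) : z = 0 := by
  induction hF with
  | vertex v =>
    ext s
    by_contra h
    obtain ⟨rfl, h2⟩ := hz s h
    rw [Finset.card_singleton] at h2
    omega
  | @step F τ v hF hτ hv hfree hfaces ih =>
    have hcard := hdim (insert v τ) (Or.inr (Or.inl rfl))
    rw [Finset.card_insert_of_notMem hv] at hcard
    have hzτ : z τ = 0 := by
      by_contra h
      have := (hz τ h).2
      omega
    have key : z (insert v τ) = 0 := by
      -- In the coefficient of the boundary at the free face `τ` only `insert v τ` survives: the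
      -- other simplices containing `τ` reduce to `τ` itself, which is too small to occur in `z`.
      have h := DFunLike.congr_fun hb τ
      rw [addMonoidHom_eq_sum, Finsupp.finsetSum_apply, Finset.sum_eq_single (insert v τ)] at h
      · rw [Finsupp.smul_apply, chainBd_single_insert_apply hv, smul_eq_mul, Finsupp.zero_apply,
          mul_eq_zero] at h
        exact h.resolve_right (pow_ne_zero _ (by norm_num))
      · intro s hs hne
        rw [Finsupp.mem_support_iff] at hs
        rcases (hz s hs).1 with rfl | rfl | hsF
        · exact absurd hzτ hs
        · exact absurd rfl hne
        · rw [Finsupp.smul_apply, chainBd_single_apply_of_not_subset (hfree s hsF), smul_zero]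
      · intro hs
        rw [Finsupp.notMem_support_iff.1 hs, zero_smul, Finsupp.zero_apply]
    refine ih (fun s hs => hdim s (Or.inr (Or.inr hs))) fun s hs => ?_
    rcases hz s hs with ⟨rfl | rfl | hsF, h2⟩
    · exact absurd hzτ hs
    · exact absurd key hs
    · exact ⟨hsF, h2⟩

/-- The apex exceeds all vertices of `s`, so it comes last: the other faces keep their signs and the
face opposite to it gets `(-1) ^ s.card`. As `chainBd` is augmented, with the empty set as boundary
of a vertex, there is no exception in low dimension. -/
theorem chainBd_single_cone {a : ℕ} {s : Finset ℕ} (hs : s ⊆ Finset.range a) :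
    chainBd (Finsupp.single (insert a s) 1) =
      Finsupp.mapDomain (insert a) (chainBd (Finsupp.single s 1)) +
        (-1 : ℤ) ^ s.card • Finsupp.single s 1 := by
  have hlt : ∀ u ∈ s, u < a := fun u hu => Finset.mem_range.1 (hs hu)
  have ha : a ∉ s := fun h => (hlt a h).ne rfl
  rw [chainBd_single, Finset.sum_insert ha, add_comm]
  congr 1
  · rw [chainBd_single, Finsupp.mapDomain_finsetSum]
    refine Finset.sum_congr rfl fun v hv => ?_
    rw [Finsupp.mapDomain_smul, Finsupp.mapDomain_single,
      Finset.erase_insert_of_ne (hlt v hv).ne', Finset.filter_insert, if_neg (hlt v hv).not_gt]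
  · rw [Finset.erase_insert ha, Finset.filter_insert, if_neg (lt_irrefl a),
      Finset.filter_true_of_mem hlt]

/-- The boundary of a cone. -/
theorem chainBd_cone {a n : ℕ} {z : Finset ℕ →₀ ℤ}
    (hz : ∀ s, z s ≠ 0 → s ⊆ Finset.range a ∧ s.card = n) :
    chainBd (Finsupp.mapDomain (insert a) z) =
      Finsupp.mapDomain (insert a) (chainBd z) + (-1 : ℤ) ^ n • z := by
  have h1 := addMonoidHom_eq_sum
    (chainBd.comp (Finsupp.mapDomain.addMonoidHom (M := ℤ) (insert a))) z
  have h2 := addMonoidHom_eq_sum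
    ((Finsupp.mapDomain.addMonoidHom (M := ℤ) (insert a)).comp chainBd) z
  have h3 := addMonoidHom_eq_sum (AddMonoidHom.id (Finset ℕ →₀ ℤ)) z
  simp only [AddMonoidHom.coe_comp, Function.comp_apply, Finsupp.mapDomain.addMonoidHom_apply,
    AddMonoidHom.id_apply, Finsupp.mapDomain_single] at h1 h2 h3
  have h4 : (-1 : ℤ) ^ n • z = ∑ x ∈ z.support, (-1 : ℤ) ^ n • z x • Finsupp.single x (1 : ℤ) := by
    conv_lhs => rw [h3]
    rw [Finset.smul_sum]
  rw [h1, h2, h4, ← Finset.sum_add_distrib]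
  refine Finset.sum_congr rfl fun s hs => ?_
  obtain ⟨hs1, hs2⟩ := hz s (Finsupp.mem_support_iff.1 hs)
  rw [chainBd_single_cone hs1, hs2, smul_add, smul_comm]

end Chains

/-! ### Models: a sphere filled in a complex built by elementary expansions -/

/-- A complex on the vertices `0, …, N - 1` obtained from a complex `Y` built by elementary
expansions by adding one simplex `S` of dimension `d`, together with a `d`-cycle `z` that takes the
value `1` on `S` and has `B` as its largest absolute value. -/
structure FilledModel (d N B : ℕ) (Y : Set (Finset ℕ)) (S : Finset ℕ) (z : Finset ℕ →₀ ℤ) :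
    Prop where
  expands : Expands Y
  card : S.card = d + 1
  free : ∀ s ∈ Y, ¬ S ⊆ s
  faces : ∀ s ⊂ S, s.Nonempty → s ∈ Y
  dim : ∀ s ∈ Y, s.card ≤ d + 1
  range : ∀ s ∈ insert S Y, s ⊆ Finset.range N
  vertex : ∀ v < N, {v} ∈ Y
  supp : ∀ s, z s ≠ 0 → s ∈ insert S Y ∧ s.card = d + 1
  cycle : chainBd z = 0
  one : z S = 1
  le : ∀ s, (z s).natAbs ≤ B
  attained : ∃ s, (z s).natAbs = B

namespace FilledModel

variable {d N B : ℕ} {Y : Set (Finset ℕ)} {S : Finset ℕ} {z : Finset ℕ →₀ ℤ}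

theorem mem_of_subset (h : FilledModel d N B Y S z) {s t : Finset ℕ} (hs : s ∈ insert S Y)
    (hts : t ⊆ s) (ht : t.Nonempty) : t ∈ insert S Y := by
  rcases hs with rfl | hs
  · by_cases e : t = s
    · exact Or.inl e
    · exact Or.inr (h.faces t (Finset.ssubset_iff_subset_ne.2 ⟨hts, e⟩) ht)
  · exact Or.inr (h.expands.mem_of_subset s hs t hts ht)

theorem nonempty_of_mem (h : FilledModel d N B Y S z) {s : Finset ℕ} (hs : s ∈ insert S Y) :
    s.Nonempty := by
  rcases hs with rfl | hs
  · exact Finset.card_pos.1 (by rw [h.card]; omega)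
  · exact h.expands.nonempty_of_mem s hs

/-- Every cycle is a multiple of the given one. -/
theorem eq_smul (h : FilledModel d N B Y S z) (hd : 1 ≤ d) {w : Finset ℕ →₀ ℤ}
    (hw : ∀ s, w s ≠ 0 → s ∈ insert S Y ∧ s.card = d + 1) (hb : chainBd w = 0) :
    w = w S • z := by
  -- The difference has coefficient `0` on `S`, hence is a top-dimensional cycle of `Y` and
  -- vanishes.
  rw [← sub_eq_zero]
  refine h.expands.eq_zero_of_chainBd_eq_zero hd h.dim (fun s hs => ?_) (by
    rw [map_sub, map_zsmul, hb, h.cycle, smul_zero, sub_zero])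
  have hsS : s ≠ S := by
    rintro rfl
    simp [h.one] at hs
  have : s ∈ insert S Y ∧ s.card = d + 1 := by
    by_cases h0 : w s = 0
    · refine h.supp s fun hz => hs ?_
      simp [h0, hz]
    · exact hw s h0
  exact ⟨this.1.resolve_left hsS, this.2⟩

/-- The complex obtained by suspending, minus its filling simplex. -/
def suspension (N : ℕ) (Y : Set (Finset ℕ)) (S : Finset ℕ) : Set (Finset ℕ) :=
  {t | (t = {N + 1} ∨ t ∈ insert S Y ∨ ∃ s ∈ insert S Y, t = insert (N + 1) s) ∨ t = {N} ∨
    ∃ s ∈ Y, t = insert N s}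

/-- The suspension of a model. -/
theorem suspend (h : FilledModel d N B Y S z) :
    FilledModel (d + 1) (N + 2) B (suspension N Y S) (insert N S)
      (Finsupp.mapDomain (insert N) z - Finsupp.mapDomain (insert (N + 1)) z) := by
  have hlt : ∀ s ∈ insert S Y, ∀ u ∈ s, u < N := fun s hs u hu =>
    Finset.mem_range.1 (h.range s hs hu)
  have hN : ∀ s ∈ insert S Y, N ∉ s := fun s hs hu => (hlt s hs N hu).ne rfl
  have hN1 : ∀ s ∈ insert S Y, N + 1 ∉ s := fun s hs hu => by
    have := hlt s hs _ hu
    omega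
  have hS : S ∈ insert S Y := Or.inl rfl
  have hSne : S.Nonempty := h.nonempty_of_mem hS
  have hfin : (insert S Y).Finite := h.expands.finite.insert S
  have hinj : ∀ a, (∀ s ∈ insert S Y, a ∉ s) → ∀ s ∈ insert S Y, ∀ t ∈ insert S Y,
      insert a s = insert a t → s = t := fun a ha s hs t ht e => by
    rw [← Finset.erase_insert (ha s hs), e, Finset.erase_insert (ha t ht)]
  -- The cone with apex `N + 1` is taken over the whole complex, the one with apex `N` over `Y`
  -- only. What is missing from the suspension is exactly the simplex `insert N S`.
  have hcone : Expands {t | t = {N + 1} ∨ t ∈ insert S Y ∨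
      ∃ s ∈ insert S Y, t = insert (N + 1) s} := by
    have := expands_cone (N + 1) _ hfin.toFinset rfl
      (fun s hs => h.nonempty_of_mem (hfin.mem_toFinset.1 hs))
      (fun s hs t hts ht => hfin.mem_toFinset.2 (h.mem_of_subset (hfin.mem_toFinset.1 hs) hts ht))
      (fun s hs => hN1 s (hfin.mem_toFinset.1 hs))
    simpa only [hfin.mem_toFinset] using this
  have hzr : ∀ a, N ≤ a → ∀ s, z s ≠ 0 → s ⊆ Finset.range a ∧ s.card = d + 1 :=
    fun a ha s hs => ⟨(h.range s (h.supp s hs).1).trans (Finset.range_subset_range.2 ha),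
      (h.supp s hs).2⟩
  have hNcone : ∀ t, (t = {N + 1} ∨ t ∈ insert S Y ∨ ∃ s ∈ insert S Y, t = insert (N + 1) s) →
      N ∉ t := by
    rintro t (rfl | h1 | ⟨s, hs, rfl⟩)
    · simp
    · exact hN t h1
    · simp [hN s hs]
  have hval : ∀ a, (∀ s ∈ insert S Y, a ∉ s) → ∀ t, Finsupp.mapDomain (insert a) z t ≠ 0 →
      ∃ s ∈ insert S Y, s.card = d + 1 ∧ t = insert a s := by
    intro a ha t ht
    have := Finsupp.mapDomain_support (Finsupp.mem_support_iff.2 ht)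
    obtain ⟨s, hs, rfl⟩ := Finset.mem_image.1 this
    have := h.supp s (Finsupp.mem_support_iff.1 hs)
    exact ⟨s, this.1, this.2, rfl⟩
  have happ : ∀ a, (∀ s ∈ insert S Y, a ∉ s) → ∀ s ∈ insert S Y,
      Finsupp.mapDomain (insert a) z (insert a s) = z s := fun a ha s hs =>
    Finsupp.mapDomain_apply' (insert S Y) z
      (fun t ht => (h.supp t (Finsupp.mem_support_iff.1 ht)).1)
      (fun s hs t ht e => hinj a ha s hs t ht e) hs
  -- The two cones on `z` have disjoint supports, so their difference has the coefficients of `z` up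
  -- to sign.
  have hdisj : ∀ s ∈ insert S Y, Finsupp.mapDomain (insert (N + 1)) z (insert N s) = 0 := by
    intro s hs
    by_contra hne
    obtain ⟨t, ht, -, e⟩ := hval _ hN1 _ hne
    have : N ∈ insert (N + 1) t := e ▸ Finset.mem_insert_self N s
    rcases Finset.mem_insert.1 this with e' | e'
    · omega
    · exact hN t ht e'
  refine ⟨h.expands.union_cone hcone (fun s hs => Or.inr (Or.inl (Or.inr hs))) hNcone,
    by rw [Finset.card_insert_of_notMem (hN S hS), h.card], ?_, ?_, ?_, ?_, ?_, ?_, ?_, ?_, ?_, ?_⟩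
  · rintro s (hs | rfl | ⟨s, hs, rfl⟩) hsub
    · exact hNcone s hs (hsub (Finset.mem_insert_self _ _))
    · obtain ⟨u, hu⟩ := hSne
      have := Finset.mem_singleton.1 (hsub (Finset.mem_insert_of_mem hu))
      exact hN S hS (this ▸ hu)
    · refine h.free s hs fun u hu => ?_
      refine (Finset.mem_insert.1 (hsub (Finset.mem_insert_of_mem hu))).resolve_left ?_
      rintro rfl
      exact hN S hS hu
  · intro t ht htne
    by_cases hNt : N ∈ t
    · have ht' : insert N (t.erase N) = t := Finset.insert_erase hNt
      have hsub : t.erase N ⊆ S := fun u hu =>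
        (Finset.mem_insert.1 (ht.1 (Finset.mem_of_mem_erase hu))).resolve_left
          (Finset.ne_of_mem_erase hu)
      rcases Finset.eq_empty_or_nonempty (t.erase N) with he | he
      · refine Or.inr (Or.inl ?_)
        rw [← ht', he]; rfl
      · refine Or.inr (Or.inr ⟨_, h.faces _ (Finset.ssubset_iff_subset_ne.2 ⟨hsub, fun e => ?_⟩) he,
          ht'.symm⟩)
        rw [e] at ht'
        exact ht.ne ht'.symm
    · refine Or.inl (Or.inr (Or.inl (h.mem_of_subset hS (fun u hu => ?_) htne)))
      refine (Finset.mem_insert.1 (ht.1 hu)).resolve_left ?_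
      rintro rfl
      exact hNt hu
  · have hc : ∀ s ∈ insert S Y, s.card ≤ d + 1 := by
      rintro s (rfl | hs)
      · exact h.card.le
      · exact h.dim s hs
    rintro t ((rfl | ht | ⟨s, hs, rfl⟩) | rfl | ⟨s, hs, rfl⟩)
    · simp
    · exact (hc t ht).trans (Nat.le_succ _)
    · exact (Finset.card_insert_le _ _).trans (Nat.succ_le_succ (hc s hs))
    · simp
    · exact (Finset.card_insert_le _ _).trans (Nat.succ_le_succ (h.dim s hs))
  · have hr : ∀ s ∈ insert S Y, s ⊆ Finset.range (N + 2) := fun s hs =>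
      (h.range s hs).trans (Finset.range_subset_range.2 (by omega))
    have hNr : N ∈ Finset.range (N + 2) := by simp
    have hN1r : N + 1 ∈ Finset.range (N + 2) := by simp
    rintro t (rfl | (rfl | ht | ⟨s, hs, rfl⟩) | rfl | ⟨s, hs, rfl⟩)
    · exact Finset.insert_subset hNr (hr S hS)
    · simp
    · exact hr t ht
    · exact Finset.insert_subset hN1r (hr s hs)
    · simp
    · exact Finset.insert_subset hNr (hr s (Or.inr hs))
  · intro v hv
    by_cases h1 : v = N
    · exact Or.inr (Or.inl (by rw [h1]))
    by_cases h2 : v = N + 1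
    · exact Or.inl (Or.inl (by rw [h2]))
    · exact Or.inl (Or.inr (Or.inl (Or.inr (h.vertex v (by omega)))))
  · intro t ht
    rw [Finsupp.sub_apply] at ht
    by_cases h1 : Finsupp.mapDomain (insert N) z t = 0
    · rw [h1, zero_sub, neg_ne_zero] at ht
      obtain ⟨s, hs, hc, rfl⟩ := hval _ hN1 t ht
      exact ⟨Or.inr (Or.inl (Or.inr (Or.inr ⟨s, hs, rfl⟩))), by
        rw [Finset.card_insert_of_notMem (hN1 s hs), hc]⟩
    · obtain ⟨s, hs, hc, rfl⟩ := hval _ hN t h1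
      refine ⟨?_, by rw [Finset.card_insert_of_notMem (hN s hs), hc]⟩
      rcases hs with rfl | hs
      · exact Or.inl rfl
      · exact Or.inr (Or.inr (Or.inr ⟨s, hs, rfl⟩))
  -- Since `z` is a cycle, both cones have boundary `(-1) ^ (d + 1) • z`.
  · rw [map_sub, chainBd_cone (hzr N le_rfl), chainBd_cone (hzr (N + 1) (by omega)), h.cycle,
      Finsupp.mapDomain_zero, Finsupp.mapDomain_zero, sub_self]
  · rw [Finsupp.sub_apply, happ N hN S hS, hdisj S hS, h.one, sub_zero]
  · intro t
    rw [Finsupp.sub_apply]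
    by_cases h1 : Finsupp.mapDomain (insert N) z t = 0
    · by_cases h2 : Finsupp.mapDomain (insert (N + 1)) z t = 0
      · simp [h1, h2]
      · obtain ⟨s, hs, hc, rfl⟩ := hval _ hN1 t h2
        rw [h1, happ _ hN1 s hs, zero_sub, Int.natAbs_neg]
        exact h.le s
    · obtain ⟨s, hs, hc, rfl⟩ := hval _ hN t h1
      rw [hdisj s hs, happ _ hN s hs, sub_zero]
      exact h.le s
  · obtain ⟨s, hs⟩ := h.attained
    -- A maximum attained where `z` vanishes would make `B` zero, contrary to the coefficient `1` on
    -- `S`.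
    by_cases h0 : z s = 0
    · have := h.le S
      rw [h.one] at this
      rw [h0] at hs
      simp [← hs] at this
    · have hsX := (h.supp s h0).1
      exact ⟨insert N s, by rw [Finsupp.sub_apply, hdisj s hsX, happ _ hN s hsX, sub_zero, hs]⟩

end FilledModel

end BigHomology

end

noncomputable section

namespace BigHomology

/-! ### The two-dimensional models: a telescope of Möbius bands -/

namespace Band

/-- The embedding of the six vertices of a band as the vertices `3 k, …, 3 k + 5`. -/
def shift (k : ℕ) : Finset ℕ ↪ Finset ℕ :=
  Finset.mapEmbedding (addRightEmbedding (3 * k)) |>.toEmbedding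

theorem shift_apply (k : ℕ) (s : Finset ℕ) : shift k s = s.map (addRightEmbedding (3 * k)) := rfl

theorem shift_subset {k : ℕ} {s t : Finset ℕ} : shift k s ⊆ shift k t ↔ s ⊆ t := by
  simp [shift_apply]

theorem shift_insert (k v : ℕ) (s : Finset ℕ) :
    shift k (insert v s) = insert (v + 3 * k) (shift k s) := by
  simp [shift_apply]

/-- The edges and vertices of the core circle of the band. -/
def circle : Finset (Finset ℕ) := {{0}, {1}, {2}, {0, 1}, {0, 2}, {1, 2}}

/-- The triangles of the band that occur in its fundamental chain with sign `-1`. -/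
def negTriangles : Finset (Finset ℕ) := {{0, 1, 3}, {1, 2, 3}, {0, 1, 4}, {1, 2, 5}, {0, 3, 5}}

/-- The triangles of the band that occur in its fundamental chain with sign `1`. -/
def posTriangles : Finset (Finset ℕ) := {{2, 3, 4}, {0, 2, 4}, {1, 4, 5}, {0, 2, 5}}

/-- The faces of the Möbius band with core circle on the vertices `0, 1, 2` and boundary circle on
the vertices `3, 4, 5`. -/
def faces : Finset (Finset ℕ) :=
  circle ∪ negTriangles ∪ posTriangles ∪
    {{3}, {4}, {5}, {0, 3}, {1, 3}, {2, 3}, {2, 4}, {0, 4}, {1, 4}, {1, 5}, {2, 5}, {0, 5},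
      {3, 4}, {3, 5}, {4, 5}}

/-- The expansions building the band from its core circle. -/
def steps : List (Finset ℕ × ℕ) :=
  [({3}, 0), ({1, 3}, 0), ({2, 3}, 1), ({4}, 2), ({3, 4}, 2), ({0, 4}, 2), ({1, 4}, 0), ({5}, 1),
    ({4, 5}, 1), ({2, 5}, 1), ({0, 5}, 2), ({3, 5}, 0)]

/-- The family obtained from `A` by a list of expansions. -/
def grow (A : Finset (Finset ℕ)) : List (Finset ℕ × ℕ) → Finset (Finset ℕ)
  | [] => A
  | p :: L => grow (insert p.1 (insert (insert p.2 p.1) A)) L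

/-- The condition that a list of expansions of `A` is valid, with every free face containing a
vertex which is at least `3`. -/
def valid (A : Finset (Finset ℕ)) : List (Finset ℕ × ℕ) → Bool
  | [] => true
  | p :: L => decide ((∃ u ∈ p.1, 3 ≤ u) ∧ p.2 ∉ p.1 ∧ (∀ s ∈ A, ¬ p.1 ⊆ s) ∧
      ∀ s ∈ (insert p.2 p.1).powerset, s.Nonempty → s ≠ insert p.2 p.1 → s ≠ p.1 → s ∈ A) &&
        valid (insert p.1 (insert (insert p.2 p.1) A)) L

theorem valid_steps : valid circle steps = true := by decide +kernel

theorem grow_steps : grow circle steps = faces := by decide +kernel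

/-- A valid list stays valid on top of `G` after the shift: each free face has a vertex that is at
least `3`, which becomes a vertex not used by `G`. -/
theorem expands_grow {G : Set (Finset ℕ)} (k : ℕ)
    (hG : ∀ s ∈ G, s ⊆ Finset.range (3 * k + 3)) :
    ∀ (L : List (Finset ℕ × ℕ)) (A : Finset (Finset ℕ)), valid A L = true →
      Expands (G ∪ shift k '' A) → Expands (G ∪ shift k '' grow A L)
  | [], _, _, h => h
  | p :: L, A, hv, h => by
    rw [valid, Bool.and_eq_true, decide_eq_true_eq] at hv
    obtain ⟨⟨⟨u, hu, hu3⟩, hp, hfree, hface⟩, hv'⟩ := hv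
    refine expands_grow k hG L _ hv' ?_
    have := h.step (τ := shift k p.1) (v := p.2 + 3 * k) ?_ ?_ ?_ ?_
    · convert this using 1
      ext t
      simp only [Set.mem_union, Set.mem_image, Finset.coe_insert, Set.mem_insert_iff,
        exists_eq_or_imp, ← shift_insert]
      rw [eq_comm (a := t) (b := shift k p.1), eq_comm (a := t) (b := shift k (insert p.2 p.1))]
      tauto
    · rw [shift_apply, Finset.map_nonempty]
      exact ⟨u, hu⟩
    · simpa [shift_apply] using hp
    · rintro s (hs | ⟨s, hs, rfl⟩) hsub
      · have h1 : u + 3 * k ∈ s := hsub (by simpa [shift_apply] using hu)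
        have := Finset.mem_range.1 (hG s hs h1)
        omega
      · exact hfree s hs (shift_subset.1 hsub)
    · intro s hs hsne hne
      rw [← shift_insert, shift_apply] at hs
      obtain ⟨t, ht, rfl⟩ := Finset.subset_map_iff.1 hs.1
      refine Or.inr ⟨t, hface t (Finset.mem_powerset.2 ht) (by simpa using hsne) ?_ ?_, rfl⟩
      · rintro rfl
        exact hs.ne rfl
      · rintro rfl
        exact hne rfl

/-- The complex obtained from a triangle by attaching `k` bands. -/
def tower : ℕ → Set (Finset ℕ)
  | 0 => {t | t = {0} ∨ t ∈ ({{1}, {2}, {1, 2}} : Finset (Finset ℕ)) ∨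
      ∃ s ∈ ({{1}, {2}, {1, 2}} : Finset (Finset ℕ)), t = insert 0 s}
  | k + 1 => tower k ∪ shift k '' (faces : Set (Finset ℕ))

theorem tower_subset_range : ∀ k, ∀ s ∈ tower k, s ⊆ Finset.range (3 * k + 3)
  | 0 => by
    rintro s (rfl | h | ⟨t, h, rfl⟩)
    · simp
    · have : ∀ s ∈ ({{1}, {2}, {1, 2}} : Finset (Finset ℕ)), s ⊆ Finset.range 3 := by decide
      exact this s h
    · have : ∀ s ∈ ({{1}, {2}, {1, 2}} : Finset (Finset ℕ)), insert 0 s ⊆ Finset.range 3 := by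
        decide
      exact this t h
  | k + 1 => by
    rintro s (h | ⟨t, ht, rfl⟩)
    · exact (tower_subset_range k s h).trans (Finset.range_subset_range.2 (by omega))
    · have : ∀ t ∈ faces, t ⊆ Finset.range 6 := by decide +kernel
      intro u hu
      simp only [shift_apply, Finset.mem_map, addRightEmbedding_apply] at hu
      obtain ⟨v, hv, rfl⟩ := hu
      have := Finset.mem_range.1 (this t ht hv)
      rw [Finset.mem_range]
      omega

/-- The core of the next band is the boundary of the initial triangle when `k = 0`, and the boundary
circle of the preceding band otherwise. -/
theorem shift_circle_subset_tower : ∀ k, ∀ s ∈ circle, shift k s ∈ tower k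
  | 0 => by
    have : ∀ s ∈ circle, s = {0} ∨ s ∈ ({{1}, {2}, {1, 2}} : Finset (Finset ℕ)) ∨
      ∃ t ∈ ({{1}, {2}, {1, 2}} : Finset (Finset ℕ)), s = insert 0 t := by decide
    intro s hs
    have e : shift 0 s = s := by
      ext u
      simp [shift_apply]
    rw [e]
    exact this s hs
  | k + 1 => by
    intro s hs
    have h1 : ∀ s ∈ circle, shift 1 s ∈ faces := by decide +kernel
    refine Or.inr ⟨_, h1 s hs, ?_⟩
    ext u
    simp only [shift_apply, Finset.map_map, Finset.mem_map, Function.Embedding.trans_apply,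
      addRightEmbedding_apply]
    refine exists_congr fun v => and_congr_right fun _ => ?_
    rw [show v + 3 * 1 + 3 * k = v + 3 * (k + 1) by ring]

/-- The triangle is a cone on an edge, and every band expands from its core circle, which is already
present. The checked list `steps` does this for one band. -/
theorem expands_tower : ∀ k, Expands (tower k)
  | 0 => expands_cone 0 3 _ (by decide) (by decide) (by
      intro s hs t hts
      have : ∀ s ∈ ({{1}, {2}, {1, 2}} : Finset (Finset ℕ)), ∀ t ∈ s.powerset, t.Nonempty →
        t ∈ ({{1}, {2}, {1, 2}} : Finset (Finset ℕ)) := by decide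
      exact this s hs t (Finset.mem_powerset.2 hts)) (by decide)
  | k + 1 => by
    have h := expands_tower k
    have e : tower k ∪ shift k '' (circle : Set (Finset ℕ)) = tower k := by
      refine Set.union_eq_left.2 ?_
      rintro _ ⟨s, hs, rfl⟩
      exact shift_circle_subset_tower k s hs
    rw [tower, ← grow_steps]
    exact expands_grow k (tower_subset_range k) steps circle valid_steps (by rwa [e])

theorem card_le_of_mem_tower : ∀ k, ∀ s ∈ tower k, s.card ≤ 3
  | 0 => by
    rintro s (rfl | h | ⟨t, h, rfl⟩)
    · simp
    · have : ∀ s ∈ ({{1}, {2}, {1, 2}} : Finset (Finset ℕ)), s.card ≤ 3 := by decide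
      exact this s h
    · have : ∀ s ∈ ({{1}, {2}, {1, 2}} : Finset (Finset ℕ)), (insert 0 s).card ≤ 3 := by decide
      exact this t h
  | k + 1 => by
    rintro s (h | ⟨t, ht, rfl⟩)
    · exact card_le_of_mem_tower k s h
    · have : ∀ t ∈ faces, t.card ≤ 3 := by decide +kernel
      rw [shift_apply, Finset.card_map]
      exact this t ht

theorem vertex_mem_tower : ∀ k, ∀ v < 3 * k + 3, {v} ∈ tower k
  | 0 => by
    intro v hv
    interval_cases v
    · exact Or.inl rfl
    · exact Or.inr (Or.inl (by decide))
    · exact Or.inr (Or.inl (by decide))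
  | k + 1 => by
    intro v hv
    by_cases h : v < 3 * k + 3
    · exact Or.inl (vertex_mem_tower k v h)
    · refine Or.inr ⟨{v - 3 * k}, ?_, ?_⟩
      · have : ∀ i < 6, {i} ∈ faces := by decide +kernel
        exact this _ (by omega)
      · simp only [shift_apply, Finset.map_singleton, addRightEmbedding_apply]
        congr 1
        omega

theorem ncard_tower_le : ∀ k, (tower k).ncard ≤ 30 * k + 7
  | 0 => by
    have e : tower 0 ⊆ ((Finset.range 3).powerset.erase ∅ : Finset (Finset ℕ)) := by
      intro s hs
      rw [Finset.mem_coe, Finset.mem_erase, Finset.mem_powerset]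
      exact ⟨((expands_tower 0).nonempty_of_mem s hs).ne_empty, tower_subset_range 0 s hs⟩
    refine (Set.ncard_le_ncard e (Finset.finite_toSet _)).trans ?_
    rw [Set.ncard_coe_finset]
    decide
  | k + 1 => by
    refine (Set.ncard_union_le _ _).trans ?_
    have h1 := ncard_tower_le k
    have h2 : (shift k '' (faces : Set (Finset ℕ))).ncard ≤ 30 := by
      refine (Set.ncard_image_le (Finset.finite_toSet _)).trans ?_
      rw [Set.ncard_coe_finset]
      decide +kernel
    omega

/-- The fundamental chain of the `k`-th band. -/
def chain (k : ℕ) : Finset ℕ →₀ ℤ :=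
  ∑ t ∈ posTriangles, Finsupp.single (shift k t) 1 -
    ∑ t ∈ negTriangles, Finsupp.single (shift k t) 1

theorem sum_single_apply (A : Finset (Finset ℕ)) (k : ℕ) (s : Finset ℕ) :
    (∑ t ∈ A, Finsupp.single (shift k t) (1 : ℤ)) s = if s ∈ A.map (shift k) then 1 else 0 := by
  rw [Finsupp.finsetSum_apply]
  simp only [Finsupp.single_apply]
  rw [← Finset.sum_map A (shift k) fun t => if t = s then (1 : ℤ) else 0, Finset.sum_ite_eq']

theorem natAbs_chain_le (k : ℕ) (s : Finset ℕ) : (chain k s).natAbs ≤ 1 := by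
  rw [chain, Finsupp.sub_apply, sum_single_apply, sum_single_apply]
  split_ifs <;> simp

/-- Every triangle of a band has a vertex off the core circle, hence outside the earlier tower. This
keeps the chains of different bands from overlapping. -/
theorem mem_of_chain_ne_zero {k : ℕ} {s : Finset ℕ} (h : chain k s ≠ 0) :
    s ∈ shift k '' (faces : Set (Finset ℕ)) ∧ s.card = 3 ∧ ¬ s ⊆ Finset.range (3 * k + 3) := by
  have hs : s ∈ (posTriangles ∪ negTriangles).map (shift k) := by
    by_contra hs
    rw [Finset.map_union, Finset.mem_union, not_or] at hs
    rw [chain, Finsupp.sub_apply, sum_single_apply, sum_single_apply, if_neg hs.1, if_neg hs.2]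
      at h
    exact h rfl
  obtain ⟨t, ht, rfl⟩ := Finset.mem_map.1 hs
  have h1 : ∀ t ∈ posTriangles ∪ negTriangles, t ∈ faces ∧ t.card = 3 ∧ ∃ u ∈ t, 3 ≤ u := by
    decide +kernel
  obtain ⟨h2, h3, u, hu, hu3⟩ := h1 t ht
  refine ⟨⟨t, h2, rfl⟩, by rw [shift_apply, Finset.card_map, h3], fun hsub => ?_⟩
  have : u + 3 * k ∈ Finset.range (3 * k + 3) := hsub (by simpa [shift_apply] using hu)
  rw [Finset.mem_range] at this
  omega

theorem chainBd_triangle (k : ℕ) {i j l : ℕ} (hij : i < j) (hjl : j < l) :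
    chainBd (Finsupp.single (shift k {i, j, l}) 1) =
      Finsupp.single (shift k {j, l}) 1 - Finsupp.single (shift k {i, l}) 1 +
        Finsupp.single (shift k {i, j}) 1 := by
  have e : ∀ s : Finset ℕ, chainBd (Finsupp.single (shift k s) 1) = ∑ v ∈ s,
      (-1 : ℤ) ^ (s.filter (· < v)).card • Finsupp.single (shift k (s.erase v)) (1 : ℤ) := by
    intro s
    rw [chainBd_single, shift_apply, Finset.sum_map]
    refine Finset.sum_congr rfl fun v _ => ?_
    rw [Finset.filter_map, Finset.card_map, shift_apply, Finset.map_erase]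
    congr 4
    ext u
    simp
  have hi : i ∉ ({j, l} : Finset ℕ) := by simp; omega
  have hj : j ∉ ({l} : Finset ℕ) := by simp; omega
  have e1 : ({i, j, l} : Finset ℕ).filter (· < i) = ∅ := by ext u; simp; omega
  have e2 : ({i, j, l} : Finset ℕ).filter (· < j) = {i} := by ext u; simp; omega
  have e3 : ({i, j, l} : Finset ℕ).filter (· < l) = {i, j} := by ext u; simp; omega
  have f1 : ({i, j, l} : Finset ℕ).erase i = {j, l} := by ext u; simp; omega
  have f2 : ({i, j, l} : Finset ℕ).erase j = {i, l} := by ext u; simp; omega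
  have f3 : ({i, j, l} : Finset ℕ).erase l = {i, j} := by ext u; simp; omega
  rw [e, Finset.sum_insert hi, Finset.sum_insert hj, Finset.sum_singleton, e1, e2, e3, f1, f2, f3,
    Finset.card_empty, Finset.card_singleton, Finset.card_pair hij.ne]
  simp only [pow_zero, one_smul, pow_one, neg_smul, even_two, Even.neg_pow, one_pow]
  abel

/-- The boundary circle of a Möbius band runs twice around its core. Both circles are written as
boundaries of the triangles they span, whether or not these belong to the complex. -/
theorem chainBd_chain (k : ℕ) : chainBd (chain k) =
    chainBd (Finsupp.single (shift k {3, 4, 5}) 1) -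
      (2 : ℤ) • chainBd (Finsupp.single (shift k {0, 1, 2}) 1) := by
  have e1 : ∑ t ∈ posTriangles, Finsupp.single (shift k t) (1 : ℤ) =
      Finsupp.single (shift k {2, 3, 4}) 1 + (Finsupp.single (shift k {0, 2, 4}) 1 +
        (Finsupp.single (shift k {1, 4, 5}) 1 + Finsupp.single (shift k {0, 2, 5}) 1)) := by
    rw [posTriangles, Finset.sum_insert (by decide), Finset.sum_insert (by decide),
      Finset.sum_insert (by decide), Finset.sum_singleton]
  have e2 : ∑ t ∈ negTriangles, Finsupp.single (shift k t) (1 : ℤ) =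
      Finsupp.single (shift k {0, 1, 3}) 1 + (Finsupp.single (shift k {1, 2, 3}) 1 +
        (Finsupp.single (shift k {0, 1, 4}) 1 + (Finsupp.single (shift k {1, 2, 5}) 1 +
          Finsupp.single (shift k {0, 3, 5}) 1))) := by
    rw [negTriangles, Finset.sum_insert (by decide), Finset.sum_insert (by decide),
      Finset.sum_insert (by decide), Finset.sum_insert (by decide), Finset.sum_singleton]
  rw [chain, e1, e2]
  simp only [map_sub, map_add]
  repeat rw [chainBd_triangle k (by norm_num) (by norm_num)]
  module

/-- The chain filling, with opposite sign, the boundary circle of the last band. -/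
def towerChain : ℕ → Finset ℕ →₀ ℤ
  | 0 => -Finsupp.single (shift 0 {0, 1, 2}) 1
  | k + 1 => (2 : ℤ) • towerChain k - chain k

theorem shift_succ (k : ℕ) : shift k {3, 4, 5} = shift (k + 1) {0, 1, 2} := by
  simp only [shift_apply, Finset.map_insert, Finset.map_singleton, addRightEmbedding_apply]
  rw [show 3 + 3 * k = 0 + 3 * (k + 1) by ring, show 4 + 3 * k = 1 + 3 * (k + 1) by ring,
    show 5 + 3 * k = 2 + 3 * (k + 1) by ring]

/-- Twice the previous filling ends on twice the core of the next band, and subtracting that band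
carries this over to the band's boundary circle. -/
theorem chainBd_towerChain :
    ∀ k, chainBd (towerChain k) = -chainBd (Finsupp.single (shift k {0, 1, 2}) 1)
  | 0 => by rw [towerChain, map_neg]
  | k + 1 => by
    rw [towerChain, map_sub, map_zsmul, chainBd_towerChain k, chainBd_chain, shift_succ]
    module

theorem mem_of_towerChain_ne_zero :
    ∀ k, ∀ s, towerChain k s ≠ 0 → s ∈ tower k ∧ s.card = 3
  | 0 => by
    intro s hs
    have : s = {0, 1, 2} := by
      by_contra h
      refine hs ?_
      have e : shift 0 {0, 1, 2} ≠ s := fun e => h (by rw [← e]; ext u; simp [shift_apply])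
      simp [towerChain, e]
    subst this
    exact ⟨Or.inr (Or.inr ⟨{1, 2}, by decide, rfl⟩), by decide⟩
  | k + 1 => by
    intro s hs
    by_cases h : towerChain k s = 0
    · have : chain k s ≠ 0 := by
        intro h'
        simp [towerChain, h, h'] at hs
      exact ⟨Or.inr (mem_of_chain_ne_zero this).1, (mem_of_chain_ne_zero this).2.1⟩
    · have := mem_of_towerChain_ne_zero k s h
      exact ⟨Or.inl this.1, this.2⟩

/-- The two chains combined at each stage have disjoint supports, so old coefficients double exactly
and new ones are at most `1` in absolute value. -/
theorem natAbs_towerChain_le : ∀ k, ∀ s, (towerChain k s).natAbs ≤ 2 ^ k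
  | 0 => by
    intro s
    simp only [towerChain, Finsupp.neg_apply, Finsupp.single_apply]
    split_ifs <;> simp
  | k + 1 => by
    intro s
    have h1 := natAbs_towerChain_le k s
    rw [towerChain, Finsupp.sub_apply, Finsupp.smul_apply, smul_eq_mul]
    by_cases h : chain k s = 0
    · rw [h, sub_zero, Int.natAbs_mul, pow_succ]
      change 2 * _ ≤ _
      omega
    · have : towerChain k s = 0 := by
        by_contra h'
        exact (mem_of_chain_ne_zero h).2.2
          (tower_subset_range k s (mem_of_towerChain_ne_zero k s h').1)
      rw [this, mul_zero, zero_sub, Int.natAbs_neg]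
      exact (natAbs_chain_le k s).trans Nat.one_le_two_pow

theorem towerChain_apply_triangle : ∀ k, towerChain k {0, 1, 2} = -2 ^ k
  | 0 => by
    have e : shift 0 {0, 1, 2} = {0, 1, 2} := by ext u; simp [shift_apply]
    simp [towerChain, e]
  | k + 1 => by
    have h : chain k {0, 1, 2} = 0 := by
      by_contra h
      refine (mem_of_chain_ne_zero h).2.2 ?_
      have : ({0, 1, 2} : Finset ℕ) ⊆ Finset.range 3 := by decide
      exact this.trans (Finset.range_subset_range.2 (by omega))
    rw [towerChain, Finsupp.sub_apply, Finsupp.smul_apply, towerChain_apply_triangle k, h,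
      smul_eq_mul]
    ring

/-- The filling simplex spans the boundary circle of the last band. For `k = 0` it would be the
initial triangle, which is already in the tower. The value `2 ^ k` is attained on the initial
triangle. -/
theorem filledModel {k : ℕ} (hk : 1 ≤ k) : FilledModel 2 (3 * k + 3) (2 ^ k) (tower k)
    (shift k {0, 1, 2}) (Finsupp.single (shift k {0, 1, 2}) 1 + towerChain k) := by
  have hnot : shift k {0, 1, 2} ∉ tower k := by
    obtain ⟨k, rfl⟩ := Nat.exists_eq_add_of_le' hk
    rw [← shift_succ]
    rintro (h | ⟨t, ht, e⟩)
    · have : 3 + 3 * k ∈ Finset.range (3 * k + 3) :=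
        tower_subset_range k _ h (by simp [shift_apply])
      rw [Finset.mem_range] at this
      omega
    · have h1 : {3, 4, 5} ∉ faces := by decide +kernel
      exact h1 ((shift k).injective e ▸ ht)
  have hcard : (shift k {0, 1, 2}).card = 3 := by rw [shift_apply, Finset.card_map]; rfl
  have hval : towerChain k (shift k {0, 1, 2}) = 0 := by
    by_contra h
    exact hnot (mem_of_towerChain_ne_zero k _ h).1
  have hpow := Nat.one_le_two_pow (n := k)
  refine ⟨expands_tower k, hcard, fun s hs hsub => ?_, fun s hs hne => ?_, card_le_of_mem_tower k,
    ?_, vertex_mem_tower k, fun s hs => ?_, ?_, ?_, fun s => ?_, ?_⟩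
  · exact hnot ((expands_tower k).mem_of_subset s hs _ hsub
      (Finset.card_pos.1 (by rw [hcard]; omega)))
  · rw [shift_apply] at hs
    obtain ⟨t, ht, rfl⟩ := Finset.subset_map_iff.1 hs.1
    refine shift_circle_subset_tower k t ?_
    have h1 : ∀ t ∈ ({0, 1, 2} : Finset ℕ).powerset, t.Nonempty → t ≠ {0, 1, 2} → t ∈ circle := by
      decide +kernel
    refine h1 t (Finset.mem_powerset.2 ht) (by simpa using hne) ?_
    rintro rfl
    exact hs.ne rfl
  · rintro s (rfl | hs)
    · intro u hu
      simp [shift_apply] at hu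
      rw [Finset.mem_range]
      omega
    · exact tower_subset_range k s hs
  · by_cases h : towerChain k s = 0
    · by_cases e : shift k {0, 1, 2} = s
      · exact ⟨Or.inl e.symm, e ▸ hcard⟩
      · simp [h, e] at hs
    · have := mem_of_towerChain_ne_zero k s h
      exact ⟨Or.inr this.1, this.2⟩
  · rw [map_add, chainBd_towerChain, add_neg_cancel]
  · simp [hval]
  · by_cases e : shift k {0, 1, 2} = s
    · subst e
      simpa [hval] using hpow
    · simpa [e] using natAbs_towerChain_le k s
  · refine ⟨{0, 1, 2}, ?_⟩
    have e : shift k {0, 1, 2} ≠ {0, 1, 2} := by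
      intro e
      have h0 : 0 ∈ shift k {0, 1, 2} := by rw [e]; simp
      simp [shift_apply] at h0
      omega
    rw [Finsupp.add_apply, towerChain_apply_triangle, Finsupp.single_eq_of_ne e.symm, zero_add,
      Int.natAbs_neg, Int.natAbs_pow]
    rfl

end Band

/-- `Y` occurs in the base and in both cones, `S` in the base and in one cone, and there are two
apexes. -/
theorem ncard_suspension_le (N : ℕ) {Y : Set (Finset ℕ)} (hY : Y.Finite) (S : Finset ℕ) :
    (FilledModel.suspension N Y S).ncard ≤ 3 * Y.ncard + 4 := by
  have e : FilledModel.suspension N Y S ⊆ ({{N + 1}} ∪ (insert S Y ∪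
      insert (N + 1) '' insert S Y)) ∪ ({{N}} ∪ insert N '' Y) := by
    rintro t ((h | h | ⟨s, hs, rfl⟩) | h | ⟨s, hs, rfl⟩)
    · exact Or.inl (Or.inl h)
    · exact Or.inl (Or.inr (Or.inl h))
    · exact Or.inl (Or.inr (Or.inr ⟨s, hs, rfl⟩))
    · exact Or.inr (Or.inl h)
    · exact Or.inr (Or.inr ⟨s, hs, rfl⟩)
  have hX := hY.insert S
  refine (Set.ncard_le_ncard e (((Set.finite_singleton _).union (hX.union (hX.image _))).union
    ((Set.finite_singleton _).union (hY.image _)))).trans ?_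
  have h1 := Set.ncard_insert_le S Y
  have h2 := Set.ncard_image_le (f := insert (N + 1)) hX
  have h3 := Set.ncard_image_le (f := insert N) hY
  have h4 := Set.ncard_union_le (insert S Y) (insert (N + 1) '' insert S Y)
  have h5 := Set.ncard_union_le {{N + 1}} (insert S Y ∪ insert (N + 1) '' insert S Y)
  have h6 := Set.ncard_union_le {{N}} (insert N '' Y)
  have h7 := Set.ncard_union_le ({{N + 1}} ∪ (insert S Y ∪ insert (N + 1) '' insert S Y))
    ({{N}} ∪ insert N '' Y)
  rw [Set.ncard_singleton] at h5 h6
  omega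

/-- Models of linear size in every dimension. -/
theorem exists_filledModel {d : ℕ} (hd : 2 ≤ d) : ∃ c : ℕ, ∀ k, 1 ≤ k → ∃ N Y S z,
    FilledModel d N (2 ^ k) Y S z ∧ k ≤ N ∧ Y.ncard ≤ c * k := by
  induction d, hd using Nat.le_induction with
  | base =>
    -- `30 * k + 7 ≤ 37 * k` for `k ≥ 1`.
    refine ⟨37, fun k hk => ⟨_, _, _, _, Band.filledModel hk, by omega, ?_⟩⟩
    have := Band.ncard_tower_le k
    omega
  | succ d hd ih =>
    obtain ⟨c, hc⟩ := ih
    refine ⟨3 * c + 4, fun k hk => ?_⟩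
    obtain ⟨N, Y, S, z, h, hN, hY⟩ := hc k hk
    refine ⟨_, _, _, _, h.suspend, by omega, ?_⟩
    have := ncard_suspension_le N h.expands.finite S
    calc _ ≤ 3 * Y.ncard + 4 := this
      _ ≤ 3 * (c * k) + 4 * k := by omega
      _ = (3 * c + 4) * k := by ring

end BigHomology

end

/-! ### Homology, size and connectivity of the simplicial complexes of the models. -/

noncomputable section

namespace BigHomology

section General

variable (C : ℕ → Type) [∀ n, AddCommGroup (C n)] (bd : ∀ n, C (n + 1) →+ C n)

/-- A surjection from the cycles to `ℤ` with kernel the boundaries identifies the homology with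
`ℤ`, and takes generators to `1` or `-1`. -/
theorem homology_of_ker_eq {n : ℕ} (φ : cycles C bd n →+ ℤ) (hs : Function.Surjective φ)
    (hk : φ.ker = boundaries C bd n) : Nonempty (Homology C bd n ≃+ ℤ) ∧
      ∀ z : cycles C bd n, Generates C bd z → (φ z).natAbs = 1 := by
  refine ⟨⟨(QuotientAddGroup.quotientAddEquivOfEq hk.symm).trans
    (QuotientAddGroup.quotientKerEquivOfSurjective φ hs)⟩, fun z hz => ?_⟩
  -- An element `w` with value `1` is a multiple of the generator up to boundaries, so `φ z` divides
  -- `1`.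
  obtain ⟨w, hw⟩ := hs 1
  have : (w : Homology C bd n) ∈ AddSubgroup.zmultiples (z : Homology C bd n) := by
    rw [show AddSubgroup.zmultiples (z : Homology C bd n) = ⊤ from hz]
    trivial
  obtain ⟨m, hm⟩ := AddSubgroup.mem_zmultiples_iff.1 this
  rw [← QuotientAddGroup.mk_zsmul, QuotientAddGroup.eq, ← hk, AddMonoidHom.mem_ker, map_add,
    map_neg, map_zsmul, hw, smul_eq_mul] at hm
  have h1 : m * φ z = 1 := by linarith
  exact Int.isUnit_iff_natAbs_eq.1 (IsUnit.of_mul_eq_one_right _ h1)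

end General

/-- The base is the `(c + 1)`-th root of `2`; using `c + 1` instead of `c` avoids a zero exponent.
It turns a linear bound on the size into exponential growth of the coefficients. -/
theorem exists_base (c : ℕ) : ∃ b : ℝ, 1 < b ∧ ∀ k n : ℕ, n ≤ c * k → b ^ n ≤ 2 ^ k := by
  have hc : (0 : ℝ) < (c + 1 : ℕ) := by positivity
  refine ⟨(2 : ℝ) ^ (((c + 1 : ℕ) : ℝ)⁻¹), Real.one_lt_rpow (by norm_num) (inv_pos.2 hc),
    fun k n hn => ?_⟩
  have h1 : 1 ≤ (2 : ℝ) ^ (((c + 1 : ℕ) : ℝ)⁻¹) :=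
    Real.one_le_rpow (by norm_num) (inv_pos.2 hc).le
  calc _ ≤ ((2 : ℝ) ^ (((c + 1 : ℕ) : ℝ)⁻¹)) ^ ((c + 1) * k) :=
        pow_le_pow_right₀ h1 (hn.trans (Nat.mul_le_mul_right k (Nat.le_succ c)))
    _ = 2 ^ k := by rw [pow_mul, Real.rpow_inv_natCast_pow (by norm_num) (by omega)]

/-- Transport of expansions from `ℕ` to an initial segment. -/
theorem Expands.preimage {F : Set (Finset ℕ)} (hF : Expands F) {N : ℕ}
    (hN : ∀ s ∈ F, s ⊆ Finset.range N) :
    Expands {s : Finset (Fin N) | s.map Fin.valEmbedding ∈ F} := by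
  have hlift : ∀ s : Finset ℕ, s ⊆ Finset.range N →
      ∃ t : Finset (Fin N), t.map Fin.valEmbedding = s := fun s hs =>
    ⟨s.attachFin fun u hu => Finset.mem_range.1 (hs hu), Finset.map_valEmbedding_attachFin _⟩
  have hinj := Finset.map_injective (Fin.valEmbedding (n := N))
  induction hF with
  | vertex v =>
    have hv : v < N := by simpa using hN {v} rfl
    have : {s : Finset (Fin N) | s.map Fin.valEmbedding ∈ ({{v}} : Set (Finset ℕ))} =
        {{⟨v, hv⟩}} := by
      ext s
      have e : ({v} : Finset ℕ) = ({⟨v, hv⟩} : Finset (Fin N)).map Fin.valEmbedding := by simp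
      rw [Set.mem_ofPred_eq, Set.mem_singleton_iff, Set.mem_singleton_iff, e, hinj.eq_iff]
    rw [this]
    exact Expands.vertex _
  | @step F τ v hF hτ hv hfree hfaces ih =>
    obtain ⟨τ', rfl⟩ := hlift τ (hN τ (Or.inl rfl))
    have hvN : v < N := by
      have := hN _ (Or.inr (Or.inl rfl)) (Finset.mem_insert_self v _)
      exact Finset.mem_range.1 this
    have e : insert v (τ'.map Fin.valEmbedding) =
        (insert (⟨v, hvN⟩ : Fin N) τ').map Fin.valEmbedding := by simp
    rw [e] at hfaces ⊢
    have := (ih fun s hs => hN s (Or.inr (Or.inr hs))).step (τ := τ') (v := ⟨v, hvN⟩)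
      (by simpa using hτ) (fun h => hv (Finset.mem_map.2 ⟨_, h, rfl⟩))
      (fun s hs hsub => hfree _ hs (Finset.map_subset_map.2 hsub)) (fun s hs hne hne' =>
        hfaces _ (Finset.map_ssubset_map.2 hs) (by simpa using hne) fun h => hne' (hinj h))
    convert this using 1
    ext s
    simp only [Set.mem_ofPred_eq, Set.mem_insert_iff, hinj.eq_iff]

namespace FilledModel

variable {d N B : ℕ} {Y : Set (Finset ℕ)} {S : Finset ℕ} {z : Finset ℕ →₀ ℤ}

/-- The simplicial complex of a model. -/
def complex (h : FilledModel d N B Y S z) : AbstractSimplicialComplex (Fin N) where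
  faces := {s | s.map Fin.valEmbedding ∈ insert S Y}
  isRelLowerSet_faces := fun s hs =>
    ⟨by simpa using h.nonempty_of_mem hs, fun t hts ht =>
      h.mem_of_subset hs (Finset.map_subset_map.2 hts) (by simpa using ht)⟩
  singleton_mem v := Or.inr (by simpa using h.vertex v v.2)

theorem exists_map_eq (h : FilledModel d N B Y S z) {s : Finset ℕ} (hs : s ∈ insert S Y) :
    ∃ t ∈ h.complex.faces, t.map Fin.valEmbedding = s := by
  have e := Finset.map_valEmbedding_attachFin (s := s)
    fun u hu => Finset.mem_range.1 (h.range s hs hu)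
  refine ⟨_, ?_, e⟩
  change Finset.map _ _ ∈ insert S Y
  rwa [e]

theorem hasDim (h : FilledModel d N B Y S z) : Complex.HasDim h.complex d := by
  refine ⟨fun s hs => ?_, ?_⟩
  · rw [← Finset.card_map Fin.valEmbedding]
    rcases hs with hs | hs
    · rw [hs, h.card]
    · exact h.dim _ hs
  · obtain ⟨t, ht, e⟩ := h.exists_map_eq (Or.inl rfl)
    exact ⟨t, ht, by rw [← Finset.card_map Fin.valEmbedding, e, h.card]⟩

theorem isNConnected (h : FilledModel d N B Y S z) (hd : 0 < d) :
    IsNConnected (d - 1) (Complex.Realization h.complex) := by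
  obtain ⟨T, -, hT⟩ := h.exists_map_eq (Or.inl rfl)
  have hinj := Finset.map_injective (Fin.valEmbedding (n := N))
  have e : h.complex.faces = insert T {s : Finset (Fin N) | s.map Fin.valEmbedding ∈ Y} := by
    ext s
    change s.map Fin.valEmbedding ∈ insert S Y ↔ _
    rw [← hT, Set.mem_insert_iff, Set.mem_insert_iff, hinj.eq_iff]
    rfl
  have key : IsNConnected (d - 1)
      (Geom (insert T {s : Finset (Fin N) | s.map Fin.valEmbedding ∈ Y})) :=
    (isTopCell_fillMap (S := T) (by rw [← Finset.card_map Fin.valEmbedding, hT, h.card])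
      (fun s hs hsub => h.free _ hs (by rw [← hT]; exact Finset.map_subset_map.2 hsub))
      (fun s hs hne => h.faces _ (by rw [← hT]; exact Finset.map_ssubset_map.2 hs)
        (by simpa using hne))
      (h.expands.preimage fun s hs => h.range s (Or.inr hs))).isNConnected hd
  rw [← e] at key
  exact key

theorem size_eq (h : FilledModel d N B Y S z) :
    Complex.size h.complex = (insert S Y).ncard := by
  have : insert S Y = Finset.map Fin.valEmbedding '' h.complex.faces := by
    ext s
    constructor
    · intro hs
      obtain ⟨t, ht, e⟩ := h.exists_map_eq hs
      exact ⟨t, ht, e⟩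
    · rintro ⟨t, ht, rfl⟩
      exact ht
  rw [Complex.size, this, Set.ncard_image_of_injective _ (Finset.map_injective _)]

theorem le_size (h : FilledModel d N B Y S z) : N ≤ Complex.size h.complex := by
  have h1 : Set.range (fun v : Fin N => ({v} : Finset (Fin N))) ⊆ h.complex.faces := by
    rintro _ ⟨v, rfl⟩
    exact h.complex.singleton_mem v
  have h2 := Set.ncard_le_ncard h1 (Set.toFinite _)
  rwa [Set.ncard_range_of_injective Finset.singleton_injective, Nat.card_eq_fintype_card,
    Fintype.card_fin] at h2

end FilledModel

/-- The simplicial chains of a complex, as formal combinations of finite sets of integers. -/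
def chainMap {N : ℕ} (K : AbstractSimplicialComplex (Fin N)) (n : ℕ) :
    Complex.Chain K n →+ (Finset ℕ →₀ ℤ) :=
  Finsupp.mapDomain.addMonoidHom fun s => s.1.map Fin.valEmbedding

section ChainMap

variable {N : ℕ} (K : AbstractSimplicialComplex (Fin N))

theorem simplex_map_injective (n : ℕ) :
    Function.Injective fun s : Complex.Simplex K n => s.1.map Fin.valEmbedding :=
  (Finset.map_injective _).comp Subtype.val_injective

theorem chainMap_injective (n : ℕ) : Function.Injective (chainMap K n) :=
  Finsupp.mapDomain_injective (simplex_map_injective K n)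

theorem chainMap_apply {n : ℕ} (z : Complex.Chain K n) (s : Complex.Simplex K n) :
    chainMap K n z (s.1.map Fin.valEmbedding) = z s :=
  Finsupp.mapDomain_apply (simplex_map_injective K n) z s

theorem exists_of_chainMap_ne_zero {n : ℕ} {z : Complex.Chain K n} {t : Finset ℕ}
    (h : chainMap K n z t ≠ 0) : ∃ s : Complex.Simplex K n, s.1.map Fin.valEmbedding = t := by
  obtain ⟨s, -, e⟩ := Finset.mem_image.1
    (Finsupp.mapDomain_support (Finsupp.mem_support_iff.2 h))
  exact ⟨s, e⟩

/-- The `i`-th smallest vertex of a simplex has exactly `i` smaller ones, so the two sign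
conventions agree. -/
theorem chainMap_bd (n : ℕ) (z : Complex.Chain K (n + 1)) :
    chainMap K n (Complex.bd K n z) = chainBd (chainMap K (n + 1) z) := by
  suffices (chainMap K n).comp (Complex.bd K n) = chainBd.comp (chainMap K (n + 1)) from
    DFunLike.congr_fun this z
  ext1 s
  ext1
  simp only [AddMonoidHom.coe_comp, Function.comp_apply, Finsupp.singleAddHom_apply]
  have e1 : Complex.bd K n (Finsupp.single s 1) =
      ∑ i : Fin (n + 2), (-1 : ℤ) ^ (i : ℕ) • Finsupp.single (Complex.face K s i) (1 : ℤ) := by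
    simp [Complex.bd]
  have e2 : chainMap K (n + 1) (Finsupp.single s 1) =
      Finsupp.single (s.1.map Fin.valEmbedding) 1 := Finsupp.mapDomain_single
  rw [e1, e2, chainBd_single, map_sum, Finset.sum_map]
  refine Finset.sum_bij (fun i _ => s.1.orderEmbOfFin s.2.2 i)
    (fun i _ => s.1.orderEmbOfFin_mem s.2.2 i)
    (fun i _ j _ h => (s.1.orderEmbOfFin s.2.2).injective h) (fun v hv => ?_) fun i _ => ?_
  · have : v ∈ Set.range (s.1.orderEmbOfFin s.2.2) := by
      rw [Finset.range_orderEmbOfFin]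
      exact hv
    obtain ⟨i, hi⟩ := this
    exact ⟨i, Finset.mem_univ i, hi⟩
  · have h1 : chainMap K n (Finsupp.single (Complex.face K s i) 1) =
        Finsupp.single ((s.1.erase (s.1.orderEmbOfFin s.2.2 i)).map Fin.valEmbedding) 1 :=
      Finsupp.mapDomain_single
    rw [map_zsmul, h1, Finset.map_erase]
    congr 2
    have h2 : (s.1.map Fin.valEmbedding).filter
        (· < Fin.valEmbedding (s.1.orderEmbOfFin s.2.2 i)) =
        ((Finset.univ.filter (· < i)).map (s.1.orderEmbOfFin s.2.2).toEmbedding).map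
          Fin.valEmbedding := by
      rw [Finset.filter_map]
      congr 1
      ext v
      simp only [Finset.mem_filter, Finset.mem_map, Function.comp_apply, Finset.mem_univ,
        true_and, RelEmbedding.coe_toEmbedding]
      constructor
      · rintro ⟨hv, hlt⟩
        have : v ∈ Set.range (s.1.orderEmbOfFin s.2.2) := by
          rw [Finset.range_orderEmbOfFin]
          exact hv
        obtain ⟨j, rfl⟩ := this
        exact ⟨j, (s.1.orderEmbOfFin s.2.2).lt_iff_lt.1 hlt, rfl⟩
      · rintro ⟨j, hj, rfl⟩
        exact ⟨s.1.orderEmbOfFin_mem s.2.2 j, (s.1.orderEmbOfFin s.2.2).lt_iff_lt.2 hj⟩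
    rw [h2, Finset.card_map, Finset.card_map]
    simp [Finset.filter_gt_eq_Iio]

end ChainMap

namespace FilledModel

variable {e N B : ℕ} {Y : Set (Finset ℕ)} {S : Finset ℕ} {z : Finset ℕ →₀ ℤ}

theorem homology (h : FilledModel (e + 1) N B Y S z) :
    Nonempty (Homology (Complex.Chain h.complex) (Complex.bd h.complex) (e + 1) ≃+ ℤ) ∧
      ∀ w : cycles (Complex.Chain h.complex) (Complex.bd h.complex) (e + 1),
        Generates _ _ w → Complex.maxCoeff h.complex w.1 = B := by
  set K := h.complex with hK
  obtain ⟨T, hTK, hT⟩ := h.exists_map_eq (Or.inl rfl)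
  let T' : Complex.Simplex K (e + 1) :=
    ⟨T, hTK, by rw [← Finset.card_map Fin.valEmbedding, hT, h.card]⟩
  have hsupp : ∀ w : Complex.Chain K (e + 1), ∀ s, chainMap K (e + 1) w s ≠ 0 →
      s ∈ insert S Y ∧ s.card = e + 1 + 1 := by
    intro w s hs
    obtain ⟨t, rfl⟩ := exists_of_chainMap_ne_zero K hs
    exact ⟨t.2.1, by rw [Finset.card_map, t.2.2]⟩
  -- A cycle is determined by its coefficient on the filling simplex.
  have hmul : ∀ w : cycles (Complex.Chain K) (Complex.bd K) (e + 1),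
      chainMap K (e + 1) w.1 = w.1 T' • z := by
    intro w
    have hw : Complex.bd K e w.1 = 0 := w.2
    rw [h.eq_smul (by omega) (hsupp w.1) (by rw [← chainMap_bd, hw, map_zero]), ← hT]
    congr 1
    exact chainMap_apply K w.1 T'
  let z' : Complex.Chain K (e + 1) :=
    Finsupp.comapDomain (fun s : Complex.Simplex K (e + 1) => s.1.map Fin.valEmbedding) z
      (simplex_map_injective K _).injOn
  have hz' : chainMap K (e + 1) z' = z := by
    refine Finsupp.mapDomain_comapDomain _ (simplex_map_injective K _) z fun s hs => ?_
    obtain ⟨h1, h2⟩ := h.supp s (Finsupp.mem_support_iff.1 hs)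
    obtain ⟨t, ht, e⟩ := h.exists_map_eq h1
    exact ⟨⟨t, ht, by rw [← Finset.card_map Fin.valEmbedding, e, h2]⟩, e⟩
  have hz'c : z' ∈ cycles (Complex.Chain K) (Complex.bd K) (e + 1) := by
    change Complex.bd K e z' = 0
    apply chainMap_injective K e
    rw [chainMap_bd, hz', h.cycle, map_zero]
  have hz'1 : z' T' = 1 := by
    rw [← chainMap_apply K z' T', hz', ← h.one, ← hT]
  let φ : cycles (Complex.Chain K) (Complex.bd K) (e + 1) →+ ℤ :=
    (Finsupp.applyAddHom T').comp (AddSubgroup.subtype _)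
  have hφ : ∀ w, φ w = w.1 T' := fun w => rfl
  -- Without simplices in the next dimension there are no boundaries to divide out, and the homology
  -- is the group of cycles.
  have hempty : IsEmpty (Complex.Simplex K (e + 1 + 1)) := by
    refine ⟨fun s => ?_⟩
    have h1 := h.hasDim.1 s.1 s.2.1
    rw [s.2.2] at h1
    omega
  obtain ⟨h1, h2⟩ := homology_of_ker_eq (Complex.Chain K) (Complex.bd K) φ
    (fun m => ⟨m • ⟨z', hz'c⟩, by rw [map_zsmul, hφ, hz'1, smul_eq_mul, mul_one]⟩) (by
      ext w
      rw [AddMonoidHom.mem_ker, hφ, boundaries, AddSubgroup.mem_addSubgroupOf]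
      constructor
      · intro hw
        have : w.1 = 0 := chainMap_injective K (e + 1) (by rw [hmul, hw, zero_smul, map_zero])
        rw [this]
        exact zero_mem _
      · rintro ⟨u, hu⟩
        rw [Subsingleton.elim u 0, map_zero] at hu
        rw [← hu]
        rfl)
  refine ⟨h1, fun w hw => ?_⟩
  have hw1 := h2 w hw
  rw [hφ] at hw1
  have habs : ∀ s, (w.1 s).natAbs = (z (s.1.map Fin.valEmbedding)).natAbs := by
    intro s
    rw [← chainMap_apply K w.1 s, hmul, Finsupp.smul_apply, smul_eq_mul, Int.natAbs_mul, hw1,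
      one_mul]
  apply le_antisymm
  · refine Finset.sup_le fun s _ => ?_
    rw [habs]
    exact h.le _
  · obtain ⟨s, hs⟩ := h.attained
    by_cases hB : B = 0
    · rw [hB]; exact Nat.zero_le _
    · have hzs : z s ≠ 0 := fun h0 => hB (by rw [← hs, h0]; rfl)
      obtain ⟨h3, h4⟩ := h.supp s hzs
      obtain ⟨t, ht, et⟩ := h.exists_map_eq h3
      let t' : Complex.Simplex K (e + 1) :=
        ⟨t, ht, by rw [← Finset.card_map Fin.valEmbedding, et, h4]⟩
      have h5 : (w.1 t').natAbs = B := by rw [habs, et, hs]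
      rw [← h5]
      refine Finset.le_sup (f := fun s => (w.1 s).natAbs) (Finsupp.mem_support_iff.2 fun h0 => ?_)
      rw [h0] at h5
      exact hB h5.symm

end FilledModel

/-- Simplicial complexes with exponentially large generators of their homology. -/
theorem exists_complexes {d : ℕ} (hd : 2 ≤ d) :
    ∃ (m : ℕ → ℕ) (X : ∀ k, AbstractSimplicialComplex (Fin (m k))) (c : ℕ) (a b : ℝ),
      0 < a ∧ 1 < b ∧ ∀ k, 1 ≤ k →
        Complex.HasDim (X k) d ∧
        IsNConnected (d - 1) (Complex.Realization (X k)) ∧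
        Nonempty (Homology (Complex.Chain (X k)) (Complex.bd (X k)) d ≃+ ℤ) ∧
        k ≤ Complex.size (X k) ∧ Complex.size (X k) ≤ c * k ∧
        ∀ z : cycles (Complex.Chain (X k)) (Complex.bd (X k)) d,
          Generates _ _ z →
            Complex.maxCoeff (X k) z.1 = 2 ^ k ∧
            a * b ^ Complex.size (X k) ≤ (Complex.maxCoeff (X k) z.1 : ℝ) := by
  obtain ⟨e, rfl⟩ := Nat.exists_eq_add_of_le' (one_le_two.trans hd)
  obtain ⟨c, hc⟩ := exists_filledModel hd
  obtain ⟨b, hb, hbk⟩ := exists_base (c + 1)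
  have key : ∀ k, ∃ p : Σ m, AbstractSimplicialComplex (Fin m), 1 ≤ k →
      Complex.HasDim p.2 (e + 1) ∧
        IsNConnected (e + 1 - 1) (Complex.Realization p.2) ∧
        Nonempty (Homology (Complex.Chain p.2) (Complex.bd p.2) (e + 1) ≃+ ℤ) ∧
        k ≤ Complex.size p.2 ∧ Complex.size p.2 ≤ (c + 1) * k ∧
        ∀ z : cycles (Complex.Chain p.2) (Complex.bd p.2) (e + 1),
          Generates _ _ z → Complex.maxCoeff p.2 z.1 = 2 ^ k := by
    intro k
    by_cases hk : 1 ≤ k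
    · obtain ⟨N, Y, S, z, h, hN, hY⟩ := hc k hk
      obtain ⟨h1, h2⟩ := h.homology
      refine ⟨⟨N, h.complex⟩, fun _ => ⟨h.hasDim, h.isNConnected (by omega), h1,
        hN.trans h.le_size, ?_, h2⟩⟩
      rw [h.size_eq]
      refine (Set.ncard_insert_le _ _).trans ?_
      rw [add_mul, one_mul]
      omega
    · exact ⟨⟨0, ⊥⟩, fun h => absurd h hk⟩
  choose p hp using key
  refine ⟨fun k => (p k).1, fun k => (p k).2, c + 1, 1, b, one_pos, hb, fun k hk => ?_⟩
  obtain ⟨h1, h2, h3, h4, h5, h6⟩ := hp k hk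
  refine ⟨h1, h2, h3, h4, h5, fun z hz => ⟨h6 z hz, ?_⟩⟩
  rw [h6 z hz, one_mul]
  push_cast
  exact hbk k _ h5

end BigHomology

end

/-! ### Simplicial sets with one vertex and further cells in two consecutive dimensions. -/

noncomputable section

namespace BigHomology

open CategoryTheory Opposite
open SimplexCategory (δ σ)

/-- Attaching data for a simplicial set with one vertex, nondegenerate simplices of dimension `e`
with trivial boundary and nondegenerate simplices of dimension `e + 1` whose faces are either
trivial (`none`) or among the former. -/
structure CellData (e : ℕ) where
  Low : Type
  High : Type
  face : High → Fin (e + 2) → Option Low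

namespace CellData

variable {e : ℕ} (D : CellData e)

/-- The simplices over `n` of the simplicial set with attaching data `D`. -/
inductive Simp (n : SimplexCategory) : Type
  | pt : Simp n
  | low (a : D.Low) (s : n ⟶ (SimplexCategory.mk e)) (hs : Epi s) : Simp n
  | high (b : D.High) (s : n ⟶ (SimplexCategory.mk (e + 1))) (hs : Epi s) : Simp n

variable {D} {n m l : SimplexCategory}

theorem exists_comp_δ {r : ℕ} (t : n ⟶ (SimplexCategory.mk (r + 1))) (h : ¬Epi t) :
    ∃ (i : Fin (r + 2)) (t' : n ⟶ (SimplexCategory.mk r)), t = t' ≫ δ i :=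
  SimplexCategory.eq_comp_δ_of_not_surjective t
    (by rwa [← SimplexCategory.epi_iff_surjective])

theorem not_epi_comp_δ {r : ℕ} (t : n ⟶ (SimplexCategory.mk r)) (i : Fin (r + 2)) :
    ¬Epi (t ≫ δ i) := fun h => by
  have := epi_of_epi t (δ i)
  have := SimplexCategory.le_of_epi (δ i)
  omega

open Classical in
/-- The simplex of the characteristic map of `a` at `t`. -/
def redLow (a : D.Low) (t : n ⟶ (SimplexCategory.mk e)) : D.Simp n := if h : Epi t then .low a t h else .pt

/-- The simplex of the trivial or characteristic map of `o` at `t`. -/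
def redOpt (o : Option D.Low) (t : n ⟶ (SimplexCategory.mk e)) : D.Simp n := o.elim .pt fun a => redLow a t

open Classical in
/-- The simplex of the characteristic map of `b` at `t`. -/
def redHigh (b : D.High) (t : n ⟶ (SimplexCategory.mk (e + 1))) : D.Simp n :=
  if h : Epi t then .high b t h else
    redOpt (D.face b (exists_comp_δ t h).choose) (exists_comp_δ t h).choose_spec.choose

theorem redLow_of_epi (a : D.Low) (t : n ⟶ (SimplexCategory.mk e)) (h : Epi t) : redLow a t = .low a t h :=
  dif_pos h

theorem redLow_of_not_epi (a : D.Low) (t : n ⟶ (SimplexCategory.mk e)) (h : ¬Epi t) : redLow a t = .pt :=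
  dif_neg h

theorem redHigh_of_epi (b : D.High) (t : n ⟶ (SimplexCategory.mk (e + 1))) (h : Epi t) :
    redHigh b t = .high b t h := dif_pos h

theorem redOpt_of_not_epi (o : Option D.Low) (t : n ⟶ (SimplexCategory.mk e)) (h : ¬Epi t) :
    redOpt o t = .pt := by
  cases o
  · rfl
  · exact redLow_of_not_epi (D := D) _ _ h

/-- If `t` were surjective, `t ≫ δ i` would reach every vertex except `i`, in particular `j`, which
`t' ≫ δ j` misses. -/
theorem not_epi_of_comp_δ_eq {t t' : n ⟶ (SimplexCategory.mk e)} {i j : Fin (e + 2)} (hij : i ≠ j)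
    (h : t ≫ δ i = t' ≫ δ j) : ¬Epi t := fun ht => by
  rw [SimplexCategory.epi_iff_surjective] at ht
  obtain ⟨y, hy⟩ := Fin.exists_succAbove_eq hij.symm
  obtain ⟨x, hx⟩ := ht y
  have h1 := congr_arg (fun f : n ⟶ (SimplexCategory.mk (e + 1)) => f.toOrderHom x) h
  have h2 : (t ≫ δ i).toOrderHom x = i.succAbove (t.toOrderHom x) := rfl
  have h3 : (t' ≫ δ j).toOrderHom x = j.succAbove (t'.toOrderHom x) := rfl
  simp only [h2, h3, hx, hy] at h1
  exact Fin.succAbove_ne _ _ h1.symm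

/-- The facet chosen in `redHigh` does not matter: a map factoring through two facets is not
surjective onto either, and then both readings give the base point because the low cells have
trivial boundary. -/
theorem redHigh_comp_δ (b : D.High) (t : n ⟶ (SimplexCategory.mk e)) (i : Fin (e + 2)) :
    redHigh b (t ≫ δ i) = redOpt (D.face b i) t := by
  have h := not_epi_comp_δ t i
  have key : ∀ (j : Fin (e + 2)) (t' : n ⟶ (SimplexCategory.mk e)), t ≫ δ i = t' ≫ δ j →
      redOpt (D.face b j) t' = redOpt (D.face b i) t := by
    intro j t' h'
    by_cases hi : i = j
    · subst hi
      rw [(cancel_mono (δ i)).1 h']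
    · rw [redOpt_of_not_epi _ _ (not_epi_of_comp_δ_eq hi h'),
        redOpt_of_not_epi _ _ (not_epi_of_comp_δ_eq (Ne.symm hi) h'.symm)]
  rw [redHigh, dif_neg h]
  exact key _ _ (exists_comp_δ _ h).choose_spec.choose_spec

/-- Precomposition with a morphism of the simplex category. -/
def Simp.map (f : m ⟶ n) : D.Simp n → D.Simp m
  | .pt => .pt
  | .low a s _ => redLow a (f ≫ s)
  | .high b s _ => redHigh b (f ≫ s)

theorem map_redLow (f : m ⟶ n) (a : D.Low) (t : n ⟶ (SimplexCategory.mk e)) :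
    (redLow a t).map f = redLow a (f ≫ t) := by
  by_cases h : Epi t
  · rw [redLow_of_epi a t h]; rfl
  · rw [redLow_of_not_epi a t h, redLow_of_not_epi]
    · rfl
    · exact fun h' => h (epi_of_epi f t)

theorem map_redOpt (f : m ⟶ n) (o : Option D.Low) (t : n ⟶ (SimplexCategory.mk e)) :
    (redOpt o t).map f = redOpt o (f ≫ t) := by
  cases o
  · rfl
  · exact map_redLow (D := D) f _ t

theorem map_redHigh (f : m ⟶ n) (b : D.High) (t : n ⟶ (SimplexCategory.mk (e + 1))) :
    (redHigh b t).map f = redHigh b (f ≫ t) := by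
  by_cases h : Epi t
  · rw [redHigh_of_epi b t h]; rfl
  · obtain ⟨i, t', rfl⟩ := exists_comp_δ t h
    rw [redHigh_comp_δ, map_redOpt, ← Category.assoc, redHigh_comp_δ]

theorem map_id (x : D.Simp n) : x.map (𝟙 n) = x := by
  rcases x with _ | ⟨a, s, hs⟩ | ⟨b, s, hs⟩
  · rfl
  · rw [← redLow_of_epi a s hs, map_redLow, Category.id_comp]
  · rw [← redHigh_of_epi b s hs, map_redHigh, Category.id_comp]

/-- Every simplex other than `pt` is a value of `redLow` or `redHigh`, on which restriction is
precomposition, so functoriality is associativity. -/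
theorem map_comp (f : l ⟶ m) (g : m ⟶ n) (x : D.Simp n) : x.map (f ≫ g) = (x.map g).map f := by
  rcases x with _ | ⟨a, s, hs⟩ | ⟨b, s, hs⟩
  · rfl
  · rw [← redLow_of_epi a s hs, map_redLow, map_redLow, map_redLow, Category.assoc]
  · rw [← redHigh_of_epi b s hs, map_redHigh, map_redHigh, map_redHigh, Category.assoc]

variable (D) in
/-- The simplicial set with attaching data `D`. -/
def sset : SSet.{0} where
  obj n := D.Simp n.unop
  map f := ↾(Simp.map f.unop)
  map_id n := by ext x; exact map_id x
  map_comp f g := by ext x; exact map_comp g.unop f.unop x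

/-! ### Maps out of the simplicial set -/

section Desc

variable (D) in
/-- The data of a map from the simplicial set of `D` to `Y`. -/
structure Cocone (Y : SSet.{0}) where
  pt : SimpSet.Simplex Y 0
  low : D.Low → SimpSet.Simplex Y e
  high : D.High → SimpSet.Simplex Y (e + 1)
  low_map : ∀ (a : D.Low) (n : SimplexCategory) (t : n ⟶ (SimplexCategory.mk e)), ¬Epi t →
    Y.map t.op (low a) = Y.map (n.const (SimplexCategory.mk 0) 0).op pt
  high_δ : ∀ b i, Y.δ i (high b) =
    (D.face b i).elim (Y.map (SimplexCategory.const (SimplexCategory.mk e) (SimplexCategory.mk 0) 0).op pt) low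

variable {Y : SSet.{0}} (c : D.Cocone Y)

namespace Cocone

/-- The degenerate simplices at the base point. -/
def const (n : SimplexCategory) : Y.obj (op n) := Y.map (n.const (SimplexCategory.mk 0) 0).op c.pt

theorem map_const (f : m ⟶ n) : Y.map f.op (c.const n) = c.const m := by
  simp only [const, ← Functor.map_comp_apply, ← op_comp]
  rfl

/-- The map on simplices. -/
def toFun : D.Simp n → Y.obj (op n)
  | .pt => c.const n
  | .low a s _ => Y.map s.op (c.low a)
  | .high b s _ => Y.map s.op (c.high b)

theorem toFun_redLow (a : D.Low) (t : n ⟶ (SimplexCategory.mk e)) : c.toFun (redLow a t) = Y.map t.op (c.low a) := by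
  by_cases h : Epi t
  · rw [redLow_of_epi a t h]; rfl
  · rw [redLow_of_not_epi a t h, c.low_map a n t h]; rfl

theorem toFun_redHigh (b : D.High) (t : n ⟶ (SimplexCategory.mk (e + 1))) :
    c.toFun (redHigh b t) = Y.map t.op (c.high b) := by
  by_cases h : Epi t
  · rw [redHigh_of_epi b t h]; rfl
  · obtain ⟨i, t', rfl⟩ := exists_comp_δ t h
    rw [redHigh_comp_δ, op_comp, Functor.map_comp_apply]
    have := c.high_δ b i
    rw [SimplicialObject.δ] at this
    rw [this]
    rcases D.face b i with _ | a
    · exact (c.map_const t').symm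
    · exact c.toFun_redLow a t'

theorem toFun_map (f : m ⟶ n) (x : D.Simp n) : c.toFun (x.map f) = Y.map f.op (c.toFun x) := by
  rcases x with _ | ⟨a, s, hs⟩ | ⟨b, s, hs⟩
  · exact (c.map_const f).symm
  · rw [← redLow_of_epi a s hs, map_redLow, toFun_redLow, toFun_redLow, op_comp,
      Functor.map_comp_apply]
  · rw [← redHigh_of_epi b s hs, map_redHigh, toFun_redHigh, toFun_redHigh, op_comp,
      Functor.map_comp_apply]

/-- The map of simplicial sets given by the data. -/
def desc : D.sset ⟶ Y where
  app n := ↾(fun x => c.toFun x)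
  naturality m n f := by
    ext x
    exact c.toFun_map f.unop x

end Cocone

end Desc

end CellData

end BigHomology

end

noncomputable section

namespace BigHomology

open CategoryTheory Opposite
open SimplexCategory (δ σ)

namespace CellData

variable {e : ℕ} {D : CellData e}

/-! ### Nondegenerate simplices -/

/-- The `e`-dimensional simplex `a`. -/
def lowCell (a : D.Low) : SimpSet.Simplex D.sset e := Simp.low a (𝟙 _) inferInstance

/-- The `e + 1`-dimensional simplex `b`. -/
def highCell (b : D.High) : SimpSet.Simplex D.sset (e + 1) := Simp.high b (𝟙 _) inferInstance

theorem redLow_eq_map (a : D.Low) {n : ℕ} (t : SimplexCategory.mk n ⟶ SimplexCategory.mk e) :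
    redLow a t = D.sset.map t.op (lowCell a) := by
  exact (congrArg (redLow a) (Category.comp_id t)).symm

theorem redHigh_eq_map (b : D.High) {n : ℕ}
    (t : SimplexCategory.mk n ⟶ SimplexCategory.mk (e + 1)) :
    redHigh b t = D.sset.map t.op (highCell b) := by
  exact (congrArg (redHigh b) (Category.comp_id t)).symm

theorem pt_mem_degenerate (n : ℕ) :
    (Simp.pt : D.Simp (SimplexCategory.mk (n + 1))) ∈ D.sset.degenerate (n + 1) :=
  ⟨0, Nat.succ_pos n, SimplexCategory.const _ _ 0, Simp.pt, rfl⟩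

theorem low_mem_degenerate {n : ℕ} (a : D.Low)
    (s : SimplexCategory.mk n ⟶ SimplexCategory.mk e) (hs : Epi s) (h : e < n) :
    (Simp.low a s hs : D.Simp (SimplexCategory.mk n)) ∈ D.sset.degenerate n :=
  ⟨e, h, s, lowCell a, by rw [← redLow_of_epi a s hs, redLow_eq_map]⟩

theorem high_mem_degenerate {n : ℕ} (b : D.High)
    (s : SimplexCategory.mk n ⟶ SimplexCategory.mk (e + 1)) (hs : Epi s) (h : e + 1 < n) :
    (Simp.high b s hs : D.Simp (SimplexCategory.mk n)) ∈ D.sset.degenerate n :=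
  ⟨e + 1, h, s, highCell b, by rw [← redHigh_of_epi b s hs, redHigh_eq_map]⟩

/-- Restrictions of `pt` and of low simplices are never high, and a high simplex does not exist in
dimension below `e + 1`. -/
theorem highCell_mem_nonDegenerate (b : D.High) :
    highCell b ∈ D.sset.nonDegenerate (e + 1) := by
  rintro ⟨m, hm, f, y, hy⟩
  replace hy : Simp.map f y = highCell b := hy
  rcases y with _ | ⟨a, s, hs⟩ | ⟨b', s, hs⟩
  · cases hy
  · have hy' : redLow a (f ≫ s) = highCell b := hy
    by_cases h : Epi (f ≫ s)
    · rw [redLow_of_epi _ _ h] at hy'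
      cases hy'
    · rw [redLow_of_not_epi _ _ h] at hy'
      cases hy'
  · have := SimplexCategory.le_of_epi s
    omega

/-- The list of all nondegenerate simplices. -/
def label : Option (D.Low ⊕ D.High) → D.sset.S
  | none => SSet.S.mk (X := D.sset) (dim := 0) Simp.pt
  | some (.inl a) => SSet.S.mk (lowCell a)
  | some (.inr b) => SSet.S.mk (highCell b)

/-- A surjection that lowers the dimension exhibits its simplex as degenerate, and one that
preserves it is the identity. -/
theorem mem_range_label (s : D.sset.N) : s.toS ∈ Set.range (label (D := D)) := by
  obtain ⟨n, ⟨x, hx⟩, rfl⟩ := s.mk_surjective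
  rcases x with _ | ⟨a, s, hs⟩ | ⟨b, s, hs⟩
  · rcases n with _ | n
    · exact ⟨none, rfl⟩
    · exact absurd (pt_mem_degenerate n) hx
  · have h1 := SimplexCategory.le_of_epi s
    rcases h1.lt_or_eq with h | rfl
    · exact absurd (low_mem_degenerate a s hs h) hx
    · obtain rfl := SimplexCategory.eq_id_of_epi s
      exact ⟨some (.inl a), rfl⟩
  · have h1 := SimplexCategory.le_of_epi s
    rcases h1.lt_or_eq with h | rfl
    · exact absurd (high_mem_degenerate b s hs h) hx
    · obtain rfl := SimplexCategory.eq_id_of_epi s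
      exact ⟨some (.inr b), rfl⟩

theorem toS_injective (X : SSet.{0}) : Function.Injective (SSet.N.toS (X := X)) :=
  fun x y h => (SSet.N.ext_iff x y).2 h

variable (D) in
theorem sset_finite [Finite D.Low] [Finite D.High] : D.sset.Finite where
  finite := by
    have : Finite (Set.range (label (D := D))) := Set.finite_range _
    exact Finite.of_injective (fun s : D.sset.N => (⟨_, mem_range_label s⟩ : Set.range (label (D := D))))
      fun x y h => toS_injective _ (Subtype.ext_iff.1 h)

variable (D) in
theorem card_sset_N_le [Finite D.Low] [Finite D.High] :
    Nat.card D.sset.N ≤ Nat.card D.Low + Nat.card D.High + 1 := by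
  have : Finite (Set.range (label (D := D))) := Set.finite_range _
  calc Nat.card D.sset.N ≤ Nat.card (Set.range (label (D := D))) :=
        Nat.card_le_card_of_injective
          (fun s : D.sset.N => (⟨_, mem_range_label s⟩ : Set.range (label (D := D))))
          fun x y h => toS_injective _ (Subtype.ext_iff.1 h)
    _ ≤ Nat.card (Option (D.Low ⊕ D.High)) := Finite.card_range_le _
    _ = _ := by rw [Finite.card_option, Nat.card_sum]

variable (D) in
theorem le_card_sset_N [Finite D.Low] [Finite D.High] : Nat.card D.High ≤ Nat.card D.sset.N := by
  have := (sset_finite D).finite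
  refine Nat.card_le_card_of_injective
    (fun b => SSet.N.mk (highCell b) (highCell_mem_nonDegenerate b)) fun b b' h => ?_
  have h1 := (SSet.N.ext_iff _ _).1 h
  have h2 := (SSet.S.ext_iff (highCell b) (highCell b')).1 h1
  exact (Simp.high.inj h2).1

variable (D) in
theorem hasDimensionLE : D.sset.HasDimensionLE (e + 1) where
  degenerate_eq_top n hn := by
    refine Set.eq_univ_of_forall fun x => ?_
    obtain ⟨n, rfl⟩ : ∃ k, n = k + 1 := ⟨n - 1, by omega⟩
    rcases x with _ | ⟨a, s, hs⟩ | ⟨b, s, hs⟩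
    · exact pt_mem_degenerate n
    · exact low_mem_degenerate a s hs (by omega)
    · exact high_mem_degenerate b s hs (by omega)

variable (D) in
theorem hasDim [Nonempty D.High] : SimpSet.HasDim D.sset (e + 1) :=
  ⟨hasDimensionLE D, ⟨_, highCell_mem_nonDegenerate (Classical.arbitrary D.High)⟩⟩

variable (D) in
theorem isReduced (r : ℕ) (hr : r < e) : SimpSet.IsReduced D.sset r := fun i hi => by
  refine ⟨Simp.pt, trivial, fun x _ => ?_⟩
  rcases x with _ | ⟨a, s, hs⟩ | ⟨b, s, hs⟩
  · rfl
  · have := SimplexCategory.le_of_epi s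
    omega
  · have := SimplexCategory.le_of_epi s
    omega

/-! ### Size -/

theorem one_le_recordSize (X : SSet.{0}) {n : ℕ} (x : SimpSet.Simplex X n) :
    1 ≤ SimpSet.recordSize X n x := by
  cases n
  · exact le_rfl
  · exact Nat.le_add_right _ _

/-- A simplex of positive dimension `n` has `n + 1` faces, each stored in at most `n` entries. -/
theorem recordSize_le (X : SSet.{0}) {n r : ℕ} (x : SimpSet.Simplex X n) (h : n ≤ r) :
    SimpSet.recordSize X n x ≤ 1 + (r + 1) * (r + 1) := by
  rcases n with _ | n
  · exact Nat.le_add_right _ _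
  · refine Nat.add_le_add_left ((Finset.sum_le_card_nsmul _ _ (n + 1) fun i _ => by omega).trans ?_) 1
    rw [Finset.card_univ, Fintype.card_fin, smul_eq_mul]
    exact Nat.mul_le_mul (by omega) (by omega)

variable (D) in
theorem card_high_le_size [Finite D.Low] [Finite D.High] :
    Nat.card D.High ≤ SimpSet.size D.sset := by
  have := (sset_finite D).finite
  have := Fintype.ofFinite D.sset.N
  refine (le_card_sset_N D).trans ?_
  rw [SimpSet.size, finsum_eq_sum_of_fintype, Nat.card_eq_fintype_card, ← Finset.card_univ,
    Finset.card_eq_sum_ones]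
  exact Finset.sum_le_sum fun s _ => one_le_recordSize _ _

variable (D) in
theorem size_le [Finite D.Low] [Finite D.High] :
    SimpSet.size D.sset ≤
      (1 + (e + 2) * (e + 2)) * (Nat.card D.Low + Nat.card D.High + 1) := by
  have := (sset_finite D).finite
  have := Fintype.ofFinite D.sset.N
  have := hasDimensionLE D
  refine le_trans ?_ (Nat.mul_le_mul_left _ (card_sset_N_le D))
  rw [SimpSet.size, finsum_eq_sum_of_fintype, Nat.card_eq_fintype_card, mul_comm,
    ← Finset.card_univ, ← smul_eq_mul]
  exact Finset.sum_le_card_nsmul _ _ _ fun s _ => recordSize_le _ _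
    (D.sset.dim_le_of_nonDegenerate ⟨_, s.nonDegenerate⟩ (e + 1))

end CellData

end BigHomology

end

/-! ### Boundaries of degenerate simplices and the effect of degenerate chains on homology. -/

noncomputable section

namespace BigHomology

open CategoryTheory Opposite
open SimplexCategory (δ σ)

theorem δ_apply_val {n : ℕ} (i : Fin (n + 2)) (x : Fin (n + 1)) :
    ((δ i).toOrderHom x : ℕ) = if (x : ℕ) < i then (x : ℕ) else x + 1 := by
  change (i.succAbove x : ℕ) = _
  by_cases h : (x : ℕ) < i
  · rw [Fin.succAbove_of_castSucc_lt _ _ h, if_pos h]; rfl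
  · rw [Fin.succAbove_of_le_castSucc _ _ (not_lt.1 h), if_neg h]; rfl

theorem σ_apply_val {n : ℕ} (j : Fin (n + 1)) (x : Fin (n + 2)) :
    ((σ j).toOrderHom x : ℕ) = if (j : ℕ) < x then (x : ℕ) - 1 else x := by
  change (j.predAbove x : ℕ) = _
  by_cases h : (j : ℕ) < x
  · rw [Fin.predAbove_of_castSucc_lt _ _ h, if_pos h]; rfl
  · rw [Fin.predAbove_of_le_castSucc _ _ (not_lt.1 h), if_neg h]; rfl

theorem δ_comp_σ_eq_id_iff {n : ℕ} (i : Fin (n + 2)) (j : Fin (n + 1)) :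
    δ i ≫ σ j = 𝟙 _ ↔ i = j.castSucc ∨ i = j.succ := by
  constructor
  · intro h
    have hx : ∀ x : Fin (n + 1), ((σ j).toOrderHom ((δ i).toOrderHom x) : ℕ) = x := fun x => by
      have := congr_arg
        (fun f : SimplexCategory.mk n ⟶ SimplexCategory.mk n => (f.toOrderHom x : ℕ)) h
      exact this
    rw [Fin.ext_iff, Fin.ext_iff, Fin.val_castSucc, Fin.val_succ]
    by_contra hne
    have hi := i.2
    have hj := j.2
    rcases Nat.lt_or_ge i j with h1 | h1
    · have := hx ⟨i, by omega⟩
      rw [σ_apply_val, δ_apply_val] at this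
      simp only at this
      split_ifs at this <;> omega
    · have := hx ⟨i - 1, by omega⟩
      rw [σ_apply_val, δ_apply_val] at this
      simp only at this
      split_ifs at this <;> omega
  · rintro (rfl | rfl)
    · exact SimplexCategory.δ_comp_σ_self
    · exact SimplexCategory.δ_comp_σ_succ

/-- Exactly two consecutive faces undo a degeneracy, and their signs cancel. Hence a cell does not
occur in the boundary of its own degeneracies. -/
theorem sum_δ_comp_σ {n : ℕ} (j : Fin (n + 1)) [∀ i : Fin (n + 2), Decidable (δ i ≫ σ j = 𝟙 _)] :
    ∑ i : Fin (n + 2), (-1 : ℤ) ^ (i : ℕ) * (if δ i ≫ σ j = 𝟙 _ then 1 else 0) = 0 := by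
  have h : ∀ i : Fin (n + 2), (-1 : ℤ) ^ (i : ℕ) * (if δ i ≫ σ j = 𝟙 _ then 1 else 0) =
      (if i = j.castSucc then (-1 : ℤ) ^ (i : ℕ) else 0) +
        if i = j.succ then (-1 : ℤ) ^ (i : ℕ) else 0 := by
    intro i
    have hne : j.castSucc ≠ j.succ := (Fin.castSucc_lt_succ).ne
    by_cases h1 : i = j.castSucc
    · rw [if_pos ((δ_comp_σ_eq_id_iff i j).2 (Or.inl h1)), if_pos h1, if_neg (h1 ▸ hne)]
      ring
    · by_cases h2 : i = j.succ
      · rw [if_pos ((δ_comp_σ_eq_id_iff i j).2 (Or.inr h2)), if_neg h1, if_pos h2]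
        ring
      · rw [if_neg (fun h => ((δ_comp_σ_eq_id_iff i j).1 h).elim h1 h2), if_neg h1, if_neg h2]
        ring
  rw [Finset.sum_congr rfl fun i _ => h i, Finset.sum_add_distrib, Finset.sum_ite_eq',
    Finset.sum_ite_eq', if_pos (Finset.mem_univ _), if_pos (Finset.mem_univ _), Fin.val_castSucc,
    Fin.val_succ, pow_succ]
  ring

/-- The composite degeneracy identifies `j`, `j + 1` and `j + 2`; omitting one of the three leaves
the pair identified by `σ j`. -/
theorem δ_comp_σ_comp_σ_of_mem {n : ℕ} (i : Fin (n + 3)) (j : Fin (n + 1))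
    (h : (i : ℕ) = j ∨ (i : ℕ) = j + 1 ∨ (i : ℕ) = j + 2) :
    δ i ≫ σ j.castSucc ≫ σ j = σ j := by
  rcases h with h | h | h
  · obtain rfl : i = j.castSucc.castSucc := Fin.ext h
    rw [SimplexCategory.δ_comp_σ_self_assoc]
  · obtain rfl : i = j.castSucc.succ := Fin.ext h
    rw [SimplexCategory.δ_comp_σ_succ_assoc]
  · obtain rfl : i = j.succ.succ := Fin.ext h
    rw [SimplexCategory.δ_comp_σ_of_gt_assoc (Fin.castSucc_lt_succ),
      SimplexCategory.δ_comp_σ_succ, Category.comp_id]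

/-- A vertex outside the triple fibre is the only preimage of its image, which is `i` below the
fibre and `i - 2` above it; omitting the vertex loses that image. -/
theorem not_epi_δ_comp_σ_comp_σ {n : ℕ} (i : Fin (n + 3)) (j : Fin (n + 1))
    (h : ¬((i : ℕ) = j ∨ (i : ℕ) = j + 1 ∨ (i : ℕ) = j + 2)) :
    ¬Epi (δ i ≫ σ j.castSucc ≫ σ j) := by
  rw [SimplexCategory.epi_iff_surjective]
  intro hs
  have hi := i.2
  have hj := j.2
  have key : ∀ y : Fin (n + 1), ∃ x : Fin (n + 2),
      ((σ j).toOrderHom ((σ j.castSucc).toOrderHom ((δ i).toOrderHom x)) : ℕ) = y := fun y => by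
    obtain ⟨x, hx⟩ := hs y
    exact ⟨x, congr_arg Fin.val hx⟩
  rcases Nat.lt_or_ge i j with h1 | h1
  · obtain ⟨x, hx⟩ := key ⟨i, by omega⟩
    rw [σ_apply_val, σ_apply_val, δ_apply_val, Fin.val_castSucc] at hx
    simp only at hx
    split_ifs at hx <;> omega
  · obtain ⟨x, hx⟩ := key ⟨i - 2, by omega⟩
    rw [σ_apply_val, σ_apply_val, δ_apply_val, Fin.val_castSucc] at hx
    simp only at hx
    split_ifs at hx <;> omega

namespace SimpSet

variable (X : SSet.{0})

theorem bd_single {n : ℕ} (x : Simplex X (n + 1)) (r : ℤ) :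
    bd X n (Finsupp.single x r) =
      r • ∑ i : Fin (n + 2), (-1 : ℤ) ^ (i : ℕ) • Finsupp.single (X.δ i x) (1 : ℤ) := by
  rw [bd, Finsupp.liftAddHom_apply_single]
  rfl

theorem bd_single_apply {n : ℕ} (x : Simplex X (n + 1)) (y : Simplex X n) [DecidableEq (Simplex X n)] :
    bd X n (Finsupp.single x 1) y =
      ∑ i : Fin (n + 2), (-1 : ℤ) ^ (i : ℕ) * if X.δ i x = y then 1 else 0 := by
  rw [bd_single, one_smul, Finsupp.finsetSum_apply]
  refine Finset.sum_congr rfl fun i _ => ?_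
  rw [Finsupp.smul_apply, Finsupp.single_apply, smul_eq_mul]

/-- The sum of the coefficients of a chain. -/
def augmentation (n : ℕ) : Chain X n →+ ℤ := Finsupp.liftAddHom fun _ => AddMonoidHom.id ℤ

theorem augmentation_single {n : ℕ} (x : Simplex X n) (r : ℤ) :
    augmentation X n (Finsupp.single x r) = r := by
  rw [augmentation, Finsupp.liftAddHom_apply_single]; rfl

/-- The alternating sum is `0` or `1` according to parity. The augmentation serves to detect
multiples of the degenerate base point. -/
theorem augmentation_bd {n : ℕ} (c : Chain X (n + 1)) :
    augmentation X n (bd X n c) =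
      (∑ i : Fin (n + 2), (-1 : ℤ) ^ (i : ℕ)) * augmentation X (n + 1) c := by
  have : (augmentation X n).comp (bd X n) =
      (AddMonoidHom.mulLeft (∑ i : Fin (n + 2), (-1 : ℤ) ^ (i : ℕ))).comp
        (augmentation X (n + 1)) := by
    refine Finsupp.addHom_ext fun x r => ?_
    simp only [AddMonoidHom.comp_apply, bd_single, map_zsmul, map_sum, augmentation_single,
      AddMonoidHom.coe_mulLeft, smul_eq_mul, mul_one]
    ring
  exact DFunLike.congr_fun this c

end SimpSet

theorem sum_neg_one_pow_even {n : ℕ} (h : Even n) : ∑ i : Fin n, (-1 : ℤ) ^ (i : ℕ) = 0 := by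
  rw [Fin.sum_univ_eq_sum_range (fun i => (-1 : ℤ) ^ i), neg_one_geom_sum, if_pos h]

theorem sum_neg_one_pow_odd {n : ℕ} (h : Odd n) : ∑ i : Fin n, (-1 : ℤ) ^ (i : ℕ) = 1 := by
  rw [Fin.sum_univ_eq_sum_range (fun i => (-1 : ℤ) ^ i), neg_one_geom_sum,
    if_neg (Nat.not_even_iff_odd.2 h)]

namespace CellData

variable {e : ℕ} {D : CellData e}

theorem redLow_eq_lowCell_iff (a a' : D.Low) (t : SimplexCategory.mk e ⟶ SimplexCategory.mk e) :
    redLow a' t = lowCell a ↔ a' = a ∧ t = 𝟙 _ := by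
  constructor
  · intro h
    by_cases ht : Epi t
    · rw [redLow_of_epi _ _ ht] at h
      exact Simp.low.inj h
    · rw [redLow_of_not_epi _ _ ht] at h
      cases h
  · rintro ⟨rfl, rfl⟩
    exact redLow_of_epi _ _ inferInstance

theorem redOpt_id_eq_lowCell_iff (a : D.Low) (o : Option D.Low) :
    redOpt o (𝟙 (SimplexCategory.mk e)) = lowCell a ↔ o = some a := by
  rcases o with _ | a'
  · exact iff_of_false (fun h : (Simp.pt : D.Simp _) = lowCell a => by cases h) (by simp)
  · exact (redLow_eq_lowCell_iff a a' _).trans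
      ⟨fun h => congrArg some h.1, fun h => ⟨Option.some.inj h, rfl⟩⟩

theorem redOpt_ne_high (o : Option D.Low) {n : SimplexCategory}
    (t : n ⟶ SimplexCategory.mk e) (b : D.High) (s) (hs) :
    redOpt o t ≠ Simp.high b s hs := by
  rcases o with _ | a
  · exact fun h => by cases h
  · change redLow a t ≠ _
    by_cases h : Epi t
    · rw [redLow_of_epi _ _ h]
      exact fun h => by cases h
    · rw [redLow_of_not_epi _ _ h]
      exact fun h => by cases h

theorem redHigh_eq_highCell_iff (b b' : D.High)
    (t : SimplexCategory.mk (e + 1) ⟶ SimplexCategory.mk (e + 1)) :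
    redHigh b' t = highCell b ↔ b' = b ∧ t = 𝟙 _ := by
  constructor
  · intro h
    by_cases ht : Epi t
    · rw [redHigh_of_epi _ _ ht] at h
      exact Simp.high.inj h
    · obtain ⟨i, t', rfl⟩ := exists_comp_δ t ht
      rw [redHigh_comp_δ] at h
      exact absurd h (redOpt_ne_high _ _ _ _ _)
  · rintro ⟨rfl, rfl⟩
    exact redHigh_of_epi _ _ inferInstance

open Classical in
theorem bd_single_apply_of_face {n : ℕ} (x : D.Simp (SimplexCategory.mk (n + 1)))
    (y : D.Simp (SimplexCategory.mk n)) :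
    SimpSet.bd D.sset n (Finsupp.single x 1) y =
      ∑ i : Fin (n + 2), (-1 : ℤ) ^ (i : ℕ) * if x.map (δ i) = y then 1 else 0 := by
  exact SimpSet.bd_single_apply D.sset x y

theorem bd_single_of_face {n : ℕ} (x : D.Simp (SimplexCategory.mk (n + 1))) :
    SimpSet.bd D.sset n (Finsupp.single x 1) = ∑ i : Fin (n + 2), (-1 : ℤ) ^ (i : ℕ) •
      (Finsupp.single (x.map (δ i)) (1 : ℤ) : SimpSet.Chain D.sset n) :=
  (SimpSet.bd_single D.sset x 1).trans (one_smul _ _)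

open Classical in
-- Degenerate simplices drop out by `sum_δ_comp_σ`, so the coefficient is the cellular one, given by
-- the incidence numbers of the attaching data.
theorem bd_apply_lowCell [Fintype D.High] (c : SimpSet.Chain D.sset (e + 1)) (a : D.Low) :
    SimpSet.bd D.sset e c (lowCell a) = ∑ b, c (highCell b) *
      ∑ i : Fin (e + 2), (-1 : ℤ) ^ (i : ℕ) * if D.face b i = some a then 1 else 0 := by
  have : (Finsupp.applyAddHom (lowCell a)).comp (SimpSet.bd D.sset e) =
      ∑ b, (AddMonoidHom.mulRight (∑ i : Fin (e + 2), (-1 : ℤ) ^ (i : ℕ) *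
        if D.face b i = some a then 1 else 0)).comp (Finsupp.applyAddHom (highCell b)) := by
    refine Finsupp.addHom_ext' fun x => AddMonoidHom.ext_int ?_
    simp only [AddMonoidHom.comp_apply, Finsupp.applyAddHom_apply, Finsupp.singleAddHom_apply,
      AddMonoidHom.finsetSum_apply, AddMonoidHom.coe_mulRight]
    refine (bd_single_apply_of_face _ _).trans ?_
    rcases x with _ | ⟨a', s, hs⟩ | ⟨b', s, hs⟩
    · rw [Finset.sum_eq_zero, Finset.sum_eq_zero]
      · intro b _
        exact mul_eq_zero_of_left (Finsupp.single_apply.trans (if_neg fun h => by cases h)) _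
      · intro i _
        rw [if_neg, mul_zero]
        exact fun h => by cases h
    · rw [Finset.sum_eq_zero (s := Finset.univ (α := D.High))]
      · obtain ⟨j, rfl⟩ := SimplexCategory.eq_σ_of_epi s
        by_cases ha : a' = a
        · subst ha
          refine Eq.trans ?_ (sum_δ_comp_σ j)
          refine Finset.sum_congr rfl fun i _ => ?_
          congr 1
          refine if_congr ?_ rfl rfl
          exact (redLow_eq_lowCell_iff _ _ _).trans (and_iff_right rfl)
        · refine Finset.sum_eq_zero fun i _ => ?_
          rw [if_neg, mul_zero]
          exact fun h => ha ((redLow_eq_lowCell_iff _ _ _).1 h).1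
      · intro b _
        exact mul_eq_zero_of_left (Finsupp.single_apply.trans (if_neg fun h => by cases h)) _
    · obtain rfl := SimplexCategory.eq_id_of_epi s
      rw [Finset.sum_eq_single b']
      · refine Eq.trans ?_ (congrArg (· * _) (Finsupp.single_eq_same (a := highCell b')).symm)
        rw [one_mul]
        refine Finset.sum_congr rfl fun i _ => ?_
        congr 1
        refine if_congr ?_ rfl rfl
        rw [← redOpt_id_eq_lowCell_iff, ← redHigh_comp_δ, Category.id_comp]
        change redHigh b' (δ i ≫ 𝟙 _) = _ ↔ _
        rw [Category.comp_id]
      · intro b _ hb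
        exact mul_eq_zero_of_left (Finsupp.single_apply.trans
          (if_neg fun h => hb (Simp.high.inj h).1.symm)) _
      · exact fun h => absurd (Finset.mem_univ _) h
  have := DFunLike.congr_fun this c
  simpa only [AddMonoidHom.comp_apply, Finsupp.applyAddHom_apply,
      AddMonoidHom.finsetSum_apply, AddMonoidHom.coe_mulRight] using this

/-- All simplices of dimension `e + 2` are degenerate and their faces returning to a cell cancel in
pairs. Thus coefficients on high cells depend only on the homology class. -/
theorem bd_apply_highCell (c : SimpSet.Chain D.sset (e + 2)) (b : D.High) :
    SimpSet.bd D.sset (e + 1) c (highCell b) = 0 := by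
  classical
  have : (Finsupp.applyAddHom (highCell b)).comp (SimpSet.bd D.sset (e + 1)) = 0 := by
    refine Finsupp.addHom_ext' fun x => AddMonoidHom.ext_int ?_
    simp only [AddMonoidHom.comp_apply, Finsupp.applyAddHom_apply, Finsupp.singleAddHom_apply,
      AddMonoidHom.zero_apply]
    refine (bd_single_apply_of_face _ _).trans ?_
    rcases x with _ | ⟨a', s, hs⟩ | ⟨b', s, hs⟩
    · refine Finset.sum_eq_zero fun i _ => ?_
      rw [if_neg, mul_zero]
      exact fun h => by cases h
    · refine Finset.sum_eq_zero fun i _ => ?_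
      rw [if_neg, mul_zero]
      exact redOpt_ne_high (some a') (δ i ≫ s) b _ _
    · obtain ⟨j, rfl⟩ := SimplexCategory.eq_σ_of_epi s
      by_cases hb : b' = b
      · subst hb
        refine Eq.trans ?_ (sum_δ_comp_σ j)
        refine Finset.sum_congr rfl fun i _ => ?_
        congr 1
        refine if_congr ?_ rfl rfl
        exact (redHigh_eq_highCell_iff _ _ _).trans (and_iff_right rfl)
      · refine Finset.sum_eq_zero fun i _ => ?_
        rw [if_neg, mul_zero]
        exact fun h => hb ((redHigh_eq_highCell_iff _ _ _).1 h).1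
  exact DFunLike.congr_fun this c

variable (D) in
/-- The chain given by the degenerate simplex at the base point. -/
def ptChain (n : ℕ) : SimpSet.Chain D.sset n :=
  Finsupp.single (Simp.pt : D.Simp (SimplexCategory.mk n)) 1

variable (D) in
theorem bd_ptChain (n : ℕ) :
    SimpSet.bd D.sset n (ptChain D (n + 1)) =
      (∑ i : Fin (n + 2), (-1 : ℤ) ^ (i : ℕ)) • ptChain D n := by
  rw [Finset.sum_smul]
  exact bd_single_of_face Simp.pt

variable (D) in
theorem augmentation_ptChain (n : ℕ) : SimpSet.augmentation D.sset n (ptChain D n) = 1 :=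
  SimpSet.augmentation_single _ _ _

/-- Degenerating once more at the same place gives a simplex with three consecutive faces equal to
the given one, contributing `1 - 1 + 1` up to sign, while all its other faces are the base point. -/
theorem single_low_mem (a : D.Low) (s : SimplexCategory.mk (e + 1) ⟶ SimplexCategory.mk e)
    (hs : Epi s) :
    (Finsupp.single (Simp.low a s hs : D.Simp (SimplexCategory.mk (e + 1))) 1 :
      SimpSet.Chain D.sset (e + 1)) ∈
      (SimpSet.bd D.sset (e + 1)).range ⊔ AddSubgroup.zmultiples (ptChain D (e + 1)) := by
  obtain ⟨j, rfl⟩ := SimplexCategory.eq_σ_of_epi s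
  set f : SimpSet.Chain D.sset (e + 1) :=
    Finsupp.single (Simp.low a (σ j) hs : D.Simp (SimplexCategory.mk (e + 1))) 1 with hf
  set P := (SimpSet.bd D.sset (e + 1)).range ⊔ AddSubgroup.zmultiples (ptChain D (e + 1))
  have hp : ptChain D (e + 1) ∈ P :=
    (le_sup_right : _ ≤ P) (AddSubgroup.mem_zmultiples _)
  let T : Finset (Fin (e + 3)) := {j.castSucc.castSucc, j.castSucc.succ, j.succ.succ}
  have hT : ∀ i : Fin (e + 3), i ∈ T ↔ ((i : ℕ) = j ∨ (i : ℕ) = j + 1 ∨ (i : ℕ) = j + 2) :=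
    fun i => by simp [T, Fin.ext_iff]
  have hx : SimpSet.bd D.sset (e + 1) (Finsupp.single
      (Simp.low a (σ j.castSucc ≫ σ j) inferInstance : D.Simp (SimplexCategory.mk (e + 2))) 1) ∈ P :=
    (le_sup_left : _ ≤ P) ⟨_, rfl⟩
  have hterm : ∀ i : Fin (e + 3), (Finsupp.single
      ((Simp.low a (σ j.castSucc ≫ σ j) inferInstance :
        D.Simp (SimplexCategory.mk (e + 2))).map (δ i)) 1 :
        SimpSet.Chain D.sset (e + 1)) = if i ∈ T then f else ptChain D (e + 1) := by
    intro i
    have h0 : (Simp.low a (σ j.castSucc ≫ σ j) inferInstance :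
        D.Simp (SimplexCategory.mk (e + 2))).map (δ i) =
        redLow a (δ i ≫ σ j.castSucc ≫ σ j) := rfl
    rw [h0]
    by_cases h : i ∈ T
    · rw [if_pos h, δ_comp_σ_comp_σ_of_mem i j ((hT i).1 h), redLow_of_epi _ _ hs]
    · rw [if_neg h, redLow_of_not_epi _ _
        (not_epi_δ_comp_σ_comp_σ i j fun h' => h ((hT i).2 h'))]
      rfl
  replace hx := (bd_single_of_face (D := D) _) ▸ hx
  simp_rw [hterm] at hx
  have h1 : ∑ i : Fin (e + 3), ((-1 : ℤ) ^ (i : ℕ) • if i ∈ T then f else ptChain D (e + 1)) =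
      (-1 : ℤ) ^ (j : ℕ) • f +
        ∑ i : Fin (e + 3), (-1 : ℤ) ^ (i : ℕ) • (if i ∈ T then 0 else ptChain D (e + 1)) := by
    have h2 : (-1 : ℤ) ^ (j : ℕ) • f =
        ∑ i : Fin (e + 3), (-1 : ℤ) ^ (i : ℕ) • (if i ∈ T then f else 0) := by
      have h3 : j.castSucc.castSucc ∉ ({j.castSucc.succ, j.succ.succ} : Finset (Fin (e + 3))) := by
        simp only [Finset.mem_insert, Finset.mem_singleton, Fin.ext_iff, Fin.val_castSucc,
          Fin.val_succ]
        omega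
      have h4 : j.castSucc.succ ∉ ({j.succ.succ} : Finset (Fin (e + 3))) := by
        simp [Fin.ext_iff]
      simp_rw [smul_ite, smul_zero]
      rw [Finset.sum_ite_mem, Finset.univ_inter, Finset.sum_insert h3, Finset.sum_insert h4,
        Finset.sum_singleton, ← add_smul, ← add_smul]
      congr 1
      simp only [Fin.val_castSucc, Fin.val_succ, pow_succ]
      ring
    rw [h2, ← Finset.sum_add_distrib]
    refine Finset.sum_congr rfl fun i _ => ?_
    by_cases h : i ∈ T <;> simp [h]
  rw [h1] at hx
  have h5 : ∑ i : Fin (e + 3), (-1 : ℤ) ^ (i : ℕ) • (if i ∈ T then 0 else ptChain D (e + 1)) ∈ P :=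
    sum_mem fun i _ => P.zsmul_mem (by split_ifs; exacts [P.zero_mem, hp]) _
  have h6 := P.zsmul_mem ((add_mem_cancel_right h5).1 hx) ((-1 : ℤ) ^ (j : ℕ))
  rwa [smul_smul, ← mul_pow, neg_one_mul, neg_neg, one_pow, one_smul] at h6

/-- A chain without nondegenerate simplices is a multiple of the base point up to boundaries. -/
theorem mem_of_apply_highCell_eq_zero (c : SimpSet.Chain D.sset (e + 1))
    (hc : ∀ b, c (highCell b) = 0) :
    c ∈ (SimpSet.bd D.sset (e + 1)).range ⊔ AddSubgroup.zmultiples (ptChain D (e + 1)) := by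
  rw [← Finsupp.sum_single c]
  refine sum_mem fun x hx => ?_
  have h1 : (Finsupp.single x (c x) : SimpSet.Chain D.sset (e + 1)) = c x • Finsupp.single x 1 := by
    rw [Finsupp.smul_single, smul_eq_mul, mul_one]
  rw [h1]
  refine AddSubgroup.zsmul_mem _ ?_ _
  rcases x with _ | ⟨a, s, hs⟩ | ⟨b, s, hs⟩
  · exact (le_sup_right : _ ≤ (SimpSet.bd D.sset (e + 1)).range ⊔ _)
      (AddSubgroup.mem_zmultiples _)
  · exact single_low_mem a s hs
  · obtain rfl := SimplexCategory.eq_id_of_epi s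
    exact absurd (hc b) (Finsupp.mem_support_iff.1 hx)

/-- Only a multiple `m` of the base point chain remains. For even `e` that chain is a boundary, as
the `e + 3` faces above it have alternating sum `1`. For odd `e` the augmentation of `c` is `m` and
is preserved by the boundary, so `m = 0`. -/
theorem mem_range_bd (c : SimpSet.Chain D.sset (e + 1)) (hc : ∀ b, c (highCell b) = 0)
    (h : SimpSet.bd D.sset e c = 0) : c ∈ (SimpSet.bd D.sset (e + 1)).range := by
  obtain ⟨u, ⟨w, rfl⟩, v, hv, rfl⟩ := AddSubgroup.mem_sup.1 (mem_of_apply_highCell_eq_zero c hc)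
  obtain ⟨m, rfl⟩ := AddSubgroup.mem_zmultiples_iff.1 hv
  refine add_mem ⟨w, rfl⟩ ?_
  rcases Nat.even_or_odd e with he | he
  · refine AddSubgroup.zsmul_mem _ ?_ _
    refine ⟨ptChain D (e + 2), ?_⟩
    rw [bd_ptChain, sum_neg_one_pow_odd (n := e + 1 + 2) (he.add_odd (by decide : Odd 3)), one_smul]
  · have h1 := congrArg (SimpSet.augmentation D.sset e) h
    rw [map_zero, SimpSet.augmentation_bd, map_add, SimpSet.augmentation_bd, map_zsmul,
      sum_neg_one_pow_even (n := e + 1 + 2) (he.add_odd (by decide : Odd 3)), zero_mul, zero_add,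
      sum_neg_one_pow_odd (n := e + 2) (he.add_even (by decide : Even 2)), one_mul,
      augmentation_ptChain, smul_eq_mul, mul_one] at h1
    rw [h1, zero_smul]
    exact zero_mem _

end CellData

end BigHomology

end

/-! ### The iterated doubling and its homology. -/

noncomputable section

namespace BigHomology

open CategoryTheory Opposite
open SimplexCategory (δ σ)

namespace CellData

variable {e : ℕ} {D : CellData e}

theorem exists_eq_highCell (x : SimpSet.Simplex D.sset (e + 1))
    (hx : x ∈ D.sset.nonDegenerate (e + 1)) : ∃ b, x = highCell b := by
  rcases x with _ | ⟨a, s, hs⟩ | ⟨b, s, hs⟩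
  · exact absurd (pt_mem_degenerate e) hx
  · exact absurd (low_mem_degenerate a s hs (Nat.lt_succ_self e)) hx
  · obtain rfl := SimplexCategory.eq_id_of_epi s
    exact ⟨b, rfl⟩

/-- A chain in dimension `e` without the simplices `lowCell a` is a multiple of the base point. -/
theorem eq_smul_ptChain (c : SimpSet.Chain D.sset e) (hc : ∀ a, c (lowCell a) = 0) :
    c = SimpSet.augmentation D.sset e c • ptChain D e := by
  classical
  have h : c = c (Simp.pt : D.Simp (SimplexCategory.mk e)) • ptChain D e := by
    refine Finsupp.ext fun x => ?_
    rw [Finsupp.smul_apply, smul_eq_mul]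
    rcases x with _ | ⟨a, s, hs⟩ | ⟨b, s, hs⟩
    · exact (mul_one _).symm.trans (congrArg _ Finsupp.single_eq_same.symm)
    · obtain rfl := SimplexCategory.eq_id_of_epi s
      exact (hc a).trans (mul_eq_zero_of_right _
        (Finsupp.single_apply.trans (if_neg fun h => by cases h))).symm
    · have := SimplexCategory.le_of_epi s
      omega
  have h1 := congrArg (SimpSet.augmentation D.sset e) h
  rw [map_zsmul, augmentation_ptChain, smul_eq_mul, mul_one] at h1
  rw [h1]
  exact h

/-- A chain whose boundary does not contain the simplices `lowCell a` differs from a cycle by a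
multiple of the base point. -/
theorem exists_cycle (w : SimpSet.Chain D.sset (e + 1))
    (hw : ∀ a, SimpSet.bd D.sset e w (lowCell a) = 0) :
    ∃ z : SimpSet.Chain D.sset (e + 1), SimpSet.bd D.sset e z = 0 ∧
      ∀ b, z (highCell b) = w (highCell b) := by
  classical
  have h1 := eq_smul_ptChain _ hw
  rw [SimpSet.augmentation_bd] at h1
  refine ⟨w - SimpSet.augmentation D.sset (e + 1) w • ptChain D (e + 1), ?_, fun b => ?_⟩
  · rw [map_sub, map_zsmul, bd_ptChain, h1, smul_smul, mul_comm, sub_self]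
  · rw [Finsupp.sub_apply, Finsupp.smul_apply, sub_eq_self]
    exact smul_eq_zero_of_right _ (Finsupp.single_apply.trans (if_neg fun h => by cases h))

/-- Attaching data for `k` cells of dimension `e + 1`, each of which kills the difference of twice
a cell of dimension `e` and the next one. -/
def doubling (e k : ℕ) : CellData e where
  Low := Fin (k - 1)
  High := Fin k
  face i l :=
    if (l : ℕ) = 0 ∨ (l : ℕ) = 2 then
      if h : 1 ≤ (i : ℕ) then some ⟨i - 1, by omega⟩ else none
    else if (l : ℕ) = 1 then if h : (i : ℕ) < k - 1 then some ⟨i, h⟩ else none else none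

instance (e k : ℕ) : Fintype (doubling e k).Low := inferInstanceAs (Fintype (Fin (k - 1)))

instance (e k : ℕ) : Fintype (doubling e k).High := inferInstanceAs (Fintype (Fin k))

theorem doubling_face {e k : ℕ} (i : Fin k) (l : Fin (e + 2)) :
    (doubling e k).face i l = if (l : ℕ) = 0 ∨ (l : ℕ) = 2 then
      if h : 1 ≤ (i : ℕ) then some (⟨i - 1, by omega⟩ : Fin (k - 1)) else none
    else if (l : ℕ) = 1 then if h : (i : ℕ) < k - 1 then some ⟨i, h⟩ else none else none :=
  rfl

theorem doubling_face_zero {e k : ℕ} (i : Fin k) (l : Fin (e + 2)) (h : (l : ℕ) = 0 ∨ (l : ℕ) = 2)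
    (a : Fin (k - 1)) : (doubling e k).face i l = some a ↔ (i : ℕ) = a + 1 := by
  rw [doubling_face, if_pos h]
  split_ifs with h1
  · refine Option.some_inj.trans (Fin.ext_iff.trans ?_)
    simp only
    omega
  · refine iff_of_false (by simp) ?_
    omega

theorem doubling_face_one {e k : ℕ} (i : Fin k) (l : Fin (e + 2)) (h : (l : ℕ) = 1)
    (a : Fin (k - 1)) : (doubling e k).face i l = some a ↔ (i : ℕ) = a := by
  rw [doubling_face, if_neg (by omega), if_pos h]
  split_ifs with h1
  · exact Option.some_inj.trans Fin.ext_iff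
  · refine iff_of_false (by simp) ?_
    omega

theorem doubling_face_of_two_lt {e k : ℕ} (i : Fin k) (l : Fin (e + 2)) (h : 2 < (l : ℕ)) :
    (doubling e k).face i l = none := by
  rw [doubling_face, if_neg (by omega), if_neg (by omega)]
  rfl

/-- Faces `0` and `2` both count positively and face `1` negatively; `1 ≤ e` is what makes face `2`
exist. -/
theorem doubling_incidence {e k : ℕ} (he : 1 ≤ e) (i : Fin k) (a : Fin (k - 1))
    [∀ l, Decidable ((doubling e k).face i l = some a)] :
    ∑ l : Fin (e + 2), (-1 : ℤ) ^ (l : ℕ) *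
      (if (doubling e k).face i l = some a then 1 else 0) =
        2 * (if (i : ℕ) = a + 1 then 1 else 0) - if (i : ℕ) = a then 1 else 0 := by
  obtain ⟨r, rfl⟩ : ∃ r, e = r + 1 := ⟨e - 1, by omega⟩
  rw [Fin.sum_univ_succ, Fin.sum_univ_succ, Fin.sum_univ_succ, Finset.sum_eq_zero]
  · rw [if_congr (doubling_face_zero i _ (Or.inl rfl) a) rfl rfl,
      if_congr (doubling_face_one i _ rfl a) rfl rfl,
      if_congr (doubling_face_zero i _ (Or.inr rfl) a) rfl rfl]
    simp only [Fin.val_succ, Fin.val_zero]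
    ring
  · intro l _
    rw [if_neg, mul_zero]
    refine fun h => ?_
    have h1 := doubling_face_of_two_lt (k := k) i l.succ.succ.succ
      (by simp only [Fin.val_succ]; omega)
    exact Option.some_ne_none a (h.symm.trans h1)

theorem bd_doubling_apply {e k : ℕ} (he : 1 ≤ e)
    (c : SimpSet.Chain (doubling e k).sset (e + 1)) (a : Fin (k - 1)) :
    SimpSet.bd (doubling e k).sset e c (lowCell (D := doubling e k) a) =
      2 * c (highCell (D := doubling e k) (⟨a + 1, by omega⟩ : Fin k)) -
        c (highCell (D := doubling e k) (⟨a, by omega⟩ : Fin k)) := by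
  classical
  refine (bd_apply_lowCell c a).trans ?_
  have h : ∀ i : Fin k, c (highCell (D := doubling e k) i) *
      (2 * (if (i : ℕ) = a + 1 then 1 else 0) - if (i : ℕ) = a then 1 else 0) =
      (if i = ⟨a + 1, by omega⟩ then 2 * c (highCell (D := doubling e k) i) else 0) -
        (if i = ⟨a, by omega⟩ then c (highCell (D := doubling e k) i) else 0) := by
    intro i
    simp only [Fin.ext_iff]
    split_ifs <;> ring
  refine (Finset.sum_congr rfl fun i _ =>
    (congrArg (c (highCell i) * ·) (@doubling_incidence e k he i a (fun l => _))).trans (h i)).trans ?_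
  refine (Finset.sum_sub_distrib _ _).trans ?_
  exact congrArg₂ (· - ·)
    ((Finset.sum_ite_eq' (Finset.univ : Finset (Fin k)) _ _).trans (if_pos (Finset.mem_univ _)))
    ((Finset.sum_ite_eq' (Finset.univ : Finset (Fin k)) _ _).trans (if_pos (Finset.mem_univ _)))

/-- Vanishing of the boundary on the `i`-th low cell says that the `i`-th coefficient is twice the
next one. -/
theorem coeff_of_cycle {e k : ℕ} (he : 1 ≤ e) (c : SimpSet.Chain (doubling e (k + 1)).sset (e + 1))
    (hc : SimpSet.bd (doubling e (k + 1)).sset e c = 0) (i : Fin (k + 1)) :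
    c (highCell (D := doubling e (k + 1)) i) =
      2 ^ (k - i) * c (highCell (D := doubling e (k + 1)) (Fin.last k)) := by
  induction i using Fin.reverseInduction with
  | last => simp
  | cast i ih =>
    have h := bd_doubling_apply he c i
    rw [hc, Finsupp.zero_apply] at h
    have h1 : c (highCell (D := doubling e (k + 1)) i.castSucc) =
        2 * c (highCell (D := doubling e (k + 1)) i.succ) := by
      have : 2 * c (highCell (D := doubling e (k + 1)) i.succ) -
        c (highCell (D := doubling e (k + 1)) i.castSucc) = 0 := h.symm
      linarith
    rw [h1, ih, ← mul_assoc, ← pow_succ']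
    congr 2
    simp only [Fin.val_succ, Fin.val_castSucc]
    omega

theorem homology_doubling {e k : ℕ} (he : 1 ≤ e) :
    Nonempty (Homology (SimpSet.Chain (doubling e (k + 1)).sset)
      (SimpSet.bd (doubling e (k + 1)).sset) (e + 1) ≃+ ℤ) ∧
    ∀ z : cycles (SimpSet.Chain (doubling e (k + 1)).sset)
      (SimpSet.bd (doubling e (k + 1)).sset) (e + 1),
      Generates _ _ z → SimpSet.maxCoeff (doubling e (k + 1)).sset z.1 = 2 ^ k := by
  classical
  set D := doubling e (k + 1) with hD
  let last : D.High := Fin.last k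
  let φ : cycles (SimpSet.Chain D.sset) (SimpSet.bd D.sset) (e + 1) →+ ℤ :=
    (Finsupp.applyAddHom (highCell last)).comp (AddSubgroup.subtype _)
  have hφ : ∀ z, φ z = z.1 (highCell last) := fun _ => rfl
  have hcyc : ∀ z : cycles (SimpSet.Chain D.sset) (SimpSet.bd D.sset) (e + 1),
      SimpSet.bd D.sset e z.1 = 0 := fun z => z.2
  have hs : Function.Surjective φ := by
    -- These are the only coefficients compatible with `1` on the last cell. `w` itself may fail to
    -- be a cycle by a multiple of the base point, which `exists_cycle` removes.
    let w : SimpSet.Chain D.sset (e + 1) :=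
      ∑ i : Fin (k + 1), Finsupp.single (highCell (D := D) i) (2 ^ (k - i))
    have hw : ∀ i : Fin (k + 1), w (highCell (D := D) i) = 2 ^ (k - i) := by
      intro i
      rw [Finsupp.finsetSum_apply, Finset.sum_eq_single i, Finsupp.single_eq_same]
      · intro j _ hj
        exact Finsupp.single_apply.trans (if_neg fun h => hj (Simp.high.inj h).1)
      · exact fun h => absurd (Finset.mem_univ _) h
    obtain ⟨z, hz, hzw⟩ := exists_cycle w fun a => by
      refine (bd_doubling_apply he w a).trans ?_
      refine (congrArg₂ (fun x y => 2 * x - y) (hw _) (hw _)).trans ?_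
      have ha : (a : Fin k).1 < k := (a : Fin k).2
      obtain ⟨r, hr⟩ : ∃ r, k - (a : Fin k).1 = r + 1 := ⟨k - (a : Fin k).1 - 1, by omega⟩
      have hr' : k - ((a : Fin k).1 + 1) = r := by omega
      change 2 * (2 : ℤ) ^ (k - ((a : Fin k).1 + 1)) - 2 ^ (k - (a : Fin k).1) = 0
      rw [hr, hr', pow_succ]
      ring
    have h1 : φ ⟨z, hz⟩ = 1 := by
      rw [hφ]
      refine (hzw last).trans ((hw (Fin.last k)).trans ?_)
      simp
    exact fun m => ⟨m • ⟨z, hz⟩, by rw [map_zsmul, h1, smul_eq_mul, mul_one]⟩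
  -- A cycle vanishing on the last cell vanishes on all high cells, hence is a boundary; conversely
  -- boundaries vanish on high cells.
  have hk : φ.ker = boundaries (SimpSet.Chain D.sset) (SimpSet.bd D.sset) (e + 1) := by
    ext z
    rw [AddMonoidHom.mem_ker, hφ, boundaries, AddSubgroup.mem_addSubgroupOf]
    constructor
    · intro h
      refine mem_range_bd z.1 (fun b => ?_) (hcyc z)
      refine (coeff_of_cycle he z.1 (hcyc z) b).trans ?_
      exact mul_eq_zero_of_right _ h
    · rintro ⟨w, hw⟩
      rw [← hw]
      exact bd_apply_highCell w _
  obtain ⟨h1, h2⟩ := homology_of_ker_eq _ _ φ hs hk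
  refine ⟨h1, fun z hz => ?_⟩
  have h3 := h2 z hz
  rw [hφ] at h3
  have h4 : ∀ i : Fin (k + 1), (z.1 (highCell (D := D) i)).natAbs = 2 ^ (k - i) := fun i => by
    have h5 : z.1 (highCell (D := D) i) = _ := coeff_of_cycle he z.1 (hcyc z) i
    rw [h5, Int.natAbs_mul, Int.natAbs_pow]
    exact (congrArg _ h3).trans (mul_one _)
  rw [SimpSet.maxCoeff]
  refine le_antisymm (Finset.sup_le fun x hx => ?_) ?_
  · obtain ⟨b, rfl⟩ := exists_eq_highCell x (Finset.mem_filter.1 hx).2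
    exact (h4 b).trans_le (Nat.pow_le_pow_right (by norm_num) (Nat.sub_le _ _))
  · have h6 := h4 0
    rw [Fin.val_zero, Nat.sub_zero] at h6
    rw [← h6]
    refine Finset.le_sup (f := fun x => (z.1 x).natAbs) (Finset.mem_filter.2 ⟨?_, ?_⟩)
    · rw [Finsupp.mem_support_iff]
      intro h7
      rw [h7] at h6
      exact absurd h6.symm (by positivity)
    · exact highCell_mem_nonDegenerate _

end CellData

end BigHomology

end

noncomputable section

namespace BigHomology

open CategoryTheory Opposite
open SimplexCategory (δ σ)

/-! ### Facets of the standard simplex -/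

/-- The inclusion of the facet opposite to the vertex `i`. -/
def facet {n : ℕ} (i : Fin (n + 2)) : C(stdSimplex ℝ (Fin (n + 1)), stdSimplex ℝ (Fin (n + 2))) :=
  ⟨stdSimplex.map i.succAbove, stdSimplex.continuous_map _⟩

theorem map_apply {n m : ℕ} (f : Fin (n + 1) → Fin (m + 1)) (y : stdSimplex ℝ (Fin (n + 1)))
    (j : Fin (m + 1)) : stdSimplex.map f y j = ∑ i with f i = j, y i := by
  rw [stdSimplex.map_coe, FunOnFinite.linearMap_apply_apply]

theorem facet_apply_self {n : ℕ} (i : Fin (n + 2)) (y : stdSimplex ℝ (Fin (n + 1))) :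
    facet i y i = 0 := by
  refine (map_apply _ y i).trans (Finset.sum_eq_zero fun j hj => ?_)
  exact absurd (Finset.mem_filter.1 hj).2 (Fin.succAbove_ne i j)

theorem facet_apply_succAbove {n : ℕ} (i : Fin (n + 2)) (y : stdSimplex ℝ (Fin (n + 1)))
    (j : Fin (n + 1)) : facet i y (i.succAbove j) = y j := by
  refine (map_apply _ y _).trans ?_
  rw [Finset.filter_congr fun k _ => (Fin.succAbove_right_injective (p := i)).eq_iff,
    Finset.filter_eq', if_pos (Finset.mem_univ j), Finset.sum_singleton]

/-- A retraction of the inclusion of a facet. -/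
def facetRetract {n : ℕ} (i : Fin (n + 2)) :
    C(stdSimplex ℝ (Fin (n + 2)), stdSimplex ℝ (Fin (n + 1))) :=
  ⟨stdSimplex.map (Function.invFun i.succAbove), stdSimplex.continuous_map _⟩

theorem facetRetract_facet {n : ℕ} (i : Fin (n + 2)) (y : stdSimplex ℝ (Fin (n + 1))) :
    facetRetract i (facet i y) = y := by
  refine (stdSimplex.map_comp_apply _ _ y).trans ?_
  rw [Function.invFun_comp Fin.succAbove_right_injective, stdSimplex.map_id_apply]

theorem exists_facet_eq {n : ℕ} {x : stdSimplex ℝ (Fin (n + 2))} {i : Fin (n + 2)} (h : x i = 0) :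
    ∃ y, x = facet i y := by
  have hs : ∑ j, x (i.succAbove j) = 1 := by
    rw [← stdSimplex.sum_eq_one x, Fin.sum_univ_succAbove _ i, h, zero_add]
  refine ⟨⟨fun j => x (i.succAbove j), fun j => x.2.1 _, hs⟩, ?_⟩
  refine stdSimplex.ext (funext fun k => ?_)
  rcases eq_or_ne k i with rfl | hk
  · rw [h, facet_apply_self]
  · obtain ⟨j, rfl⟩ := Fin.exists_succAbove_eq hk
    rw [facet_apply_succAbove]
    rfl

namespace CellData

variable {e : ℕ} {D : CellData e}

/-! ### Maps out of the geometric realization -/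

variable (D) in
/-- The geometric realization. -/
abbrev Real : Type := SSet.toTop.obj D.sset

variable (D) in
/-- The data of a continuous map from the realization to `Z`. -/
structure TopCocone (Z : Type) [TopologicalSpace Z] where
  pt : Z
  low : D.Low → C(stdSimplex ℝ (Fin (e + 1)), Z)
  high : D.High → C(stdSimplex ℝ (Fin (e + 2)), Z)
  low_eq : ∀ a y, (∃ i, y i = 0) → low a y = pt
  high_facet : ∀ b l y, high b (facet l y) = (D.face b l).elim pt fun a => low a y

namespace TopCocone

variable {Z : Type} [TopologicalSpace Z] (c : D.TopCocone Z)

/-- The simplicial data corresponding to topological data. -/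
def toCocone : D.Cocone (TopCat.toSSet.obj (TopCat.of Z)) where
  pt := (TopCat.toSSetObjEquiv (TopCat.of Z) (op (SimplexCategory.mk 0))).symm
    (ContinuousMap.const _ c.pt)
  low a := (TopCat.toSSetObjEquiv (TopCat.of Z) (op (SimplexCategory.mk e))).symm (c.low a)
  high b := (TopCat.toSSetObjEquiv (TopCat.of Z) (op (SimplexCategory.mk (e + 1)))).symm (c.high b)
  low_map a n t ht := by
    refine (TopCat.toSSetObjEquiv (TopCat.of Z) _).injective (ContinuousMap.ext fun z => ?_)
    change c.low a (stdSimplex.map t z) = c.pt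
    rw [SimplexCategory.epi_iff_surjective, Function.Surjective, not_forall] at ht
    obtain ⟨i, hi⟩ := ht
    refine c.low_eq a _ ⟨i, (map_apply _ z i).trans (Finset.sum_eq_zero fun j hj => ?_)⟩
    exact absurd ⟨j, (Finset.mem_filter.1 hj).2⟩ hi
  high_δ b i := by
    refine (TopCat.toSSetObjEquiv (TopCat.of Z) _).injective (ContinuousMap.ext fun z => ?_)
    refine (c.high_facet b i z).trans ?_
    rcases D.face b i with _ | a
    · rfl
    · rfl

/-- The continuous map given by the data. -/
def desc : C(D.Real, Z) :=
  ((sSetTopAdj.homEquiv D.sset (TopCat.of Z)).symm c.toCocone.desc).hom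

end TopCocone

/-- The singular simplex of a simplex. -/
def charMap {n : ℕ} (x : SimpSet.Simplex D.sset n) : C(stdSimplex ℝ (Fin (n + 1)), D.Real) :=
  TopCat.toSSetObjEquiv (SSet.toTop.obj D.sset) (op (SimplexCategory.mk n))
    ((sSetTopAdj.unit.app D.sset).app (op (SimplexCategory.mk n)) x)

theorem charMap_map {n m : ℕ} (f : SimplexCategory.mk n ⟶ SimplexCategory.mk m)
    (x : SimpSet.Simplex D.sset m) (y : stdSimplex ℝ (Fin (n + 1))) :
    charMap (D.sset.map f.op x : SimpSet.Simplex D.sset n) y = charMap x (stdSimplex.map f y) := by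
  rw [charMap, charMap]
  have := ConcreteCategory.congr_hom ((sSetTopAdj.unit.app D.sset).naturality f.op) x
  exact congrArg (fun w => TopCat.toSSetObjEquiv (SSet.toTop.obj D.sset) _ w y) this

theorem apply_charMap {Z : TopCat.{0}} (f : SSet.toTop.obj D.sset ⟶ Z) {n : ℕ}
    (x : SimpSet.Simplex D.sset n) (y : stdSimplex ℝ (Fin (n + 1))) :
    f (charMap x y) = TopCat.toSSetObjEquiv Z (op (SimplexCategory.mk n))
      ((sSetTopAdj.homEquiv D.sset Z f).app (op (SimplexCategory.mk n)) x) y := by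
  rw [Adjunction.homEquiv_unit]
  rfl

variable (D) in
/-- The base point. -/
def base : D.Real :=
  charMap (n := 0) (Simp.pt : D.Simp (SimplexCategory.mk 0)) (default : stdSimplex ℝ (Fin 1))

theorem charMap_pt {n : ℕ} (y : stdSimplex ℝ (Fin (n + 1))) :
    charMap (n := n) (Simp.pt : D.Simp (SimplexCategory.mk n)) y = base D := by
  refine (charMap_map (SimplexCategory.const _ (SimplexCategory.mk 0) 0)
    (Simp.pt : D.Simp (SimplexCategory.mk 0)) y).trans ?_
  exact congrArg (charMap (n := 0) (Simp.pt : D.Simp (SimplexCategory.mk 0)))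
    (Subsingleton.elim (α := stdSimplex ℝ (Fin 1)) _ _)

/-- The characteristic map of a simplex of dimension `e`. -/
def lowMap (a : D.Low) : C(stdSimplex ℝ (Fin (e + 1)), D.Real) := charMap (lowCell a)

/-- The characteristic map of a simplex of dimension `e + 1`. -/
def highMap (b : D.High) : C(stdSimplex ℝ (Fin (e + 2)), D.Real) := charMap (highCell b)

theorem lowMap_eq_base (he : 1 ≤ e) (a : D.Low) {y : stdSimplex ℝ (Fin (e + 1))}
    (hy : ∃ i, y i = 0) : lowMap a y = base D := by
  obtain ⟨r, rfl⟩ : ∃ r, e = r + 1 := ⟨e - 1, by omega⟩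
  obtain ⟨i, hi⟩ := hy
  obtain ⟨y, rfl⟩ := exists_facet_eq hi
  refine (charMap_map (δ i) (lowCell a) y).symm.trans ?_
  rw [← redLow_eq_map, redLow_of_not_epi]
  · exact charMap_pt y
  · exact fun h => absurd (SimplexCategory.le_of_epi (δ i)) (by omega)

theorem highMap_facet (b : D.High) (l : Fin (e + 2)) (y : stdSimplex ℝ (Fin (e + 1))) :
    highMap b (facet l y) = (D.face b l).elim (base D) fun a => lowMap a y := by
  refine (charMap_map (δ l) (highCell b) y).symm.trans ?_
  rw [← redHigh_eq_map, ← Category.id_comp (δ l), redHigh_comp_δ]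
  rcases D.face b l with _ | a
  · exact charMap_pt y
  · change charMap (redLow a (𝟙 _)) y = _
    rw [redLow_of_epi _ _ inferInstance]
    rfl

namespace TopCocone

variable {Z : Type} [TopologicalSpace Z] (c : D.TopCocone Z)

theorem desc_charMap {n : ℕ} (x : SimpSet.Simplex D.sset n) (y : stdSimplex ℝ (Fin (n + 1))) :
    c.desc (charMap x y) = TopCat.toSSetObjEquiv (TopCat.of Z) (op (SimplexCategory.mk n))
      (c.toCocone.toFun x) y := by
  refine (apply_charMap ((sSetTopAdj.homEquiv D.sset (TopCat.of Z)).symm c.toCocone.desc) x y).trans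
    ?_
  rw [Equiv.apply_symm_apply]
  rfl

theorem desc_base : c.desc (base D) = c.pt :=
  c.desc_charMap _ _

theorem desc_lowMap (a : D.Low) (y : stdSimplex ℝ (Fin (e + 1))) :
    c.desc (lowMap a y) = c.low a y := by
  refine (c.desc_charMap _ y).trans ?_
  change c.low a (stdSimplex.map id y) = _
  rw [stdSimplex.map_id_apply]

theorem desc_highMap (b : D.High) (y : stdSimplex ℝ (Fin (e + 2))) :
    c.desc (highMap b y) = c.high b y := by
  refine (c.desc_charMap _ y).trans ?_
  change c.high b (stdSimplex.map id y) = _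
  rw [stdSimplex.map_id_apply]

end TopCocone

/-- By adjunction a map out of the realization is determined by its composites with the singular
simplices of `D.sset`, and these factor through the base point or a cell. -/
theorem hom_ext {Z : Type} [TopologicalSpace Z] {f g : C(D.Real, Z)} (h0 : f (base D) = g (base D))
    (h1 : ∀ a y, f (lowMap a y) = g (lowMap a y))
    (h2 : ∀ b y, f (highMap b y) = g (highMap b y)) : f = g := by
  have key : ∀ {n : ℕ} (x : SimpSet.Simplex D.sset n) (y : stdSimplex ℝ (Fin (n + 1))),
      f (charMap x y) = g (charMap x y) := by
    intro n x y
    rcases x with _ | ⟨a, s, hs⟩ | ⟨b, s, hs⟩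
    · have := charMap_pt (D := D) y
      exact ((congrArg f this).trans h0).trans (congrArg g this).symm
    · have : charMap (n := n) (Simp.low a s hs : D.Simp (SimplexCategory.mk n)) y =
          lowMap a (stdSimplex.map s y) := by
        rw [← redLow_of_epi a s hs, redLow_eq_map]
        exact charMap_map s (lowCell a) y
      exact ((congrArg f this).trans (h1 _ _)).trans (congrArg g this).symm
    · have : charMap (n := n) (Simp.high b s hs : D.Simp (SimplexCategory.mk n)) y =
          highMap b (stdSimplex.map s y) := by
        rw [← redHigh_of_epi b s hs, redHigh_eq_map]
        exact charMap_map s (highCell b) y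
      exact ((congrArg f this).trans (h2 _ _)).trans (congrArg g this).symm
  have h : (TopCat.ofHom f : SSet.toTop.obj D.sset ⟶ TopCat.of Z) = TopCat.ofHom g := by
    refine (sSetTopAdj.homEquiv D.sset (TopCat.of Z)).injective ?_
    ext n x
    obtain ⟨n⟩ := n
    induction n using SimplexCategory.rec with | _ n
    refine (TopCat.toSSetObjEquiv (TopCat.of Z) _).injective (ContinuousMap.ext fun y => ?_)
    refine (apply_charMap _ x y).symm.trans ((key x y).trans (apply_charMap _ x y))
  exact congrArg (fun w => TopCat.Hom.hom w) h

/-- The realization is covered by its closed cells. -/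
theorem exists_eq_cell (x : D.Real) :
    x = base D ∨ (∃ a y, x = lowMap a y) ∨ ∃ b y, x = highMap b y := by
  by_contra! h
  -- With the indiscrete topology on `Prop` every predicate is continuous. If `x` were on no cell,
  -- the predicates `w = x` and `False` would agree on all cells, hence everywhere.
  have := @hom_ext e D Prop ⊤ (@ContinuousMap.mk _ _ _ ⊤ (fun w => w = x) continuous_top)
    (@ContinuousMap.mk _ _ _ ⊤ (fun _ => False) continuous_top)
    (propext ⟨fun h' => h.1 h'.symm, False.elim⟩)
    (fun a y => propext ⟨fun h' => h.2.1 a y h'.symm, False.elim⟩)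
    (fun b y => propext ⟨fun h' => h.2.2 b y h'.symm, False.elim⟩)
  have h3 := @congrArg _ _ _ _ (fun w => @ContinuousMap.toFun _ _ _ ⊤ w x) this
  exact h3.mp rfl

end CellData

end BigHomology

end

noncomputable section

namespace BigHomology

open scoped unitInterval Topology
open CategoryTheory Opposite

/-! ### Pushing a simplex to its boundary -/

section Push

variable {n : ℕ}

/-- The flow on the simplex away from the point `p`, for time at most `κ`, stopping at the
boundary. -/
def radialMap (p : stdSimplex ℝ (Fin (n + 1))) (hp : ∀ i, 0 < p i) (κ : ℝ) (hκ : κ < 1) :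
    C(ℝ × stdSimplex ℝ (Fin (n + 1)), stdSimplex ℝ (Fin (n + 1))) where
  toFun q := ⟨radialPush p.1
      (min q.1 (min (radialWeight Finset.univ Finset.univ_nonempty p.1 q.2.1) κ)) q.2.1,
    radialPush_mem_stdSimplex (hS := Finset.univ_nonempty) (fun u _ => hp u)
      (fun u hu => absurd (Finset.mem_univ u) hu) p.2 q.2.2
      ((min_le_right _ _).trans (min_le_left _ _))
      ((min_le_right _ _).trans_lt ((min_le_right _ _).trans_lt hκ))⟩
  continuous_toFun := by
    have h1 : Continuous fun q : ℝ × stdSimplex ℝ (Fin (n + 1)) =>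
        min q.1 (min (radialWeight Finset.univ Finset.univ_nonempty p.1 q.2.1) κ) := by
      refine continuous_fst.min (Continuous.min ?_ continuous_const)
      exact (continuous_radialWeight _ _ _).comp (continuous_subtype_val.comp continuous_snd)
    refine Continuous.subtype_mk (continuous_pi fun u => ?_) _
    refine Continuous.mul (Continuous.inv₀ (continuous_const.sub h1) fun q => ?_) ?_
    · have : min q.1 (min (radialWeight Finset.univ Finset.univ_nonempty p.1 q.2.1) κ) < 1 :=
        (min_le_right _ _).trans_lt ((min_le_right _ _).trans_lt hκ)
      exact (sub_pos.2 this).ne'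
    · exact ((continuous_apply u).comp (continuous_subtype_val.comp continuous_snd)).sub
        (h1.mul continuous_const)

/-- The part of `p` in `x`. -/
abbrev weight (p x : stdSimplex ℝ (Fin (n + 1))) : ℝ :=
  radialWeight Finset.univ Finset.univ_nonempty p.1 x.1

variable {p : stdSimplex ℝ (Fin (n + 1))} (hp : ∀ i, 0 < p i)

include hp in
theorem weight_nonneg (x : stdSimplex ℝ (Fin (n + 1))) : 0 ≤ weight p x :=
  radialWeight_nonneg (fun u _ => hp u) x.2

include hp in
theorem weight_eq_zero {x : stdSimplex ℝ (Fin (n + 1))} {i : Fin (n + 1)} (hx : x i = 0) :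
    weight p x = 0 := by
  refine le_antisymm ?_ (weight_nonneg hp x)
  have h1 : weight p x * p.1 i ≤ x.1 i :=
    radialWeight_mul_le (hS := Finset.univ_nonempty) (fun u _ => hp u) (Finset.mem_univ i)
  have h2 : x.1 i = 0 := hx
  have h3 : 0 < p.1 i := hp i
  rw [h2] at h1
  nlinarith

include hp in
-- Removing the weight times `p` from `x` leaves nonnegative coordinates of total `1 - weight p x`,
-- so no coordinate of `x` differs from that of `p` by more than this.
theorem weight_le_one_sub_dist (x : stdSimplex ℝ (Fin (n + 1))) : weight p x ≤ 1 - dist x p := by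
  have h1 : ∀ u, weight p x * p.1 u ≤ x.1 u := fun u =>
    radialWeight_mul_le (hS := Finset.univ_nonempty) (fun u _ => hp u) (Finset.mem_univ u)
  have hs : ∑ u, (x.1 u - weight p x * p.1 u) = 1 - weight p x := by
    rw [Finset.sum_sub_distrib, ← Finset.mul_sum, x.2.2, p.2.2, mul_one]
  have hw : weight p x ≤ 1 := by
    have := Finset.sum_nonneg fun u (_ : u ∈ Finset.univ) => sub_nonneg.2 (h1 u)
    rw [hs] at this
    linarith
  have h2 : ∀ u, x.1 u - weight p x * p.1 u ≤ 1 - weight p x := fun u => by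
    rw [← hs]
    exact Finset.single_le_sum (f := fun u => x.1 u - weight p x * p.1 u)
      (fun u _ => sub_nonneg.2 (h1 u)) (Finset.mem_univ u)
  suffices h : dist x p ≤ 1 - weight p x by linarith
  refine (dist_pi_le_iff (sub_nonneg.2 hw)).2 fun u => ?_
  have h3 : p.1 u ≤ 1 := stdSimplex.le_one p u
  have h4 : 0 < p.1 u := hp u
  have h5 := h1 u
  have h6 := h2 u
  change |x.1 u - p.1 u| ≤ _
  rw [abs_le]
  constructor <;> nlinarith

theorem radialMap_of_eq_zero {κ : ℝ} (hκ : κ < 1) {c : ℝ} {x : stdSimplex ℝ (Fin (n + 1))}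
    (h : min c (min (weight p x) κ) = 0) : radialMap p hp κ hκ (c, x) = x := by
  refine Subtype.ext ?_
  change radialPush p.1 (min c (min (weight p x) κ)) x.1 = x.1
  rw [h, radialPush_zero]

theorem exists_radialMap_eq_zero {κ : ℝ} (hκ : κ < 1) {c : ℝ} {x : stdSimplex ℝ (Fin (n + 1))}
    (hc : weight p x ≤ c) (hx : weight p x ≤ κ) : ∃ u, radialMap p hp κ hκ (c, x) u = 0 := by
  obtain ⟨u, -, hu⟩ := exists_radialPush_eq_zero (hS := Finset.univ_nonempty) (fun u _ => hp u) x.1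
  refine ⟨u, ?_⟩
  change radialPush p.1 (min c (min (weight p x) κ)) x.1 u = 0
  rw [min_eq_left hx, min_eq_right hc]
  exact hu

/-- The flow on the simplex away from the facet opposite to `l`. -/
def hornMap (l : Fin (n + 2)) :
    C(I × stdSimplex ℝ (Fin (n + 2)), stdSimplex ℝ (Fin (n + 2))) where
  toFun q := ⟨hornPush (Finset.univ.erase l) ⟨l.succAbove 0, by simp [Fin.succAbove_ne]⟩ l q.1 q.2.1,
    hornPush_mem_stdSimplex _ (by simp) q.1.2.1 q.1.2.2 q.2.2⟩
  continuous_toFun := by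
    refine Continuous.subtype_mk ?_ _
    exact (continuous_hornPush (Finset.univ.erase l)
      ⟨l.succAbove 0, by simp [Fin.succAbove_ne]⟩ l).comp
      ((continuous_subtype_val.comp continuous_fst).prodMk
        (continuous_subtype_val.comp continuous_snd))

theorem hornMap_zero (l : Fin (n + 2)) (x : stdSimplex ℝ (Fin (n + 2))) :
    hornMap l (0, x) = x :=
  Subtype.ext (hornPush_zero _ _ _ _)

theorem hornMap_of_eq_zero {l l' : Fin (n + 2)} (hl : l' ≠ l) {x : stdSimplex ℝ (Fin (n + 2))}
    (hx : x l' = 0) (t : I) : hornMap l (t, x) = x := by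
  refine Subtype.ext (hornPush_of_inf_eq_zero _ (le_antisymm ?_ (inf_nonneg _ x.2)))
  exact (Finset.inf'_le _ (Finset.mem_erase.2 ⟨hl, Finset.mem_univ l'⟩)).trans_eq hx

theorem exists_hornMap_one_eq_zero (l : Fin (n + 2)) (x : stdSimplex ℝ (Fin (n + 2))) :
    ∃ l', l' ≠ l ∧ hornMap l (1, x) l' = 0 := by
  obtain ⟨u, hu, h⟩ := exists_hornPush_one_eq_zero (τ := Finset.univ.erase l)
    ⟨l.succAbove 0, by simp [Fin.succAbove_ne]⟩ (Finset.notMem_erase l _) x.1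
  exact ⟨u, Finset.ne_of_mem_erase hu, h⟩

end Push

/-- A homotopy given on the boundary of a simplex extends to the simplex. -/
theorem exists_homotopy_extension {Z : Type} [TopologicalSpace Z] {e : ℕ}
    (F : C(stdSimplex ℝ (Fin (e + 2)), Z)) (z : Z)
    (L : Fin (e + 2) → C(stdSimplex ℝ (Fin (e + 1)), C(I, Z)))
    (hL : ∀ l y, (∃ i, y i = 0) → L l y = ContinuousMap.const _ z)
    (hF : ∀ l y, F (facet l y) = L l y 0) :
    ∃ G : C(stdSimplex ℝ (Fin (e + 2)), C(I, Z)),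
      (∀ l y, G (facet l y) = L l y) ∧ ∀ x, G x 0 = F x := by
  classical
  -- `Q` assembles the homotopies on the facets; where two facets meet, both are constant at `z`.
  let Q : stdSimplex ℝ (Fin (e + 2)) → C(I, Z) := fun x =>
    if h : ∃ l, x l = 0 then L h.choose (facetRetract h.choose x) else ContinuousMap.const _ z
  have hz : ∀ l l' (x : stdSimplex ℝ (Fin (e + 2))), l' ≠ l → x l = 0 → x l' = 0 →
      L l (facetRetract l x) = ContinuousMap.const _ z := by
    intro l l' x hne h h'
    obtain ⟨y, rfl⟩ := exists_facet_eq h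
    obtain ⟨j, rfl⟩ := Fin.exists_succAbove_eq hne
    rw [facet_apply_succAbove] at h'
    exact hL _ _ ⟨j, by rw [facetRetract_facet]; exact h'⟩
  have hQ : ∀ l x, x l = 0 → Q x = L l (facetRetract l x) := by
    intro l x hx
    have h : ∃ l, x l = 0 := ⟨l, hx⟩
    simp only [Q, dif_pos h]
    by_cases hl : h.choose = l
    · rw [hl]
    · rw [hz _ l x (Ne.symm hl) h.choose_spec hx, hz l _ x hl hx h.choose_spec]
  have hQc : ContinuousOn Q (⋃ l, {x | x l = 0}) := by
    refine LocallyFinite.continuousOn_iUnion (locallyFinite_of_finite _) (fun l => ?_) fun l => ?_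
    · exact isClosed_eq ((continuous_apply l).comp continuous_subtype_val) continuous_const
    · exact ((L l).continuous.comp (facetRetract l).continuous).continuousOn.congr
        fun x hx => hQ l x hx
  let p : stdSimplex ℝ (Fin (e + 2)) := stdSimplex.barycenter
  have hp : ∀ i, 0 < p i := fun i => by
    change (0 : ℝ) < (Fintype.card (Fin (e + 2)) : ℝ)⁻¹
    positivity
  -- The bound `1 / 2` keeps the flow away from the barycentre, where the weight is `1` and the
  -- radial push is undefined.
  let R := radialMap p hp (1 / 2) (by norm_num)
  have hw : Continuous fun x : stdSimplex ℝ (Fin (e + 2)) => weight p x :=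
    (continuous_radialWeight _ _ _).comp continuous_subtype_val
  -- A point flows outwards at half speed. If it meets the boundary, at time twice its weight, it
  -- spends the remaining time in the prescribed homotopy there.
  let K : stdSimplex ℝ (Fin (e + 2)) × I → Z := fun q =>
    if (q.2 : ℝ) / 2 ≤ weight p q.1 then F (R ((q.2 : ℝ) / 2, q.1)) else
      Q (R (weight p q.1, q.1)) (Set.projIcc 0 1 zero_le_one ((q.2 : ℝ) - 2 * weight p q.1))
  have hle : ∀ q : stdSimplex ℝ (Fin (e + 2)) × I, weight p q.1 ≤ (q.2 : ℝ) / 2 →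
      ∃ l, R (weight p q.1, q.1) l = 0 := fun q hq =>
    exists_radialMap_eq_zero hp _ le_rfl (hq.trans (by linarith [q.2.2.2]))
  have hK : Continuous K := by
    refine continuous_if_le (by fun_prop) (hw.comp continuous_fst) ?_ ?_ ?_
    · exact (by fun_prop : Continuous fun q : stdSimplex ℝ (Fin (e + 2)) × I =>
        F (R ((q.2 : ℝ) / 2, q.1))).continuousOn
    · refine ContinuousEval.continuous_eval.comp_continuousOn (ContinuousOn.prodMk ?_ ?_)
      · refine hQc.comp (Continuous.continuousOn ?_) fun q hq => Set.mem_iUnion.2 (hle q hq)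
        exact R.continuous.comp ((hw.comp continuous_fst).prodMk continuous_fst)
      · exact ((continuous_projIcc (h := zero_le_one)).comp ((continuous_subtype_val.comp continuous_snd).sub
          (continuous_const.mul (hw.comp continuous_fst)))).continuousOn
    · intro q hq
      obtain ⟨l, hl⟩ := hle q hq.ge
      rw [hQ l _ hl, hq]
      obtain ⟨y, hy⟩ := exists_facet_eq hl
      rw [hy, facetRetract_facet, hF]
      congr 1
      rw [show (q.2 : ℝ) - 2 * weight p q.1 = 0 by linarith]
      exact (Set.projIcc_left _).symm
  refine ⟨ContinuousMap.curry ⟨K, hK⟩, fun l y => ContinuousMap.ext fun s => ?_, fun x => ?_⟩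
  · have hw0 : weight p (facet l y) = 0 := weight_eq_zero hp (facet_apply_self l y)
    change K (facet l y, s) = _
    simp only [K]
    split_ifs with h
    · rw [hw0] at h
      have h' : (s : ℝ) ≤ 0 := by linarith
      have hs : s = 0 := Subtype.ext (le_antisymm h' s.2.1)
      subst hs
      have : R (((0 : I) : ℝ) / 2, facet l y) = facet l y :=
        radialMap_of_eq_zero hp _ (by rw [hw0]; norm_num)
      rw [this, hF]
    · have : R (weight p (facet l y), facet l y) = facet l y :=
        radialMap_of_eq_zero hp _ (by rw [hw0]; norm_num)
      rw [this, hQ l _ (facet_apply_self l y), facetRetract_facet, hw0, mul_zero, sub_zero,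
        Set.projIcc_val]
  · have h0 := weight_nonneg hp x
    change K (x, 0) = _
    simp only [K]
    have : R (((0 : I) : ℝ) / 2, x) = x := radialMap_of_eq_zero hp _ (by
      rw [Set.Icc.coe_zero, zero_div]
      exact min_eq_left (le_min h0 (by norm_num)))
    rw [if_pos (by rw [Set.Icc.coe_zero, zero_div]; exact h0), this]

/-- A map into the path space is a homotopy. -/
theorem homotopic_of_path {X Z : Type} [TopologicalSpace X] [TopologicalSpace Z]
    (H : C(X, C(I, Z))) {f g : C(X, Z)} (h0 : ∀ x, H x 0 = f x) (h1 : ∀ x, H x 1 = g x) :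
    f.Homotopic g :=
  ⟨{ toFun := fun q => H q.2 q.1
     continuous_toFun := ContinuousEval.continuous_eval.comp
      ((H.continuous.comp continuous_snd).prodMk continuous_fst)
     map_zero_left := h0
     map_one_left := h1 }⟩

end BigHomology

end

/-! ### Collapsing cells, and connectivity of the simplicial sets. -/

noncomputable section

namespace BigHomology

open scoped unitInterval Topology
open CategoryTheory Opposite

namespace CellData

variable {e : ℕ} {D : CellData e}

/-- If the faces of the cell `b₀` other than the `l₀`-th are collapsed by `g`, then `g` can be
deformed to a map collapsing `b₀`, without changing it on the cells not adjacent to that face. -/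
theorem exists_collapse (he : 1 ≤ e) {b₀ : D.High} {a₀ : D.Low} {l₀ : Fin (e + 2)}
    (h₀ : D.face b₀ l₀ = some a₀) (hne : ∀ l, l ≠ l₀ → D.face b₀ l ≠ some a₀)
    (g : C(D.Real, D.Real)) (hg : g (base D) = base D)
    (hgl : ∀ l a, l ≠ l₀ → D.face b₀ l = some a → ∀ y, g (lowMap a y) = base D) :
    ∃ g' : C(D.Real, D.Real), g.Homotopic g' ∧ g' (base D) = base D ∧
      (∀ y, g' (highMap b₀ y) = base D) ∧
      ∀ b, (∀ l, D.face b l ≠ some a₀) → ∀ y, g' (highMap b y) = g (highMap b y) := by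
  classical
  let T := D.Real
  -- `P₀` pushes the cell `b₀` into its facets other than the `l₀`-th, which `g` collapses. Its
  -- restriction to the `l₀`-th facet deforms `a₀` to the base point.
  let P₀ : C(stdSimplex ℝ (Fin (e + 2)), C(I, T)) :=
    ContinuousMap.curry ((g.comp (highMap b₀)).comp
      ((hornMap l₀).comp ⟨Prod.swap, continuous_swap⟩))
  have hP₀ : ∀ x s, P₀ x s = g (highMap b₀ (hornMap l₀ (s, x))) := fun _ _ => rfl
  let k : D.Low → C(stdSimplex ℝ (Fin (e + 1)), C(I, T)) := fun a =>
    if a = a₀ then P₀.comp (facet l₀) else ContinuousMap.const'.comp (g.comp (lowMap a))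
  have hk : ∀ a, a ≠ a₀ → ∀ y s, k a y s = g (lowMap a y) := fun a ha y s => by
    simp only [k, if_neg ha]
    rfl
  have hk₀ : ∀ y s, k a₀ y s = g (highMap b₀ (hornMap l₀ (s, facet l₀ y))) := fun y s => by
    simp only [k, if_true]
    rfl
  have hkb : ∀ a y, (∃ i, y i = 0) → k a y = ContinuousMap.const _ (base D) := by
    rintro a y ⟨i, hi⟩
    refine ContinuousMap.ext fun s => ?_
    by_cases ha : a = a₀
    · subst ha
      rw [hk₀, hornMap_of_eq_zero (l' := l₀.succAbove i) (Fin.succAbove_ne _ _)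
        ((facet_apply_succAbove _ _ _).trans hi), highMap_facet, h₀]
      refine (congrArg g (lowMap_eq_base he a ⟨i, hi⟩)).trans hg
    · rw [hk a ha, lowMap_eq_base he a ⟨i, hi⟩, hg]
      rfl
  have hk0 : ∀ a y, k a y 0 = g (lowMap a y) := fun a y => by
    by_cases ha : a = a₀
    · subst ha
      rw [hk₀, hornMap_zero, highMap_facet, h₀]
      rfl
    · exact hk a ha y 0
  let L : ∀ (b : D.High) (l : Fin (e + 2)), C(stdSimplex ℝ (Fin (e + 1)), C(I, T)) := fun b l =>
    (D.face b l).elim (ContinuousMap.const _ (ContinuousMap.const _ (base D))) k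
  have hL : ∀ b l y, (∃ i, y i = 0) → L b l y = ContinuousMap.const _ (base D) := by
    intro b l y hy
    simp only [L]
    rcases D.face b l with _ | a
    · rfl
    · exact hkb a y hy
  have hLF : ∀ b l y, (g.comp (highMap b)) (facet l y) = L b l y 0 := by
    intro b l y
    rw [ContinuousMap.comp_apply, highMap_facet]
    simp only [L]
    rcases D.face b l with _ | a
    · exact hg
    · exact (hk0 a y).symm
  have hex : ∀ b : D.High, ∃ G : C(stdSimplex ℝ (Fin (e + 2)), C(I, T)),
      (∀ l y, G (facet l y) = L b l y) ∧ (∀ x, G x 0 = g (highMap b x)) ∧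
      (b = b₀ → ∀ x, G x 1 = base D) ∧
      ((∀ l, D.face b l ≠ some a₀) → ∀ x, G x 1 = g (highMap b x)) := by
    intro b
    by_cases hb : b = b₀
    · subst hb
      refine ⟨P₀, fun l y => ContinuousMap.ext fun s => ?_, fun x => ?_, fun _ x => ?_,
        fun h => absurd h₀ (h l₀)⟩
      · by_cases hl : l = l₀
        · subst hl
          rw [hP₀]
          simp only [L, h₀, Option.elim_some]
          exact (hk₀ y s).symm
        · rw [hP₀, hornMap_of_eq_zero hl (facet_apply_self l y), highMap_facet]
          simp only [L]
          rcases hf : D.face b l with _ | a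
          · exact hg
          · refine (hk a (fun h => hne l hl (hf.trans (congrArg some h))) y s).symm
      · rw [hP₀, hornMap_zero]
      · obtain ⟨l, hl, h⟩ := exists_hornMap_one_eq_zero l₀ x
        obtain ⟨y, hy⟩ := exists_facet_eq h
        rw [hP₀, hy, highMap_facet]
        rcases hf : D.face b l with _ | a
        · exact hg
        · exact hgl l a hl hf y
    · by_cases hf : ∀ l, D.face b l ≠ some a₀
      · refine ⟨ContinuousMap.const'.comp (g.comp (highMap b)),
          fun l y => ContinuousMap.ext fun s => ?_, fun x => rfl, fun h => absurd h hb,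
          fun _ x => rfl⟩
        change g (highMap b (facet l y)) = _
        rw [highMap_facet]
        simp only [L]
        rcases hfl : D.face b l with _ | a
        · exact hg
        · exact (hk a (fun h => hf l (hfl.trans (congrArg some h))) y s).symm
      -- Another cell having `a₀` as a face cannot stay fixed; the homotopy on its boundary is
      -- extended over it.
      · obtain ⟨G, hG, hG0⟩ := exists_homotopy_extension (g.comp (highMap b)) (base D) (L b)
          (hL b) (hLF b)
        exact ⟨G, hG, hG0, fun h => absurd h hb, fun h => absurd h hf⟩
  choose G hG using hex
  -- Homotopies on the cells glue when regarded as maps into the path space, by the universal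
  -- property of the realization; no product with `I` has to be realized.
  let c : D.TopCocone C(I, T) :=
    { pt := ContinuousMap.const _ (base D)
      low := k
      high := G
      low_eq := hkb
      high_facet := fun b l y => by
        rw [(hG b).1]
        simp only [L]
        rcases D.face b l with _ | a <;> rfl }
  let g' : C(T, T) := (⟨fun w : C(I, T) => w 1, continuous_eval_const 1⟩ :
    C(C(I, T), T)).comp c.desc
  have hg' : ∀ x, g' x = c.desc x 1 := fun _ => rfl
  have h0 : (⟨fun w : C(I, T) => w 0, continuous_eval_const 0⟩ :
      C(C(I, T), T)).comp c.desc = g := by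
    refine hom_ext ?_ (fun a y => ?_) fun b y => ?_
    · change c.desc (base D) 0 = _
      rw [c.desc_base]
      exact hg.symm
    · change c.desc (lowMap a y) 0 = _
      rw [c.desc_lowMap]
      exact hk0 a y
    · change c.desc (highMap b y) 0 = _
      rw [c.desc_highMap]
      exact (hG b).2.1 y
  refine ⟨g', homotopic_of_path c.desc (fun x => DFunLike.congr_fun h0 x) fun x => rfl, ?_,
    fun y => ?_, fun b hb y => ?_⟩
  · rw [hg', c.desc_base]
    rfl
  · rw [hg', c.desc_highMap]
    exact (hG b₀).2.2.1 rfl y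
  · rw [hg', c.desc_highMap]
    exact (hG b).2.2.2 hb y

/-- The cell `b` is a top cell if all the others can be collapsed by a deformation. -/
theorem isTopCell_highMap (he : 1 ≤ e) (b : D.High) (g : C(D.Real, D.Real))
    (hg : (ContinuousMap.id D.Real).Homotopic g) (hg0 : g (base D) = base D)
    (hgl : ∀ a y, g (lowMap a y) = base D) (hgh : ∀ b', b' ≠ b → ∀ y, g (highMap b' y) = base D) :
    IsTopCell (highMap b) := by
  classical
  constructor
  · intro Z _ f z hf
    let c : D.TopCocone Z :=
      { pt := z
        low := fun _ => ContinuousMap.const _ z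
        high := fun b' => if b' = b then f else ContinuousMap.const _ z
        low_eq := fun _ _ _ => rfl
        high_facet := fun b' l y => by
          have h1 : ((D.face b' l).elim z fun a => (ContinuousMap.const _ z :
              C(stdSimplex ℝ (Fin (e + 1)), Z)) y) = z := by
            rcases D.face b' l with _ | a <;> rfl
          rw [h1]
          split_ifs
          · exact hf _ ⟨l, facet_apply_self l y⟩
          · rfl }
    refine ⟨c.desc, fun y => ?_, fun x hx => ?_⟩
    · rw [c.desc_highMap]
      simp [c]
    · rcases exists_eq_cell x with rfl | ⟨a, y, rfl⟩ | ⟨b', y, rfl⟩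
      · exact c.desc_base
      · exact c.desc_lowMap a y
      · rw [c.desc_highMap]
        by_cases hb : b' = b
        · subst hb
          simp only [c, if_true]
          refine hf y ?_
          by_contra! h
          exact hx y h rfl
        · simp [c, hb]
  · intro p hp ε hε
    -- Points at distance at least `ε` from `p` have weight at most `1 - ε ≤ κ`, so the flow takes
    -- them all the way to the boundary; the minimum with `1` keeps `κ` nonnegative.
    let κ : ℝ := 1 - min ε 1
    have hκ : κ < 1 := by
      have : 0 < min ε 1 := lt_min hε one_pos
      simp only [κ]
      linarith
    have hκ0 : 0 ≤ κ := sub_nonneg.2 (min_le_right _ _)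
    let R := radialMap p hp κ hκ
    have hRb : ∀ y, (∃ i, y i = 0) → ∀ s : I, R ((s : ℝ), y) = y := by
      rintro y ⟨i, hi⟩ s
      refine radialMap_of_eq_zero hp hκ ?_
      rw [weight_eq_zero hp hi, min_eq_left hκ0, min_eq_right s.2.1]
    let push : C(stdSimplex ℝ (Fin (e + 2)), C(I, D.Real)) :=
      ContinuousMap.curry ((highMap b).comp (R.comp
        ⟨fun q => ((q.2 : ℝ), q.1), by fun_prop⟩))
    have hpush : ∀ y s, push y s = highMap b (R ((s : ℝ), y)) := fun _ _ => rfl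
    let c : D.TopCocone C(I, D.Real) :=
      { pt := ContinuousMap.const _ (base D)
        low := fun a => ContinuousMap.const'.comp (lowMap a)
        high := fun b' => if b' = b then push else ContinuousMap.const'.comp (highMap b')
        low_eq := fun a y hy => congrArg (ContinuousMap.const I) (lowMap_eq_base he a hy)
        high_facet := fun b' l y => by
          refine ContinuousMap.ext fun s => ?_
          have h1 : ((D.face b' l).elim (ContinuousMap.const _ (base D)) fun a =>
              (ContinuousMap.const'.comp (lowMap a) :
                C(stdSimplex ℝ (Fin (e + 1)), C(I, D.Real))) y) s = highMap b' (facet l y) := by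
            rw [highMap_facet]
            rcases D.face b' l with _ | a <;> rfl
          rw [h1]
          split_ifs with hb
          · rw [hpush, hRb _ ⟨l, facet_apply_self l y⟩, hb]
          · rfl }
    let r : C(D.Real, D.Real) := (⟨fun w : C(I, D.Real) => w 1,
      continuous_eval_const 1⟩ : C(C(I, D.Real), D.Real)).comp c.desc
    have hr : ∀ x, r x = c.desc x 1 := fun _ => rfl
    have h0 : (⟨fun w : C(I, D.Real) => w 0, continuous_eval_const 0⟩ :
        C(C(I, D.Real), D.Real)).comp c.desc = ContinuousMap.id _ := by
      refine hom_ext ?_ (fun a y => ?_) fun b' y => ?_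
      · change c.desc (base D) 0 = _
        rw [c.desc_base]
        rfl
      · change c.desc (lowMap a y) 0 = _
        rw [c.desc_lowMap]
        rfl
      · change c.desc (highMap b' y) 0 = _
        rw [c.desc_highMap]
        simp only [c]
        split_ifs with hb
        · subst hb
          rw [hpush]
          refine congrArg _ (radialMap_of_eq_zero hp hκ ?_)
          exact min_eq_left (le_min (weight_nonneg hp y) hκ0)
        · rfl
    -- `r` sends the complement of the ball into the union of the boundary of `b` and the other
    -- cells, all of which `g` collapses.
    have hidr : (ContinuousMap.id D.Real).Homotopic (g.comp r) := by
      refine (homotopic_of_path c.desc (fun x => DFunLike.congr_fun h0 x)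
        (fun x => rfl) : (ContinuousMap.id D.Real).Homotopic r).trans ?_
      have := hg.comp (ContinuousMap.Homotopic.refl r)
      rwa [ContinuousMap.id_comp] at this
    have hfacet : ∀ y : stdSimplex ℝ (Fin (e + 2)), (∃ i, y i = 0) →
        g (highMap b y) = base D := by
      rintro y ⟨i, hi⟩
      obtain ⟨y, rfl⟩ := exists_facet_eq hi
      rw [highMap_facet]
      rcases D.face b i with _ | a
      · exact hg0
      · exact hgl a y
    refine ⟨base D, ?_⟩
    have := hidr.comp (ContinuousMap.Homotopic.refl
      (⟨Subtype.val, continuous_subtype_val⟩ :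
        C({x : D.Real // ∀ y, dist y p < ε → highMap b y ≠ x}, D.Real)))
    rw [ContinuousMap.id_comp] at this
    convert this using 1
    refine ContinuousMap.ext fun x => ?_
    obtain ⟨x, hx⟩ := x
    change base D = g (r x)
    rw [hr]
    symm
    rcases exists_eq_cell x with rfl | ⟨a, y, rfl⟩ | ⟨b', y, rfl⟩
    · rw [c.desc_base]
      exact hg0
    · rw [c.desc_lowMap]
      exact hgl a y
    · rw [c.desc_highMap]
      by_cases hb : b' = b
      · subst hb
        simp only [c, if_true]
        rw [hpush]
        refine hfacet _ (exists_radialMap_eq_zero hp hκ ?_ ?_)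
        · have := weight_le_one_sub_dist hp y
          have := dist_nonneg (x := y) (y := p)
          rw [Set.Icc.coe_one]
          linarith
        · have h1 := weight_le_one_sub_dist hp y
          have h2 : ε ≤ dist y p := not_lt.1 fun h => hx y h rfl
          have h3 : min ε 1 ≤ ε := min_le_left _ _
          simp only [κ]
          linarith
      · simp only [c, if_neg hb]
        exact hgh b' hb y

/-! ### The iterated doubling -/

/-- Cells are collapsed in increasing order. Face `1` of cell `j` is the `j`-th low cell; its other
nontrivial faces are the preceding low cell, already collapsed as a face of cell `j - 1`. Cells
before `j` do not meet the `j`-th low cell and stay collapsed. -/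
theorem exists_collapse_doubling {e k : ℕ} (he : 1 ≤ e) (j : ℕ) (hj : j ≤ k) :
    ∃ g : C((doubling e (k + 1)).Real, (doubling e (k + 1)).Real),
      (ContinuousMap.id _).Homotopic g ∧ g (base _) = base _ ∧
      ∀ i : Fin (k + 1), (i : ℕ) < j →
        ∀ y, g (highMap (D := doubling e (k + 1)) i y) = base _ := by
  induction j with
  | zero => exact ⟨ContinuousMap.id _, ContinuousMap.Homotopic.refl _, rfl,
      fun i hi => absurd hi (Nat.not_lt_zero _)⟩
  | succ j ih =>
    obtain ⟨g, hg, hg0, hgh⟩ := ih (by omega)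
    have h1 : ((1 : Fin (e + 2)) : ℕ) = 1 := rfl
    let b₀ : Fin (k + 1) := ⟨j, by omega⟩
    let a₀ : Fin k := ⟨j, by omega⟩
    obtain ⟨g', hgg', hg'0, hg'b, hg'⟩ := exists_collapse (D := doubling e (k + 1)) he
      (b₀ := b₀) (a₀ := a₀) (l₀ := 1)
      ((doubling_face_one b₀ 1 h1 a₀).2 rfl)
      (fun l hl h => by
        have hl1 : (l : ℕ) ≠ 1 := fun h' => hl (Fin.ext h')
        by_cases hl2 : (l : ℕ) = 0 ∨ (l : ℕ) = 2
        · have := (doubling_face_zero b₀ l hl2 a₀).1 h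
          simp only [b₀, a₀] at this
          omega
        · exact Option.some_ne_none _ (h.symm.trans (doubling_face_of_two_lt b₀ l (by omega))))
      g hg0 (fun l a hl h y => by
        have hl1 : (l : ℕ) ≠ 1 := fun h' => hl (Fin.ext h')
        by_cases hl2 : (l : ℕ) = 0 ∨ (l : ℕ) = 2
        · have ha : j = (a : Fin k).1 + 1 := (doubling_face_zero b₀ l hl2 a).1 h
          have h2 := highMap_facet (D := doubling e (k + 1))
            (⟨(a : Fin k).1, by omega⟩ : Fin (k + 1)) 1 y
          rw [(doubling_face_one (⟨(a : Fin k).1, by omega⟩ : Fin (k + 1)) 1 h1 a).2 rfl] at h2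
          refine (congrArg g h2).symm.trans (hgh _ ?_ _)
          simp only
          omega
        · exact absurd (h.symm.trans (doubling_face_of_two_lt b₀ l (by omega)))
            (Option.some_ne_none _))
    refine ⟨g', hg.trans hgg', hg'0, fun i hi y => ?_⟩
    rcases Nat.lt_succ_iff_lt_or_eq.1 hi with h | h
    · refine (hg' i (fun l hl => ?_) y).trans (hgh i h y)
      by_cases hl1 : (l : ℕ) = 1
      · have : (i : ℕ) = j := (doubling_face_one i l hl1 a₀).1 hl
        omega
      · by_cases hl2 : (l : ℕ) = 0 ∨ (l : ℕ) = 2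
        · have : (i : ℕ) = j + 1 := (doubling_face_zero i l hl2 a₀).1 hl
          omega
        · exact Option.some_ne_none _ (hl.symm.trans (doubling_face_of_two_lt i l (by omega)))
    · obtain rfl : i = b₀ := Fin.ext h
      exact hg'b y

/-- Every low cell is face `1` of a cell before the last, so collapsing these leaves only the last
cell, which is then a top cell. -/
theorem isNConnected_doubling {e k : ℕ} (he : 1 ≤ e) :
    IsNConnected e (doubling e (k + 1)).Real := by
  obtain ⟨g, hg, hg0, hgh⟩ := exists_collapse_doubling (k := k) he k le_rfl
  have h1 : ((1 : Fin (e + 2)) : ℕ) = 1 := rfl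
  refine (isTopCell_highMap (D := doubling e (k + 1)) he (Fin.last k) g hg hg0
    (fun a y => ?_) fun b hb y => ?_).isNConnected (Nat.succ_pos e)
  · have h2 := highMap_facet (D := doubling e (k + 1)) (Fin.castSucc (a : Fin k)) 1 y
    rw [(doubling_face_one (k := k + 1) (Fin.castSucc (a : Fin k)) 1 h1 a).2 rfl] at h2
    exact (congrArg g h2).symm.trans (hgh _ (a : Fin k).2 _)
  · exact hgh b (Fin.val_lt_last hb) y

end CellData

/-- Simplicial sets with exponentially large generators of their homology. -/
theorem exists_simplicialSets {d : ℕ} (hd : 2 ≤ d) :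
    ∃ (X : ℕ → SSet.{0}) (c : ℕ) (a b : ℝ),
      0 < a ∧ 1 < b ∧ ∀ k, 1 ≤ k →
        (X k).Finite ∧
        SimpSet.HasDim (X k) d ∧
        IsNConnected (d - 1) (SSet.toTop.obj (X k)) ∧
        SimpSet.IsReduced (X k) (d - 2) ∧
        Nonempty (Homology (SimpSet.Chain (X k)) (SimpSet.bd (X k)) d ≃+ ℤ) ∧
        k ≤ SimpSet.size (X k) ∧ SimpSet.size (X k) ≤ c * k ∧
        ∀ z : cycles (SimpSet.Chain (X k)) (SimpSet.bd (X k)) d,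
          Generates _ _ z →
            SimpSet.maxCoeff (X k) z.1 = 2 ^ (k - 1) ∧
            a * b ^ SimpSet.size (X k) ≤ (SimpSet.maxCoeff (X k) z.1 : ℝ) := by
  obtain ⟨e, rfl⟩ : ∃ e, d = e + 1 := ⟨d - 1, by omega⟩
  have he : 1 ≤ e := by omega
  -- The factor `2` bounds the number of nondegenerate simplices by `2 * k`: one vertex, `k - 1` low
  -- and `k` high cells. The constant `1 / 2` below compensates for the maximum being `2 ^ (k - 1)`
  -- instead of `2 ^ k`.
  let c := (1 + (e + 2) * (e + 2)) * 2
  obtain ⟨b, hb, hbk⟩ := exists_base c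
  refine ⟨fun k => (CellData.doubling e k).sset, c, 1 / 2, b, by norm_num, hb, fun k hk => ?_⟩
  obtain ⟨k, rfl⟩ : ∃ r, k = r + 1 := ⟨k - 1, by omega⟩
  have hl : Nat.card (CellData.doubling e (k + 1)).Low = k := Nat.card_fin k
  have hh : Nat.card (CellData.doubling e (k + 1)).High = k + 1 := Nat.card_fin (k + 1)
  have : Nonempty (CellData.doubling e (k + 1)).High := ⟨(0 : Fin (k + 1))⟩
  obtain ⟨h1, h2⟩ := CellData.homology_doubling (k := k) he
  have hs : SimpSet.size (CellData.doubling e (k + 1)).sset ≤ c * (k + 1) := by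
    refine (CellData.size_le _).trans ?_
    rw [hl, hh, mul_assoc]
    exact Nat.mul_le_mul_left _ (by omega)
  refine ⟨CellData.sset_finite _, CellData.hasDim _, CellData.isNConnected_doubling he,
    CellData.isReduced _ _ (by omega), h1, ?_, hs, fun z hz => ⟨h2 z hz, ?_⟩⟩
  · have := CellData.card_high_le_size (CellData.doubling e (k + 1))
    rwa [hh] at this
  · rw [h2 z hz]
    have := hbk (k + 1) _ hs
    rw [pow_succ] at this
    push_cast
    linarith

end BigHomology

end

theorem lemmal (d : ℕ) (hd : 2 ≤ d) :
    (∃ (m : ℕ → ℕ) (X : ∀ k, AbstractSimplicialComplex (Fin (m k))) (c : ℕ) (a b : ℝ),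
      0 < a ∧ 1 < b ∧ ∀ k, 1 ≤ k →
        BigHomology.Complex.HasDim (X k) d ∧
        BigHomology.IsNConnected (d - 1) (BigHomology.Complex.Realization (X k)) ∧
        Nonempty (BigHomology.Homology (BigHomology.Complex.Chain (X k))
          (BigHomology.Complex.bd (X k)) d ≃+ ℤ) ∧
        k ≤ BigHomology.Complex.size (X k) ∧ BigHomology.Complex.size (X k) ≤ c * k ∧
        ∀ z : BigHomology.cycles (BigHomology.Complex.Chain (X k))
            (BigHomology.Complex.bd (X k)) d,
          BigHomology.Generates _ _ z →
            BigHomology.Complex.maxCoeff (X k) z.1 = 2 ^ k ∧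
            a * b ^ BigHomology.Complex.size (X k) ≤
              (BigHomology.Complex.maxCoeff (X k) z.1 : ℝ)) ∧
    (∃ (X : ℕ → SSet.{0}) (c : ℕ) (a b : ℝ),
      0 < a ∧ 1 < b ∧ ∀ k, 1 ≤ k →
        (X k).Finite ∧
        BigHomology.SimpSet.HasDim (X k) d ∧
        BigHomology.IsNConnected (d - 1) (SSet.toTop.obj (X k)) ∧
        BigHomology.SimpSet.IsReduced (X k) (d - 2) ∧
        Nonempty (BigHomology.Homology (BigHomology.SimpSet.Chain (X k))
          (BigHomology.SimpSet.bd (X k)) d ≃+ ℤ) ∧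
        k ≤ BigHomology.SimpSet.size (X k) ∧ BigHomology.SimpSet.size (X k) ≤ c * k ∧
        ∀ z : BigHomology.cycles (BigHomology.SimpSet.Chain (X k))
            (BigHomology.SimpSet.bd (X k)) d,
          BigHomology.Generates _ _ z →
            BigHomology.SimpSet.maxCoeff (X k) z.1 = 2 ^ (k - 1) ∧
            a * b ^ BigHomology.SimpSet.size (X k) ≤
              (BigHomology.SimpSet.maxCoeff (X k) z.1 : ℝ)) := by
  exact ⟨BigHomology.exists_complexes hd, BigHomology.exists_simplicialSets hd⟩
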